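/- Let $M$ be a (connected) smooth Riemannian surface with Riemannian distance $d$, and let $U\subset M$ be a totally normal neighbourhood: $U$ is open and there is $\delta>0$ such that for every $p\in U$ the exponential map $\exp_p$ is a smooth diffeomorphism from the ball $B_\delta(0)\subset T_pM$ onto an open set containing $U$. Let $\gamma:\mathbb R\to U$ be a $C^2$ curve parametrized by arc length, and put $H(s,s')=d(\gamma(s),\gamma(s'))$. Let $s_0,s_1$ be parameters with $\gamma(s_0)\neq\gamma(s_1)$, write $\ell=H(s_0,s_1)$, let $\sigma:[0,\ell]\to M$ be the unit speed geodesic from $\gamma(s_0)$ to $\gamma(s_1)$, and let $J:[0,\ell]\to\mathbb R$ be the Jacobi field along it with $J(0)=0$, $J'(0)=1$, that is, the solution of $J''(t)+K(\sigma(t))J(t)=0$ with these initial values, where $K$ is the Gaussian curvature. Let $(b_0,b_1)$ be any orthonormal basis of $T_{\gamma(s_0)}M$ and let $\Phi(r,\theta)=\exp_{\gamma(s_0)}\bigl(r(\cos\theta\, b_0+\sin\theta\, b_1)\bigr)$ be the corresponding geodesic polar coordinates. Suppose that the geodesic curvature of $\gamma$ vanishes at $\gamma(s_1)$. Then $s\mapsto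 H(s_0,s)$ is of class $C^2$ near $s_1$; there is a function $\theta$, continuous at $s_1$, with $\gamma(s)=\Phi(H(s_0,s),\theta(s))$ for all $s$ near $s_1$; and every such $\theta$ is of class $C^2$ near $s_1$ and satisfies $$\partial_{22}H(s_0,s_1)=\theta'(s_1)^2\,J(\ell)\,J'(\ell).$$ Moreover, if $\sigma$ is not tangent to $\gamma$ at $\gamma(s_1)$, then $\partial_{22}H(s_0,s_1)$ has the same sign (positive, zero or negative) as $J(\ell)J'(\ell)$. In particular this is so if $\gamma$ is a strictly convex closed curve in $U$, that is, if $\gamma$ is periodic and simple and its image is the boundary of a compact set $D\subset U$ such that the open minimizing geodesic segment between any two distinct points of $D$ lies in the interior of $D$. -/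

import Mathlib

open Set Filter Topology Manifold Bundle
open scoped ContDiff

noncomputable section

namespace SurfaceBilliard

/-- The model space of a surface. -/
abbrev Plane : Type := EuclideanSpace ℝ (Fin 2)

/-! ### Coordinate formulas for a metric `(g_ij)` given on (an open part of) the plane -/

/-- The partial derivative `∂_i f` at `y`. -/
def pderiv (i : Fin 2) (f : Plane → ℝ) (y : Plane) : ℝ :=
  fderiv ℝ f y (EuclideanSpace.single i 1)

/-- `Γ^k_ij = ½ ∑_l g^{kl} (∂_i g_jl + ∂_j g_il - ∂_l g_ij)`. -/
def christoffel (g : Plane → Matrix (Fin 2) (Fin 2) ℝ) (k i j : Fin 2) (y : Plane) : ℝ :=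
  (1 / 2) * ∑ l, (g y)⁻¹ k l *
    (pderiv i (fun z => g z j l) y + pderiv j (fun z => g z i l) y - pderiv l (fun z => g z i j) y)

/-- The `l`-th component of `R(∂_i, ∂_j) ∂_k = ∇_i ∇_j ∂_k - ∇_j ∇_i ∂_k`. -/
def curvatureTensor (g : Plane → Matrix (Fin 2) (Fin 2) ℝ) (i j k l : Fin 2) (y : Plane) : ℝ :=
  pderiv i (christoffel g l j k) y - pderiv j (christoffel g l i k) y
    + ∑ m, (christoffel g m j k y * christoffel g l i m y
        - christoffel g m i k y * christoffel g l j m y)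

/-- `⟨R(∂_0, ∂_1) ∂_1, ∂_0⟩ / det g`. -/
def gaussCurvatureOfGram (g : Plane → Matrix (Fin 2) (Fin 2) ℝ) (y : Plane) : ℝ :=
  (∑ l, curvatureTensor g 0 1 1 l y * g y l 0) / (g y).det

/-! ### Riemannian surfaces -/

section Surface

variable {M : Type*} [MetricSpace M] [ChartedSpace Plane M]
  [RiemannianBundle (fun x : M => TangentSpace (𝓡 2) x)]

/-- The coordinate vector `∂_i` of the chart around `x`, at the point with coordinates `y`. -/
def coordVec (x : M) (y : Plane) (i : Fin 2) :
    TangentSpace (𝓡 2) ((extChartAt (𝓡 2) x).symm y) :=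
  mfderiv 𝓘(ℝ, Plane) (𝓡 2) (extChartAt (𝓡 2) x).symm y (EuclideanSpace.single i (1 : ℝ))

/-- The coefficients `g_ij = ⟨∂_i, ∂_j⟩` of the Riemannian metric in the chart around `x`. -/
def chartGram (x : M) (y : Plane) : Matrix (Fin 2) (Fin 2) ℝ :=
  Matrix.of fun i j => inner ℝ (coordVec x y i) (coordVec x y j)

/-- The Gaussian curvature at `x` (computed in the chart around `x`). -/
def gaussianCurvature (x : M) : ℝ :=
  gaussCurvatureOfGram (chartGram x) (extChartAt (𝓡 2) x x)

/-- The velocity `σ'(t)`. -/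
def velocity (σ : ℝ → M) (t : ℝ) : TangentSpace (𝓡 2) (σ t) :=
  mfderiv 𝓘(ℝ, ℝ) (𝓡 2) σ t (1 : ℝ)

/-- The velocity as a point of the tangent bundle. -/
def lift (σ : ℝ → M) (t : ℝ) : TangentBundle (𝓡 2) M := ⟨σ t, velocity σ t⟩

/-- The `k`-th component of the covariant acceleration `Dσ'/dt` in the chart around `x`:
`c_k'' + ∑_{i,j} Γ^k_ij c_i' c_j'`, where `c` is the curve `σ` read in the chart. -/
def covAccel (x : M) (σ : ℝ → M) (t : ℝ) (k : Fin 2) : ℝ :=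
  let c : Fin 2 → ℝ → ℝ := fun i τ => extChartAt (𝓡 2) x (σ τ) i
  deriv (deriv (c k)) t
    + ∑ i, ∑ j, christoffel (chartGram x) k i j (extChartAt (𝓡 2) x (σ t))
        * deriv (c i) t * deriv (c j) t

/-- `σ` is a geodesic on the time set `s`: it is of class `C²` around every time of `s` and satisfies
the geodesic equation there, in every chart of the surface. -/
def IsGeodesicOn (σ : ℝ → M) (s : Set ℝ) : Prop :=
  ∀ t ∈ s, ContMDiffAt 𝓘(ℝ, ℝ) (𝓡 2) 2 σ t ∧
    ∀ x : M, σ t ∈ (chartAt Plane x).source → ∀ k, covAccel x σ t k = 0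

/-- `σ : [0, ℓ] → M` is a unit speed geodesic from `p` to `q`. -/
structure IsUnitGeodesic (σ : ℝ → M) (ℓ : ℝ) (p q : M) : Prop where
  geodesic : IsGeodesicOn σ (Icc 0 ℓ)
  unit_speed : ∀ t ∈ Icc 0 ℓ, ‖velocity σ t‖ = 1
  source : σ 0 = p
  target : σ ℓ = q

/-- The absolute value `‖Dγ'/ds‖` of the geodesic curvature, at the parameter `s`, of a curve
parametrized by arc length. -/
def geodesicCurvature (γ : ℝ → M) (s : ℝ) : ℝ :=
  √(∑ i, ∑ j, chartGram (γ s) (extChartAt (𝓡 2) (γ s) (γ s)) i j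
      * covAccel (γ s) γ s i * covAccel (γ s) γ s j)

/-- There is a geodesic on `[0, 1]` which starts at `p` with velocity `v`. -/
def HasExp (p : M) (v : TangentSpace (𝓡 2) p) : Prop :=
  ∃ σ : ℝ → M, IsGeodesicOn σ (Icc 0 1) ∧ lift σ 0 = ⟨p, v⟩

open Classical in
/-- The exponential map `exp_p` (with the value `p` where it is undefined). -/
def expMap (p : M) (v : TangentSpace (𝓡 2) p) : M :=
  if h : HasExp p v then h.choose 1 else p

/-- `exp_p` is defined on the ball of radius `δ` of `T_pM` and is a smooth diffeomorphism from it
onto an open subset of `M`. -/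
def IsNormalRadius (p : M) (δ : ℝ) : Prop :=
  (∀ v ∈ Metric.ball (0 : TangentSpace (𝓡 2) p) δ, HasExp p v) ∧
  ∃ e : OpenPartialHomeomorph (TangentSpace (𝓡 2) p) M,
    e.source = Metric.ball 0 δ ∧ EqOn e (expMap p) e.source ∧
    ContMDiffOn 𝓘(ℝ, TangentSpace (𝓡 2) p) (𝓡 2) ∞ e e.source ∧
    ContMDiffOn (𝓡 2) 𝓘(ℝ, TangentSpace (𝓡 2) p) ∞ e.symm e.target

/-- `U` is a totally normal neighbourhood: it is a normal neighbourhood of each of its points, with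
a common radius. -/
def IsTotallyNormal (U : Set M) : Prop :=
  IsOpen U ∧ ∃ δ > 0, ∀ p ∈ U, IsNormalRadius p δ ∧ U ⊆ expMap p '' Metric.ball 0 δ

/-- Geodesic polar coordinates around `p`: `(r, θ) ↦ exp_p (r (cos θ b₀ + sin θ b₁))`. -/
def polar (p : M) (b : OrthonormalBasis (Fin 2) ℝ (TangentSpace (𝓡 2) p)) (r θ : ℝ) : M :=
  expMap p (r • (Real.cos θ • b 0 + Real.sin θ • b 1))

/-- The generating function `H(s, s')`: the geodesic distance from `γ s` to `γ s'`. -/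
def genFun (γ : ℝ → M) (s s' : ℝ) : ℝ := dist (γ s) (γ s')

/-- `θ` is a polar angle of `γ` around `γ s₀` near the parameter `s₁`, i.e.
`γ s = Φ(H(s₀, s), θ(s))` near `s₁`, with `θ` continuous at `s₁`. -/
def IsPolarAngle (γ : ℝ → M) (s₀ s₁ : ℝ)
    (b : OrthonormalBasis (Fin 2) ℝ (TangentSpace (𝓡 2) (γ s₀))) (θ : ℝ → ℝ) : Prop :=
  ContinuousAt θ s₁ ∧ ∀ᶠ s in 𝓝 s₁, γ s = polar (γ s₀) b (genFun γ s₀ s) (θ s)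

/-- `J : [0, ℓ] → ℝ`, with derivative `J'`, is the normal Jacobi field along the unit speed geodesic
`σ` with `J(0) = 0` and `J'(0) = 1`: it solves `J'' + K J = 0`, with `K` the Gaussian curvature
along `σ`. -/
structure IsJacobiField (σ : ℝ → M) (ℓ : ℝ) (J J' : ℝ → ℝ) : Prop where
  deriv_J : ∀ t ∈ Icc 0 ℓ, HasDerivWithinAt J (J' t) (Icc 0 ℓ) t
  jacobi : ∀ t ∈ Icc 0 ℓ, HasDerivWithinAt J' (-(gaussianCurvature (σ t) * J t)) (Icc 0 ℓ) t
  zero : J 0 = 0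
  one : J' 0 = 1

/-- The unit speed curves `σ` and `γ`, meeting at `σ t = γ s`, are tangent there. -/
def AreTangent (σ : ℝ → M) (t : ℝ) (γ : ℝ → M) (s : ℝ) : Prop :=
  lift σ t = ⟨γ s, velocity γ s⟩ ∨ lift σ t = ⟨γ s, -velocity γ s⟩

/-- `γ` is (the `L`-periodic parametrization of) a simple closed curve that bounds a compact strictly
convex region of `U`: the open minimizing geodesic segment between any two points of the region
lies in its interior. -/
structure IsConvexCurve (U : Set M) (γ : ℝ → M) (L : ℝ) : Prop where
  pos : 0 < L
  periodic : Function.Periodic γ L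
  simple : InjOn γ (Ico 0 L)
  convex : ∃ D : Set M, IsCompact D ∧ D ⊆ U ∧ frontier D = range γ ∧
    ∀ p ∈ D, ∀ q ∈ D, p ≠ q → ∀ σ : ℝ → M, IsUnitGeodesic σ (dist p q) p q →
      ∀ t ∈ Ioo 0 (dist p q), σ t ∈ interior D

end Surface

end SurfaceBilliard

end

set_option linter.unusedSectionVars false

open Set Filter Topology Manifold Bundle
open scoped ContDiff

noncomputable section

namespace SurfaceBilliard

/-! ### Riemannian metrics on an open part of the plane -/

/-! Take geodesic polar coordinates about γ(s₀), with T = ∂_r and Y = ∂_θ. The Gauss lemma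
(`IsNormalChart.gauss`, obtained by integrating the first variation identity
`dirDeriv_metricForm_mixed` along rays) says that the metric is dr² + q dθ² with q = ⟨Y, Y⟩. It also
bounds the length of a path below by the radius the path gains, so the radius is the distance to
γ(s₀) (`IsNormalChart.dist_eq`) and H(s₀, ·) is the radius r along γ. Regularity of r and θ follows,
since γ avoids the centre near s₁.

Along γ one has γ' = r'T + θ'Y, hence r' = ⟨γ', T⟩. On differentiating at s₁, the term with the
acceleration of γ disappears because the geodesic curvature vanishes. From ∇_T T = 0, ∇_Y T = ∇_T Y
and ⟨T, ∇_T Y⟩ = 0 there remains r'' = θ'² ⟨Y, ∇_T Y⟩ = θ'² ∂_r q / 2 (`deriv_radial`). The Ricci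
identity gives the Jacobi equation for √q (`jacobi_sq`, `IsNormalChart.jacobi_polar`), and √q has
initial value 0 and slope 1, so √q = J (`jacobi_unique`) and ∂_r q / 2 = J J'.

If θ'(s₁) = 0, then γ' is radial, so γ is tangent to σ (`IsNormalChart.areTangent_of_deriv_angle`);
otherwise θ'² > 0 and the signs agree. On a strictly convex curve tangency cannot occur
(`IsConvexCurve.not_areTangent`): seen from γ(s₁), the chord passes through the interior of D, and
with it so does a whole cone of rays around the chord. A boundary curve tangent to the axis of this
cone would have to enter it. -/

/-- The bilinear form `⟨u, v⟩ = ∑ g_ij u_i v_j` at `y`. -/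
def metricForm (g : Plane → Matrix (Fin 2) (Fin 2) ℝ) (y u v : Plane) : ℝ :=
  ∑ i, ∑ j, g y i j * u i * v j

/-- The vector `Γ(u, v)` with components `∑ Γ^k_ij u_i v_j`. -/
def christoffelForm (g : Plane → Matrix (Fin 2) (Fin 2) ℝ) (y u v : Plane) : Plane :=
  WithLp.toLp 2 fun k => ∑ i, ∑ j, christoffel g k i j y * u i * v j

/-- `g` is a smooth nondegenerate metric on the open set `Ω`. -/
structure GramOn (g : Plane → Matrix (Fin 2) (Fin 2) ℝ) (Ω : Set Plane) : Prop where
  isOpen : IsOpen Ω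
  contDiffAt : ∀ y ∈ Ω, ∀ i j, ContDiffAt ℝ ∞ (fun z => g z i j) y
  symm : ∀ y ∈ Ω, ∀ i j, g y i j = g y j i
  det_ne : ∀ y ∈ Ω, (g y).det ≠ 0

variable {g : Plane → Matrix (Fin 2) (Fin 2) ℝ} {Ω : Set Plane}

@[simp]
lemma christoffelForm_apply (y u v : Plane) (k : Fin 2) :
    christoffelForm g y u v k = ∑ i, ∑ j, christoffel g k i j y * u i * v j := rfl

lemma GramOn.det_ne' (hg : GramOn g Ω) {y : Plane} (hy : y ∈ Ω) :
    g y 0 0 * g y 1 1 - g y 0 1 * g y 0 1 ≠ 0 := by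
  have := hg.det_ne y hy
  rwa [Matrix.det_fin_two, hg.symm y hy 1 0] at this

lemma GramOn.pderiv_symm (hg : GramOn g Ω) {y : Plane} (hy : y ∈ Ω) (k i j : Fin 2) :
    pderiv k (fun z => g z i j) y = pderiv k (fun z => g z j i) y := by
  have : (fun z => g z i j) =ᶠ[𝓝 y] fun z => g z j i := by
    filter_upwards [hg.isOpen.mem_nhds hy] with z hz using hg.symm z hz i j
  rw [pderiv, pderiv, this.fderiv_eq]

/-- With adjugate over determinant in place of the inverse matrix the symbols are explicit rational
expressions in the metric and its derivatives. Metric compatibility then becomes a polynomial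
identity once the determinant is cleared, and smoothness can be read off. -/
lemma christoffel_eq (hg : GramOn g Ω) {y : Plane} (hy : y ∈ Ω) (k i j : Fin 2) :
    christoffel g k i j y = (1 / 2) * (g y 0 0 * g y 1 1 - g y 0 1 * g y 0 1)⁻¹ *
      ∑ l, (g y).adjugate k l * (pderiv i (fun z => g z j l) y + pderiv j (fun z => g z i l) y
        - pderiv l (fun z => g z i j) y) := by
  have hd : (g y).det = g y 0 0 * g y 1 1 - g y 0 1 * g y 0 1 := by
    rw [Matrix.det_fin_two, hg.symm y hy 1 0]
  simp only [christoffel, Matrix.inv_def, Ring.inverse_eq_inv', hd, Matrix.smul_apply, smul_eq_mul,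
    Fin.sum_univ_two]
  ring

lemma christoffel_symm (hg : GramOn g Ω) {y : Plane} (hy : y ∈ Ω) (k i j : Fin 2) :
    christoffel g k i j y = christoffel g k j i y := by
  simp only [christoffel]
  congr 1
  refine Finset.sum_congr rfl fun l _ => ?_
  rw [hg.pderiv_symm hy l i j]
  ring

/-- Compatibility of the Christoffel symbols with the metric. -/
lemma pderiv_gram (hg : GramOn g Ω) {y : Plane} (hy : y ∈ Ω) (k i j : Fin 2) :
    pderiv k (fun z => g z i j) y =
      ∑ m, (christoffel g m k i y * g y m j + christoffel g m k j y * g y m i) := by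
  have hd : g y 0 0 * g y 1 1 - g y 0 1 ^ 2 ≠ 0 := by
    have := hg.det_ne' hy
    rwa [← sq] at this
  have hs := hg.symm y hy 1 0
  have h0 := hg.pderiv_symm hy 0 1 0
  have h1 := hg.pderiv_symm hy 1 1 0
  simp only [christoffel_eq hg hy, Matrix.adjugate_fin_two, Fin.sum_univ_two, ← sq]
  fin_cases k <;> fin_cases i <;> fin_cases j <;>
    simp [hs, h0, h1] <;> field_simp <;> ring

lemma christoffelForm_symm (hg : GramOn g Ω) {y : Plane} (hy : y ∈ Ω) (u v : Plane) :
    christoffelForm g y u v = christoffelForm g y v u := by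
  ext k
  simp only [christoffelForm_apply, Fin.sum_univ_two, christoffel_symm hg hy k 1 0]
  ring

lemma metricForm_symm (hg : GramOn g Ω) {y : Plane} (hy : y ∈ Ω) (u v : Plane) :
    metricForm g y u v = metricForm g y v u := by
  simp only [metricForm, Fin.sum_univ_two, hg.symm y hy 1 0]
  ring

lemma metricForm_add_left (y u v w : Plane) :
    metricForm g y (u + v) w = metricForm g y u w + metricForm g y v w := by
  simp only [metricForm, Fin.sum_univ_two, PiLp.add_apply]
  ring

lemma metricForm_smul_right (y u v : Plane) (a : ℝ) :
    metricForm g y u (a • v) = a * metricForm g y u v := by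
  simp only [metricForm, Fin.sum_univ_two, PiLp.smul_apply, smul_eq_mul]
  ring

lemma metricForm_smul_left (y u v : Plane) (a : ℝ) :
    metricForm g y (a • u) v = a * metricForm g y u v := by
  simp only [metricForm, Fin.sum_univ_two, PiLp.smul_apply, smul_eq_mul]
  ring

@[simp]
lemma metricForm_zero_left (y v : Plane) : metricForm g y 0 v = 0 := by
  simp [metricForm]

lemma christoffelForm_add_left (y u v w : Plane) :
    christoffelForm g y (u + v) w = christoffelForm g y u w + christoffelForm g y v w := by
  ext k
  simp only [christoffelForm_apply, Fin.sum_univ_two, PiLp.add_apply]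
  ring

lemma christoffelForm_smul_left (y u v : Plane) (a : ℝ) :
    christoffelForm g y (a • u) v = a • christoffelForm g y u v := by
  ext k
  simp only [christoffelForm_apply, Fin.sum_univ_two, PiLp.smul_apply, smul_eq_mul]
  ring

lemma christoffelForm_smul_right (y u v : Plane) (a : ℝ) :
    christoffelForm g y u (a • v) = a • christoffelForm g y u v := by
  ext k
  simp only [christoffelForm_apply, Fin.sum_univ_two, PiLp.smul_apply, smul_eq_mul]
  ring

/-! ### Directional derivatives -/

section Directional

variable {E : Type*} [NormedAddCommGroup E] [NormedSpace ℝ E]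
  {G : Type*} [NormedAddCommGroup G] [NormedSpace ℝ G]

/-- The derivative of `F` in the constant direction `v`. -/
def dirDeriv (v : E) (F : E → G) (z : E) : G := fderiv ℝ F z v

lemma contDiffAt_dirDeriv {F : E → G} {z : E} (h : ContDiffAt ℝ ∞ F z) (v : E) :
    ContDiffAt ℝ ∞ (dirDeriv v F) z :=
  (h.fderiv_right (m := ∞) (by simp)).clm_apply contDiffAt_const

/-- Symmetry of the second derivative; it is the source of torsion-freeness, of the skew-symmetry of
the curvature and of the Ricci identity. -/
lemma dirDeriv_comm {F : E → G} {z : E} (h : ContDiffAt ℝ ∞ F z) (v w : E) :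
    dirDeriv v (dirDeriv w F) z = dirDeriv w (dirDeriv v F) z := by
  have hs : IsSymmSndFDerivAt ℝ F z := h.isSymmSndFDerivAt (by simpa using ENat.LEInfty.out)
  have hd : DifferentiableAt ℝ (fderiv ℝ F) z :=
    (h.fderiv_right (m := ∞) (by simp)).differentiableAt (by simp)
  have key (a b : E) : dirDeriv a (dirDeriv b F) z = fderiv ℝ (fderiv ℝ F) z a b := by
    simp only [SurfaceBilliard.dirDeriv]
    rw [show SurfaceBilliard.dirDeriv b F = fun y => (fderiv ℝ F y) ((fun _ => b) y) from rfl]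
    rw [fderiv_clm_apply hd (by fun_prop)]
    simp
  rw [key, key, hs]

lemma dirDeriv_congr {F F' : E → G} {z : E} (h : F =ᶠ[𝓝 z] F') (v : E) :
    dirDeriv v F z = dirDeriv v F' z := by
  rw [dirDeriv, dirDeriv, h.fderiv_eq]

lemma dirDeriv_apply {X : E → Plane} {z : E} (hX : DifferentiableAt ℝ X z) (v : E) (i : Fin 2) :
    dirDeriv v (fun z => X z i) z = dirDeriv v X z i := by
  have := ((EuclideanSpace.proj i : Plane →L[ℝ] ℝ).hasFDerivAt (x := X z)).comp z hX.hasFDerivAt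
  rw [dirDeriv, show (fun z => X z i) = (EuclideanSpace.proj i : Plane →L[ℝ] ℝ) ∘ X from rfl,
    this.fderiv]
  rfl

lemma differentiableAt_coord {X : E → Plane} {z : E} (hX : DifferentiableAt ℝ X z) (i : Fin 2) :
    DifferentiableAt ℝ (fun z => X z i) z :=
  ((EuclideanSpace.proj i : Plane →L[ℝ] ℝ).differentiableAt).comp z hX

lemma fderiv_eq_pderiv (F : Plane → ℝ) (y u : Plane) :
    fderiv ℝ F y u = ∑ k, pderiv k F y * u k := by
  have hu : u = ∑ k, u k • EuclideanSpace.single k (1 : ℝ) := by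
    ext i
    fin_cases i <;> simp
  conv_lhs => rw [hu]
  simp [pderiv, mul_comm]

lemma dirDeriv_comp {F : Plane → ℝ} {f : E → Plane} {z : E} (hF : DifferentiableAt ℝ F (f z))
    (hf : DifferentiableAt ℝ f z) (v : E) :
    dirDeriv v (fun z => F (f z)) z = ∑ k, pderiv k F (f z) * dirDeriv v f z k := by
  rw [dirDeriv, show (fun z => F (f z)) = F ∘ f from rfl, fderiv_comp z hF hf,
    ContinuousLinearMap.comp_apply, fderiv_eq_pderiv]
  rfl

lemma dirDeriv_mul {a b : E → ℝ} {z : E} (ha : DifferentiableAt ℝ a z)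
    (hb : DifferentiableAt ℝ b z) (v : E) :
    dirDeriv v (fun z => a z * b z) z = dirDeriv v a z * b z + a z * dirDeriv v b z := by
  simp only [dirDeriv, fderiv_fun_mul ha hb]
  simp
  ring

lemma dirDeriv_add {a b : E → G} {z : E} (ha : DifferentiableAt ℝ a z)
    (hb : DifferentiableAt ℝ b z) (v : E) :
    dirDeriv v (fun z => a z + b z) z = dirDeriv v a z + dirDeriv v b z := by
  simp only [dirDeriv, fderiv_fun_add ha hb]
  simp

lemma dirDeriv_triple {a b c : E → ℝ} {z : E} (ha : DifferentiableAt ℝ a z)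
    (hb : DifferentiableAt ℝ b z) (hc : DifferentiableAt ℝ c z) (v : E) :
    dirDeriv v (fun z => a z * b z * c z) z =
      dirDeriv v a z * b z * c z + a z * dirDeriv v b z * c z + a z * b z * dirDeriv v c z := by
  rw [dirDeriv_mul (ha.fun_mul hb) hc, dirDeriv_mul ha hb]
  ring

lemma dirDeriv_sum_triple {a : Fin 2 → Fin 2 → E → ℝ} {b c : Fin 2 → E → ℝ} {z : E}
    (ha : ∀ i j, DifferentiableAt ℝ (a i j) z) (hb : ∀ i, DifferentiableAt ℝ (b i) z)
    (hc : ∀ i, DifferentiableAt ℝ (c i) z) (v : E) :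
    dirDeriv v (fun z => ∑ i, ∑ j, a i j z * b i z * c j z) z =
      ∑ i, ∑ j, (dirDeriv v (a i j) z * b i z * c j z + a i j z * dirDeriv v (b i) z * c j z
        + a i j z * b i z * dirDeriv v (c j) z) := by
  have h (i j) : DifferentiableAt ℝ (fun z => a i j z * b i z * c j z) z :=
    ((ha i j).fun_mul (hb i)).fun_mul (hc j)
  simp only [Fin.sum_univ_two]
  rw [dirDeriv_add ((h 0 0).fun_add (h 0 1)) ((h 1 0).fun_add (h 1 1)), dirDeriv_add (h 0 0) (h 0 1),
    dirDeriv_add (h 1 0) (h 1 1)]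
  simp only [dirDeriv_triple (ha _ _) (hb _) (hc _)]

/-- The covariant derivative of the field `X` along `f` in the direction `v`. -/
def covDeriv (g : Plane → Matrix (Fin 2) (Fin 2) ℝ) (f : E → Plane) (v : E) (X : E → Plane)
    (z : E) : Plane :=
  dirDeriv v X z + christoffelForm g (f z) (dirDeriv v f z) (X z)

lemma contDiffAt_christoffel (hg : GramOn g Ω) {y : Plane} (hy : y ∈ Ω) (k i j : Fin 2) :
    ContDiffAt ℝ ∞ (christoffel g k i j) y := by
  have h (i j) := hg.contDiffAt y hy i j
  have hp (k i j) : ContDiffAt ℝ ∞ (pderiv k fun z => g z i j) y :=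
    contDiffAt_dirDeriv (h i j) _
  have hd := hg.det_ne' hy
  have hadj (k l) : ContDiffAt ℝ ∞ (fun z => (g z).adjugate k l) y := by
    simp only [Matrix.adjugate_fin_two]
    fin_cases k <;> fin_cases l <;> simp [h, (h _ _).neg]
  refine ContDiffAt.congr_of_eventuallyEq ?_ (eventually_of_mem (hg.isOpen.mem_nhds hy)
    fun z hz => christoffel_eq hg hz k i j)
  refine (contDiffAt_const.mul (ContDiffAt.inv
    (((h 0 0).mul (h 1 1)).sub ((h 0 1).mul (h 0 1))) hd)).mul ?_
  exact ContDiffAt.sum fun l _ => (hadj k l).mul (((hp i j l).add (hp j i l)).sub (hp l i j))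

/-- The product rule for the scalar product of two vector fields along a map. -/
lemma dirDeriv_metricForm (hg : GramOn g Ω) {f X Y : E → Plane} {z : E} (hz : f z ∈ Ω)
    (hf : DifferentiableAt ℝ f z) (hX : DifferentiableAt ℝ X z) (hY : DifferentiableAt ℝ Y z)
    (v : E) :
    dirDeriv v (fun z => metricForm g (f z) (X z) (Y z)) z =
      metricForm g (f z) (covDeriv g f v X z) (Y z)
        + metricForm g (f z) (X z) (covDeriv g f v Y z) := by
  have h (i j) : DifferentiableAt ℝ (fun z => g z i j) (f z) :=
    (hg.contDiffAt _ hz i j).differentiableAt (by simp)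
  simp only [metricForm, covDeriv]
  refine (dirDeriv_sum_triple (a := fun i j z => g (f z) i j) (b := fun i z => X z i)
    (c := fun i z => Y z i) (fun i j => (h i j).comp z hf) (differentiableAt_coord hX)
    (differentiableAt_coord hY) v).trans ?_
  simp only [dirDeriv_apply hX, dirDeriv_apply hY, dirDeriv_comp (h _ _) hf, pderiv_gram hg hz,
    Fin.sum_univ_two, PiLp.add_apply, christoffelForm_apply, hg.symm _ hz 1 0,
    christoffel_symm hg hz _ 1 0]
  ring

lemma contDiffAt_coord {n : ℕ∞ω} {X : E → Plane} {z : E} (hX : ContDiffAt ℝ n X z) (i : Fin 2) :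
    ContDiffAt ℝ n (fun z => X z i) z :=
  ((EuclideanSpace.proj i : Plane →L[ℝ] ℝ).contDiff.contDiffAt).comp z hX

lemma contDiffAt_christoffelForm (hg : GramOn g Ω) {f X Y : E → Plane} {z : E} (hz : f z ∈ Ω)
    (hf : ContDiffAt ℝ ∞ f z) (hX : ContDiffAt ℝ ∞ X z) (hY : ContDiffAt ℝ ∞ Y z) :
    ContDiffAt ℝ ∞ (fun z => christoffelForm g (f z) (X z) (Y z)) z := by
  refine contDiffAt_euclidean.2 fun k => ?_
  simp only [christoffelForm_apply]
  exact ContDiffAt.sum fun i _ => ContDiffAt.sum fun j _ =>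
    (((contDiffAt_christoffel hg hz k i j).comp z hf).mul (contDiffAt_coord hX i)).mul (contDiffAt_coord hY j)

lemma contDiffAt_metricForm (hg : GramOn g Ω) {f X Y : E → Plane} {z : E} (hz : f z ∈ Ω)
    (hf : ContDiffAt ℝ ∞ f z) (hX : ContDiffAt ℝ ∞ X z) (hY : ContDiffAt ℝ ∞ Y z) :
    ContDiffAt ℝ ∞ (fun z => metricForm g (f z) (X z) (Y z)) z :=
  ContDiffAt.sum fun i _ => ContDiffAt.sum fun j _ =>
    (((hg.contDiffAt _ hz i j).comp z hf).mul (contDiffAt_coord hX i)).mul (contDiffAt_coord hY j)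

/-- The torsion of the Levi-Civita connection vanishes. -/
lemma covDeriv_comm (hg : GramOn g Ω) {f : E → Plane} {z : E} (hz : f z ∈ Ω)
    (hf : ContDiffAt ℝ ∞ f z) (v w : E) :
    covDeriv g f v (dirDeriv w f) z = covDeriv g f w (dirDeriv v f) z := by
  rw [covDeriv, covDeriv, dirDeriv_comm hf, christoffelForm_symm hg hz]

end Directional

variable {g : Plane → Matrix (Fin 2) (Fin 2) ℝ} {Ω : Set Plane}

/-! ### Curvature -/

/-- The curvature operator `R(∂_0, ∂_1)` is skew-symmetric. -/
lemma curvatureTensor_skew (hg : GramOn g Ω) {y : Plane} (hy : y ∈ Ω) (j k : Fin 2) :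
    ∑ l, (curvatureTensor g 0 1 j l y * g y l k + curvatureTensor g 0 1 k l y * g y l j) = 0 := by
  have hG (i j) : DifferentiableAt ℝ (fun z => g z i j) y :=
    (hg.contDiffAt y hy i j).differentiableAt (by simp)
  have hC (k i j) : DifferentiableAt ℝ (christoffel g k i j) y :=
    (contDiffAt_christoffel hg hy k i j).differentiableAt (by simp)
  -- Skew-symmetry amounts to ∂_0 ∂_1 g_jk = ∂_1 ∂_0 g_jk: both sides are expanded by applying
  -- metric compatibility twice, and their difference is the curvature expression.
  have hsnd (a c : Fin 2) : pderiv a (pderiv c fun z => g z j k) y =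
      ∑ m, ((pderiv a (christoffel g m c j) y * g y m k
          + christoffel g m c j y * pderiv a (fun z => g z m k) y)
        + (pderiv a (christoffel g m c k) y * g y m j
          + christoffel g m c k y * pderiv a (fun z => g z m j) y)) := by
    have hev : (pderiv c fun z => g z j k) =ᶠ[𝓝 y] fun z =>
        ∑ m, (christoffel g m c j z * g z m k + christoffel g m c k z * g z m j) :=
      eventually_of_mem (hg.isOpen.mem_nhds hy) fun z hz => pderiv_gram hg hz c j k
    have h1 (m a b c d e) : DifferentiableAt ℝ (fun z => christoffel g m a b z * g z c d
        + christoffel g m a e z * g z c b) y :=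
      ((hC m a b).fun_mul (hG c d)).fun_add ((hC m a e).fun_mul (hG c b))
    have hD (F : Plane → ℝ) : pderiv a F y = dirDeriv (EuclideanSpace.single a 1) F y := rfl
    simp only [hD]
    rw [dirDeriv_congr hev]
    simp only [Fin.sum_univ_two]
    rw [dirDeriv_add
      (((hC 0 c j).fun_mul (hG 0 k)).fun_add ((hC 0 c k).fun_mul (hG 0 j)))
      (((hC 1 c j).fun_mul (hG 1 k)).fun_add ((hC 1 c k).fun_mul (hG 1 j))),
      dirDeriv_add ((hC 0 c j).fun_mul (hG 0 k)) ((hC 0 c k).fun_mul (hG 0 j)),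
      dirDeriv_add ((hC 1 c j).fun_mul (hG 1 k)) ((hC 1 c k).fun_mul (hG 1 j))]
    simp only [dirDeriv_mul (hC _ _ _) (hG _ _)]
  have hcomm : pderiv 0 (pderiv 1 fun z => g z j k) y = pderiv 1 (pderiv 0 fun z => g z j k) y :=
    dirDeriv_comm (hg.contDiffAt y hy j k) _ _
  rw [hsnd, hsnd] at hcomm
  simp only [pderiv_gram hg hy, Fin.sum_univ_two, curvatureTensor, hg.symm y hy 1 0] at hcomm ⊢
  linear_combination hcomm

/-- `⟨R(T, Y) T, Y⟩ = -K (⟨T, T⟩ ⟨Y, Y⟩ - ⟨T, Y⟩²)`. -/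
lemma metricForm_curvature (hg : GramOn g Ω) {y : Plane} (hy : y ∈ Ω) (T Y W : Plane)
    (hW : ∀ l, W l = (T 0 * Y 1 - T 1 * Y 0) * ∑ k, curvatureTensor g 0 1 k l y * T k) :
    metricForm g y W Y = -gaussCurvatureOfGram g y *
      (metricForm g y T T * metricForm g y Y Y - metricForm g y T Y ^ 2) := by
  have h00 := curvatureTensor_skew hg hy 0 0
  have h01 := curvatureTensor_skew hg hy 0 1
  have h11 := curvatureTensor_skew hg hy 1 1
  have hK : gaussCurvatureOfGram g y * (g y 0 0 * g y 1 1 - g y 0 1 * g y 1 0) =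
      ∑ l, curvatureTensor g 0 1 1 l y * g y l 0 := by
    rw [gaussCurvatureOfGram, ← Matrix.det_fin_two, div_mul_cancel₀ _ (hg.det_ne y hy)]
  simp only [metricForm, Fin.sum_univ_two, hW, hg.symm y hy 1 0] at *
  generalize curvatureTensor g 0 1 0 0 y = a at *
  generalize curvatureTensor g 0 1 0 1 y = b at *
  generalize curvatureTensor g 0 1 1 0 y = c at *
  generalize curvatureTensor g 0 1 1 1 y = d at *
  -- `hK` contains a single pairing of the curvature with the metric; the skew relations remove or
  -- rewrite the others. The halves compensate for the diagonal relations, which count one pairing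
  -- twice.
  linear_combination (T 0 * Y 1 - T 1 * Y 0) ^ 2 * hK
    + (T 0 * Y 1 - T 1 * Y 0) * T 0 * Y 0 / 2 * h00
    + (T 0 * Y 1 - T 1 * Y 0) * T 1 * Y 1 / 2 * h11
    + (T 0 * Y 1 - T 1 * Y 0) * T 0 * Y 1 * h01

/-! ### Curvature identities along families of geodesics -/

section Families

variable {E : Type*} [NormedAddCommGroup E] [NormedSpace ℝ E]

lemma covDeriv_apply {f X : E → Plane} (v : E) (z : E) (l : Fin 2) :
    covDeriv g f v X z l = dirDeriv v X z l
      + ∑ i, ∑ j, christoffel g l i j (f z) * dirDeriv v f z i * X z j := rfl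

lemma contDiffAt_covDeriv (hg : GramOn g Ω) {f X : E → Plane} {z : E} (hz : f z ∈ Ω)
    (hf : ContDiffAt ℝ ∞ f z) (hX : ContDiffAt ℝ ∞ X z) (v : E) :
    ContDiffAt ℝ ∞ (covDeriv g f v X) z :=
  (contDiffAt_dirDeriv hX v).add
    (contDiffAt_christoffelForm hg hz hf (contDiffAt_dirDeriv hf v) hX)

lemma dirDeriv_covDeriv (hg : GramOn g Ω) {f X : E → Plane} {z : E} (hz : f z ∈ Ω)
    (hf : ContDiffAt ℝ ∞ f z) (hX : ContDiffAt ℝ ∞ X z) (v w : E) (l : Fin 2) :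
    dirDeriv v (covDeriv g f w X) z l = dirDeriv v (dirDeriv w X) z l +
      ∑ i, ∑ j, ((∑ k, pderiv k (christoffel g l i j) (f z) * dirDeriv v f z k)
          * dirDeriv w f z i * X z j
        + christoffel g l i j (f z) * dirDeriv v (dirDeriv w f) z i * X z j
        + christoffel g l i j (f z) * dirDeriv w f z i * dirDeriv v X z j) := by
  have hC (k i j) : DifferentiableAt ℝ (christoffel g k i j) (f z) :=
    (contDiffAt_christoffel hg hz k i j).differentiableAt (by simp)
  have hfd : DifferentiableAt ℝ f z := hf.differentiableAt (by simp)
  have hXd : DifferentiableAt ℝ X z := hX.differentiableAt (by simp)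
  have hwf : DifferentiableAt ℝ (dirDeriv w f) z :=
    (contDiffAt_dirDeriv hf w).differentiableAt (by simp)
  have hwX : DifferentiableAt ℝ (dirDeriv w X) z :=
    (contDiffAt_dirDeriv hX w).differentiableAt (by simp)
  have hG : DifferentiableAt ℝ (fun z => christoffelForm g (f z) (dirDeriv w f z) (X z)) z :=
    (contDiffAt_christoffelForm hg hz hf (contDiffAt_dirDeriv hf w) hX).differentiableAt (by simp)
  have h1 : dirDeriv v (covDeriv g f w X) z = _ := dirDeriv_add hwX hG v
  rw [h1, PiLp.add_apply, ← dirDeriv_apply hG v l]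
  congr 1
  refine (dirDeriv_sum_triple (a := fun i j z => christoffel g l i j (f z))
    (b := fun i z => dirDeriv w f z i) (c := fun i z => X z i) (fun i j => (hC l i j).comp z hfd)
    (differentiableAt_coord hwf) (differentiableAt_coord hXd) v).trans ?_
  simp only [dirDeriv_apply hwf, dirDeriv_apply hXd, dirDeriv_comp (hC _ _ _) hfd]

/-- The Ricci identity for fields along a map. -/
lemma covDeriv_covDeriv (hg : GramOn g Ω) {f X : E → Plane} {z : E} (hz : f z ∈ Ω)
    (hf : ContDiffAt ℝ ∞ f z) (hX : ContDiffAt ℝ ∞ X z) (v w : E) (l : Fin 2) :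
    covDeriv g f v (covDeriv g f w X) z l = covDeriv g f w (covDeriv g f v X) z l
      + (dirDeriv v f z 0 * dirDeriv w f z 1 - dirDeriv v f z 1 * dirDeriv w f z 0)
        * ∑ k, curvatureTensor g 0 1 k l (f z) * X z k := by
  -- Exchanging v and w does not affect the second derivatives of f and X. What survives is
  -- antisymmetric in the two derivatives of f, hence a multiple of their 2 × 2 determinant.
  rw [covDeriv_apply, covDeriv_apply w, dirDeriv_covDeriv hg hz hf hX,
    dirDeriv_covDeriv hg hz hf hX, dirDeriv_comm hX w v, dirDeriv_comm hf w v]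
  simp only [covDeriv_apply, Fin.sum_univ_two, curvatureTensor]
  ring

variable {f : E → Plane} {z : E} {v w : E}

/-- Torsion-freeness trades the w-derivative of the v-field for the v-derivative of the w-field.
This gives the first variation formula and, for unit speed, ⟨T, ∇_T Y⟩ = 0. -/
lemma dirDeriv_metricForm_transversal (hg : GramOn g Ω) (hz : f z ∈ Ω) (hf : ContDiffAt ℝ ∞ f z) :
    dirDeriv w (fun z => metricForm g (f z) (dirDeriv v f z) (dirDeriv v f z)) z =
      2 * metricForm g (f z) (dirDeriv v f z) (covDeriv g f v (dirDeriv w f) z) := by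
  have hv := (contDiffAt_dirDeriv hf v).differentiableAt (by simp)
  rw [dirDeriv_metricForm hg hz (hf.differentiableAt (by simp)) hv hv, covDeriv_comm hg hz hf v w,
    metricForm_symm hg hz]
  ring

/-- The first variation formula behind the Gauss lemma. -/
lemma dirDeriv_metricForm_mixed (hg : GramOn g Ω) (hz : f z ∈ Ω) (hf : ContDiffAt ℝ ∞ f z)
    (hgeo : covDeriv g f v (dirDeriv v f) z = 0) :
    2 * dirDeriv v (fun z => metricForm g (f z) (dirDeriv v f z) (dirDeriv w f z)) z =
      dirDeriv w (fun z => metricForm g (f z) (dirDeriv v f z) (dirDeriv v f z)) z := by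
  have hv := (contDiffAt_dirDeriv hf v).differentiableAt (by simp)
  have hw := (contDiffAt_dirDeriv hf w).differentiableAt (by simp)
  rw [dirDeriv_metricForm hg hz (hf.differentiableAt (by simp)) hv hw, hgeo,
    dirDeriv_metricForm_transversal hg hz hf]
  simp

/-- Three vectors of the plane are linearly dependent, so their Gram determinant vanishes. -/
lemma metricForm_mul_of_orthogonal (hg : GramOn g Ω) {y : Plane} (hy : y ∈ Ω) {T Y Z : Plane}
    (hT : metricForm g y T T = 1) (hTY : metricForm g y T Y = 0) (hTZ : metricForm g y T Z = 0) :
    metricForm g y Y Y * metricForm g y Z Z = metricForm g y Y Z ^ 2 := by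
  have hgram : metricForm g y T T *
      (metricForm g y Y Y * metricForm g y Z Z - metricForm g y Y Z ^ 2)
      - metricForm g y T Y * (metricForm g y T Y * metricForm g y Z Z
        - metricForm g y Y Z * metricForm g y T Z)
      + metricForm g y T Z * (metricForm g y T Y * metricForm g y Y Z
        - metricForm g y Y Y * metricForm g y T Z) = 0 := by
    simp only [metricForm, Fin.sum_univ_two, hg.symm y hy 1 0]
    ring
  rw [hT, hTY, hTZ] at hgram
  linarith

/-- The Jacobi equation, for the squared length `q` of the transversal field of a family of unit
speed geodesics: `q q'' = q'² / 2 - 2 K q²`. -/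
lemma jacobi_sq (hg : GramOn g Ω) (hz : f z ∈ Ω) (hf : ∀ᶠ y in 𝓝 z, ContDiffAt ℝ ∞ f y)
    (hgeo : ∀ᶠ y in 𝓝 z, covDeriv g f v (dirDeriv v f) y = 0)
    (hunit : metricForm g (f z) (dirDeriv v f z) (dirDeriv v f z) = 1)
    (horth : ∀ᶠ y in 𝓝 z, metricForm g (f y) (dirDeriv v f y) (dirDeriv w f y) = 0) :
    let q : E → ℝ := fun y => metricForm g (f y) (dirDeriv w f y) (dirDeriv w f y)
    q z * dirDeriv v (dirDeriv v q) z =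
      dirDeriv v q z ^ 2 / 2 - 2 * gaussCurvatureOfGram g (f z) * q z ^ 2 := by
  intro q
  have hfz := hf.self_of_nhds
  have hΩ : ∀ᶠ y in 𝓝 z, f y ∈ Ω :=
    hfz.continuousAt.eventually_mem (hg.isOpen.mem_nhds hz)
  set Z : E → Plane := covDeriv g f v (dirDeriv w f) with hZ
  have hfd : DifferentiableAt ℝ f z := hfz.differentiableAt (by simp)
  have hTd : DifferentiableAt ℝ (dirDeriv v f) z :=
    (contDiffAt_dirDeriv hfz v).differentiableAt (by simp)
  have hYd : DifferentiableAt ℝ (dirDeriv w f) z :=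
    (contDiffAt_dirDeriv hfz w).differentiableAt (by simp)
  have hZd : DifferentiableAt ℝ Z z :=
    (contDiffAt_covDeriv hg hz hfz (contDiffAt_dirDeriv hfz w) v).differentiableAt (by simp)
  have hq1 : dirDeriv v q =ᶠ[𝓝 z] fun y => metricForm g (f y) ((2 : ℝ) • dirDeriv w f y) (Z y) := by
    filter_upwards [hf, hΩ] with y hy hyΩ
    have hYy := (contDiffAt_dirDeriv hy w).differentiableAt (n := ∞) (by simp)
    rw [dirDeriv_metricForm hg hyΩ (hy.differentiableAt (by simp)) hYy hYy,
      metricForm_symm hg hyΩ, metricForm_smul_left]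
    ring
  have hTZ : metricForm g (f z) (dirDeriv v f z) (Z z) = 0 := by
    have h0 : dirDeriv v (fun y => metricForm g (f y) (dirDeriv v f y) (dirDeriv w f y)) z
        = dirDeriv v (fun _ => (0 : ℝ)) z := dirDeriv_congr horth v
    rw [dirDeriv_metricForm hg hz hfd hTd hYd, hgeo.self_of_nhds] at h0
    simpa [dirDeriv] using h0
  have hZT : Z =ᶠ[𝓝 z] covDeriv g f w (dirDeriv v f) := by
    filter_upwards [hf, hΩ] with y hy hyΩ using covDeriv_comm hg hyΩ hy v w
  have hcongr {X X' : E → Plane} (u : E) (h : X =ᶠ[𝓝 z] X') :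
      covDeriv g f u X z = covDeriv g f u X' z := by
    rw [covDeriv, covDeriv, dirDeriv_congr h, h.self_of_nhds]
  -- With T, Y the derivatives of f along v, w: ∇_T ∇_T Y = ∇_T ∇_Y T by torsion-freeness, and since
  -- ∇_T T = 0 near z the Ricci identity leaves R(T, Y)T only.
  have hcurv : metricForm g (f z) (covDeriv g f v Z z) (dirDeriv w f z) =
      -gaussCurvatureOfGram g (f z) * q z := by
    have hW := covDeriv_covDeriv hg hz hfz (contDiffAt_dirDeriv hfz v) v w
    have hzero : covDeriv g f w (covDeriv g f v (dirDeriv v f)) z = 0 := by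
      rw [hcongr w (X' := fun _ => 0) hgeo]
      ext k
      simp [covDeriv, dirDeriv]
    rw [hzero] at hW
    rw [hcongr v hZT, metricForm_curvature hg hz (dirDeriv v f z) (dirDeriv w f z) _
      (fun l => by simpa using hW l), hunit, horth.self_of_nhds]
    ring
  have h2Y : DifferentiableAt ℝ (fun y => (2 : ℝ) • dirDeriv w f y) z := hYd.const_smul (2 : ℝ)
  have h2 : covDeriv g f v (fun y => (2 : ℝ) • dirDeriv w f y) z = (2 : ℝ) • Z z := by
    simp only [hZ, covDeriv, christoffelForm_smul_right, smul_add]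
    congr 1
    have h := fderiv_fun_const_smul hYd (2 : ℝ)
    rw [dirDeriv, h]
    rfl
  have hq2 : dirDeriv v (dirDeriv v q) z =
      2 * metricForm g (f z) (Z z) (Z z) - 2 * gaussCurvatureOfGram g (f z) * q z := by
    rw [dirDeriv_congr hq1, dirDeriv_metricForm hg hz hfd h2Y hZd, h2, metricForm_smul_left,
      metricForm_smul_left, metricForm_symm hg hz (dirDeriv w f z), hcurv]
    ring
  have hq1z : dirDeriv v q z = 2 * metricForm g (f z) (dirDeriv w f z) (Z z) := by
    rw [hq1.self_of_nhds]
    exact metricForm_smul_left ..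
  rw [hq2, hq1z]
  -- Y and ∇_T Y are both orthogonal to the unit vector T, hence parallel in dimension two. So q
  -- |∇_T Y|² = ⟨Y, ∇_T Y⟩² = q'²/4, which eliminates |∇_T Y|² from q''.
  have := metricForm_mul_of_orthogonal hg hz hunit horth.self_of_nhds hTZ
  linear_combination 2 * this

/-- The second derivative of the distance along a curve `c` in geodesic polar coordinates: if the
covariant acceleration of the curve vanishes, then `r'' = θ'² ⟨Y, ∇_r Y⟩`. -/
lemma deriv_radial (hg : GramOn g Ω) {f : ℝ × ℝ → Plane} {r θ r' θ' : ℝ → ℝ} {s r'' : ℝ}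
    (hz : f (r s, θ s) ∈ Ω) (hf : ∀ᶠ y in 𝓝 (r s, θ s), ContDiffAt ℝ ∞ f y)
    (hgeo : covDeriv g f (1, 0) (dirDeriv (1, 0) f) (r s, θ s) = 0)
    (hunit : ∀ᶠ y in 𝓝 (r s, θ s),
      metricForm g (f y) (dirDeriv (1, 0) f y) (dirDeriv (1, 0) f y) = 1)
    (horth : ∀ᶠ y in 𝓝 (r s, θ s),
      metricForm g (f y) (dirDeriv (1, 0) f y) (dirDeriv (0, 1) f y) = 0)
    (hr : ∀ᶠ τ in 𝓝 s, HasDerivAt r (r' τ) τ) (hθ : ∀ᶠ τ in 𝓝 s, HasDerivAt θ (θ' τ) τ)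
    (hr2 : HasDerivAt r' r'' s) {c : ℝ → Plane} (hc : ∀ᶠ τ in 𝓝 s, c τ = f (r τ, θ τ))
    (hc2 : DifferentiableAt ℝ (deriv c) s)
    (hacc : deriv (deriv c) s + christoffelForm g (c s) (deriv c s) (deriv c s) = 0) :
    r'' = θ' s ^ 2 * (dirDeriv (1, 0) (fun y => metricForm g (f y) (dirDeriv (0, 1) f y)
      (dirDeriv (0, 1) f y)) (r s, θ s) / 2) := by
  set z : ℝ × ℝ := (r s, θ s) with hzdef
  set P : ℝ → ℝ × ℝ := fun τ => (r τ, θ τ) with hP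
  have hfz := hf.self_of_nhds
  have hPd : ∀ᶠ τ in 𝓝 s, HasDerivAt P (r' τ, θ' τ) τ := by
    filter_upwards [hr, hθ] with τ h1 h2 using h1.prodMk h2
  have hPc : ContinuousAt P s := hPd.self_of_nhds.continuousAt
  have hlin (F : ℝ × ℝ → Plane) (y : ℝ × ℝ) (a b : ℝ) :
      fderiv ℝ F y (a, b) = a • dirDeriv (1, 0) F y + b • dirDeriv (0, 1) F y := by
    have : ((a, b) : ℝ × ℝ) = a • ((1 : ℝ), (0 : ℝ)) + b • ((0 : ℝ), (1 : ℝ)) := by simp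
    rw [this, map_add, map_smul, map_smul]
    rfl
  have hcd : ∀ᶠ τ in 𝓝 s, HasDerivAt c (r' τ • dirDeriv (1, 0) f (P τ)
      + θ' τ • dirDeriv (0, 1) f (P τ)) τ := by
    filter_upwards [hc.eventually_nhds, hPd, hPc.eventually hf] with τ h1 h2 h3
    have := (h3.differentiableAt (by simp)).hasFDerivAt.comp_hasDerivAt τ h2
    rw [hlin] at this
    exact this.congr_of_eventuallyEq h1
  have hcs : c s = f z := hc.self_of_nhds
  -- Pairing c' = r'T + θ'Y with T isolates r', as T is a unit vector orthogonal to Y. In this form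
  -- r' can be differentiated covariantly.
  have hr' : r' =ᶠ[𝓝 s] fun τ => metricForm g (c τ) (deriv c τ) (dirDeriv (1, 0) f (P τ)) := by
    have hΩ : ∀ᶠ y in 𝓝 z, f y ∈ Ω :=
      hfz.continuousAt.eventually_mem (hg.isOpen.mem_nhds hz)
    filter_upwards [hcd, hc, hPc.eventually hunit, hPc.eventually horth, hPc.eventually hΩ]
      with τ h1 h2 h3 h4 h5
    rw [h1.deriv, h2, metricForm_add_left, metricForm_smul_left, metricForm_smul_left,
      metricForm_symm hg h5 (dirDeriv (0, 1) f (P τ)), h3, h4]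
    ring
  have hT : HasDerivAt (fun τ => dirDeriv (1, 0) f (P τ))
      (r' s • dirDeriv (1, 0) (dirDeriv (1, 0) f) z
        + θ' s • dirDeriv (0, 1) (dirDeriv (1, 0) f) z) s := by
    have h := ((contDiffAt_dirDeriv hfz (1, 0)).differentiableAt
      (by simp)).hasFDerivAt.comp_hasDerivAt (f := P) s hPd.self_of_nhds
    rwa [hlin] at h
  have hdir (F : ℝ → Plane) (τ : ℝ) : dirDeriv 1 F τ = deriv F τ := by
    simp [dirDeriv]
  have hrr : r'' = dirDeriv 1 r' s := by
    simp [dirDeriv, hr2.deriv]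
  have hcz : c s ∈ Ω := by rwa [hcs]
  -- Along c the derivative of T is r' ∇_T T + θ' ∇_Y T; the first term is zero and ∇_Y T = ∇_T Y.
  have hTc : covDeriv g c 1 (fun τ => dirDeriv (1, 0) f (P τ)) s =
      θ' s • covDeriv g f (1, 0) (dirDeriv (0, 1) f) z := by
    have hg0 : dirDeriv (1, 0) (dirDeriv (1, 0) f) z +
      christoffelForm g (f z) (dirDeriv (1, 0) f z) (dirDeriv (1, 0) f z) = 0 := hgeo
    rw [covDeriv_comm hg hz hfz, covDeriv, covDeriv, hdir, hdir, hT.deriv, hcs,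
      hcd.self_of_nhds.deriv, christoffelForm_add_left, christoffelForm_smul_left,
      christoffelForm_smul_left, eq_neg_of_add_eq_zero_left hg0]
    simp only [hP, ← hzdef, smul_add, smul_neg]
    abel
  have hTZ : metricForm g (f z) (dirDeriv (1, 0) f z)
      (covDeriv g f (1, 0) (dirDeriv (0, 1) f) z) = 0 := by
    have h0 : dirDeriv (0, 1) (fun y => metricForm g (f y) (dirDeriv (1, 0) f y)
      (dirDeriv (1, 0) f y)) z = dirDeriv (0, 1) (fun _ => (1 : ℝ)) z := dirDeriv_congr hunit _
    rw [dirDeriv_metricForm_transversal hg hz hfz] at h0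
    simpa [dirDeriv] using h0
  have hYd := (contDiffAt_dirDeriv hfz (0, 1)).differentiableAt (n := ∞) (by simp)
  have hacc' : covDeriv g c 1 (deriv c) s = 0 := by
    rw [covDeriv, hdir, hdir, hacc]
  -- Here r'' = ⟨∇c', T⟩ + ⟨c', ∇T⟩. The first summand is zero by `hacc'`, and the T-component of c'
  -- contributes nothing to the second by `hTZ`.
  rw [hrr, dirDeriv_congr hr', dirDeriv_metricForm hg hcz hcd.self_of_nhds.differentiableAt hc2
    hT.differentiableAt, hacc', hTc, dirDeriv_metricForm hg hz (hfz.differentiableAt (by simp))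
    hYd hYd, hcs, hcd.self_of_nhds.deriv]
  simp only [hP, ← hzdef, metricForm_zero_left, metricForm_smul_right, metricForm_add_left,
    metricForm_smul_left, hTZ]
  rw [metricForm_symm hg hz (covDeriv g f (1, 0) (dirDeriv (0, 1) f) z)]
  ring

end Families

/-! ### The metric in a chart -/

section Chart

variable {M : Type*} [MetricSpace M] [ChartedSpace Plane M] [IsManifold (𝓡 2) ∞ M]

lemma mfderiv_chart_symm_comp (x : M) {z : Plane} (hz : z ∈ (extChartAt (𝓡 2) x).target)
    (u : TangentSpace (𝓡 2) ((extChartAt (𝓡 2) x).symm z)) :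
    mfderiv 𝓘(ℝ, Plane) (𝓡 2) (extChartAt (𝓡 2) x).symm z
      (mfderiv (𝓡 2) 𝓘(ℝ, Plane) (extChartAt (𝓡 2) x) ((extChartAt (𝓡 2) x).symm z) u) = u := by
  have : IsManifold (𝓡 2) 1 M := IsManifold.of_le (n := ∞) (by simp)
  have h := mfderivWithin_extChartAt_symm_comp_mfderiv_extChartAt hz
  rw [show range (𝓡 2) = univ by simp, mfderivWithin_univ] at h
  exact congrArg (fun L => L u) h

lemma mfderiv_chart_comp_symm (x : M) {z : Plane} (hz : z ∈ (extChartAt (𝓡 2) x).target)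
    (u : Plane) :
    mfderiv (𝓡 2) 𝓘(ℝ, Plane) (extChartAt (𝓡 2) x) ((extChartAt (𝓡 2) x).symm z)
      (mfderiv 𝓘(ℝ, Plane) (𝓡 2) (extChartAt (𝓡 2) x).symm z u) = u := by
  have : IsManifold (𝓡 2) 1 M := IsManifold.of_le (n := ∞) (by simp)
  have h := mfderiv_extChartAt_comp_mfderivWithin_extChartAt_symm hz
  rw [show range (𝓡 2) = univ by simp, mfderivWithin_univ] at h
  exact congrArg (fun L => L u) h

/-- The components of tangent vectors at `y` in the chart around `x`. -/
def chartDeriv (x y : M) : TangentSpace (𝓡 2) y →L[ℝ] Plane :=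
  mfderiv (𝓡 2) 𝓘(ℝ, Plane) (extChartAt (𝓡 2) x) y

lemma chartDeriv_mfderiv {E : Type*} [NormedAddCommGroup E] [NormedSpace ℝ E] {F : E → M} {z : E}
    (hF : MDifferentiableAt 𝓘(ℝ, E) (𝓡 2) F z) (x : M) (hx : F z ∈ (chartAt Plane x).source)
    (a : E) :
    chartDeriv x (F z) (mfderiv 𝓘(ℝ, E) (𝓡 2) F z a) =
      fderiv ℝ (fun y => extChartAt (𝓡 2) x (F y)) z a := by
  have : IsManifold (𝓡 2) 1 M := IsManifold.of_le (n := ∞) (by simp)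
  have h := mfderiv_comp z (mdifferentiableAt_extChartAt (I := 𝓡 2) hx) hF
  rw [mfderiv_eq_fderiv] at h
  exact (congrArg (fun L => L a) h).symm

lemma chartDeriv_injective (x : M) {y : M} (hy : y ∈ (chartAt Plane x).source) :
    Function.Injective (chartDeriv x y) := by
  have : IsManifold (𝓡 2) 1 M := IsManifold.of_le (n := ∞) (by simp)
  have hy' : y ∈ (extChartAt (𝓡 2) x).source := by rwa [extChartAt_source]
  exact (isInvertible_mfderiv_extChartAt hy').injective

variable [RiemannianBundle (fun x : M => TangentSpace (𝓡 2) x)]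

lemma metricForm_chartGram (x : M) (z u v : Plane) :
    metricForm (chartGram x) z u v =
      inner ℝ (mfderiv 𝓘(ℝ, Plane) (𝓡 2) (extChartAt (𝓡 2) x).symm z u)
        (mfderiv 𝓘(ℝ, Plane) (𝓡 2) (extChartAt (𝓡 2) x).symm z v) := by
  have hdec (w : Plane) : w = ∑ k, w k • EuclideanSpace.single k (1 : ℝ) := by
    ext i
    fin_cases i <;> simp
  have hL (w : Plane) : mfderiv 𝓘(ℝ, Plane) (𝓡 2) (extChartAt (𝓡 2) x).symm z w =
      ∑ k, w k • coordVec x z k := by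
    conv_lhs => rw [hdec w]
    refine (map_sum (mfderiv 𝓘(ℝ, Plane) (𝓡 2) (extChartAt (𝓡 2) x).symm z) _ _).trans ?_
    refine Finset.sum_congr rfl fun k _ => ?_
    exact map_smul (mfderiv 𝓘(ℝ, Plane) (𝓡 2) (extChartAt (𝓡 2) x).symm z) _ _
  rw [hL, hL]
  simp only [metricForm, chartGram, Fin.sum_univ_two, Matrix.of_apply, inner_add_left,
    inner_add_right, real_inner_smul_left, real_inner_smul_right]
  ring

lemma inner_eq_metricForm (x : M) {y : M} (hy : y ∈ (chartAt Plane x).source)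
    (u v : TangentSpace (𝓡 2) y) :
    inner ℝ u v = metricForm (chartGram x) (extChartAt (𝓡 2) x y)
      (chartDeriv x y u) (chartDeriv x y v) := by
  have hy' : y ∈ (extChartAt (𝓡 2) x).source := by rwa [extChartAt_source]
  obtain ⟨z, hz, rfl⟩ : ∃ z ∈ (extChartAt (𝓡 2) x).target, (extChartAt (𝓡 2) x).symm z = y :=
    ⟨_, (extChartAt (𝓡 2) x).map_source hy', (extChartAt (𝓡 2) x).left_inv hy'⟩
  have h (w : TangentSpace (𝓡 2) ((extChartAt (𝓡 2) x).symm z)) :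
      mfderiv 𝓘(ℝ, Plane) (𝓡 2) (extChartAt (𝓡 2) x).symm z
        (chartDeriv x ((extChartAt (𝓡 2) x).symm z) w) = w := mfderiv_chart_symm_comp x hz w
  rw [(extChartAt (𝓡 2) x).right_inv hz, metricForm_chartGram, h, h]

lemma metricForm_chartGram_pos (x : M) {z : Plane} (hz : z ∈ (extChartAt (𝓡 2) x).target)
    {u : Plane} (hu : u ≠ 0) : 0 < metricForm (chartGram x) z u u := by
  rw [metricForm_chartGram, real_inner_self_eq_norm_sq]
  have : mfderiv 𝓘(ℝ, Plane) (𝓡 2) (extChartAt (𝓡 2) x).symm z u ≠ 0 := by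
    intro h0
    have h1 := mfderiv_chart_comp_symm x hz u
    rw [h0] at h1
    exact hu (h1.symm.trans (map_zero _))
  positivity

variable [IsContMDiffRiemannianBundle (𝓡 2) ∞ Plane (fun x : M => TangentSpace (𝓡 2) x)]

/-- The coordinate fields are images of constant fields under the tangent map of the inverse chart,
hence smooth sections, and the bundle metric is smooth. A kernel vector of the matrix would have
length zero, so the determinant cannot vanish. -/
lemma gramOn_chartGram (x : M) : GramOn (chartGram x) (extChartAt (𝓡 2) x).target where
  isOpen := isOpen_extChartAt_target x
  contDiffAt y hy i j := by
    have : IsManifold (𝓡 2) 1 M := IsManifold.of_le (n := ∞) (by simp)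
    have hop := isOpen_extChartAt_target (I := 𝓡 2) x
    have hsec (i : Fin 2) : ContMDiffAt 𝓘(ℝ, Plane) ((𝓡 2).prod 𝓘(ℝ, Plane)) ∞
        (fun z => (coordVec x z i : TotalSpace Plane (fun x : M => TangentSpace (𝓡 2) x))) y := by
      have h1 := (contMDiffOn_extChartAt_symm (I := 𝓡 2) (n := ∞) x).contMDiffOn_tangentMapWithin
        (m := ∞) (by simp) hop.uniqueMDiffOn
      have h2 : ContMDiff 𝓘(ℝ, Plane) (𝓘(ℝ, Plane).prod 𝓘(ℝ, Plane)) ∞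
          (fun z => (⟨z, EuclideanSpace.single i (1 : ℝ)⟩ : TangentBundle 𝓘(ℝ, Plane) Plane)) :=
        contMDiff_vectorSpace_iff_contDiff.2 contDiff_const
      have h3 := (h1.comp h2.contMDiffOn (s := (extChartAt (𝓡 2) x).target)
        (fun z hz => hz)).contMDiffAt (hop.mem_nhds hy)
      refine h3.congr_of_eventuallyEq ?_
      filter_upwards [hop.mem_nhds hy] with z hz
      simp only [Function.comp_apply, tangentMapWithin, coordVec]
      rw [mfderivWithin_of_mem_nhds (hop.mem_nhds hz)]
    exact ((hsec i).inner_bundle (hsec j)).contDiffAt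
  symm y _ i j := by
    simp only [chartGram, Matrix.of_apply]
    exact real_inner_comm _ _
  det_ne y hy hdet := by
    obtain ⟨v, hv, hv0⟩ := Matrix.exists_mulVec_eq_zero_iff.2 hdet
    have hu : (WithLp.toLp 2 v : Plane) ≠ 0 := fun h => hv (by simpa using h)
    refine (metricForm_chartGram_pos x hy hu).ne' ?_
    have h0 := congrFun hv0 0
    have h1 := congrFun hv0 1
    simp only [Matrix.mulVec, dotProduct, Fin.sum_univ_two, Pi.zero_apply] at h0 h1
    simp only [metricForm, Fin.sum_univ_two]
    linear_combination v 0 * h0 + v 1 * h1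

end Chart

/-! ### Geodesics -/

section Geodesics

lemma contDiffAt_deriv {G : Type*} [NormedAddCommGroup G] [NormedSpace ℝ G] {F : ℝ → G} {t : ℝ}
    (h : ContDiffAt ℝ 2 F t) : ContDiffAt ℝ 1 (deriv F) t :=
  (h.fderiv_right (m := 1) (by norm_num)).clm_apply (contDiffAt_const (c := (1 : ℝ)))

variable {M : Type*} [MetricSpace M] [ChartedSpace Plane M] [IsManifold (𝓡 2) ∞ M]

lemma contDiffAt_chart_comp {E : Type*} [NormedAddCommGroup E] [NormedSpace ℝ E] {F : E → M} {z : E}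
    {n : ℕ∞ω} (hn : n ≤ ∞) (hF : ContMDiffAt 𝓘(ℝ, E) (𝓡 2) n F z) (x : M)
    (hx : F z ∈ (chartAt Plane x).source) :
    ContDiffAt ℝ n (fun y => extChartAt (𝓡 2) x (F y)) z := by
  have : IsManifold (𝓡 2) n M := IsManifold.of_le hn
  exact ((contMDiffAt_extChartAt' (I := 𝓡 2) (n := n) hx).comp z hF).contDiffAt

lemma chartDeriv_velocity {σ : ℝ → M} {t : ℝ} (hσ : MDifferentiableAt 𝓘(ℝ, ℝ) (𝓡 2) σ t) (x : M)
    (hx : σ t ∈ (chartAt Plane x).source) :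
    chartDeriv x (σ t) (velocity σ t) = deriv (fun τ => extChartAt (𝓡 2) x (σ τ)) t := by
  rw [velocity, chartDeriv_mfderiv hσ x hx, fderiv_eq_smul_deriv, one_smul]

lemma tangentBundle_ext {q₁ q₂ : TangentBundle (𝓡 2) M} (h : q₁.1 = q₂.1) (x : M)
    (hx : q₁.1 ∈ (chartAt Plane x).source)
    (hd : chartDeriv x q₁.1 q₁.2 = chartDeriv x q₂.1 q₂.2) : q₁ = q₂ := by
  obtain ⟨p, u⟩ := q₁
  obtain ⟨p', v⟩ := q₂
  obtain rfl : p = p' := h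
  exact congrArg _ (chartDeriv_injective x hx hd)

lemma deriv_chart_eq_of_lift {σ : ℝ → M} {t : ℝ} (hσ : MDifferentiableAt 𝓘(ℝ, ℝ) (𝓡 2) σ t)
    {q : TangentBundle (𝓡 2) M} (h : lift σ t = q) (x : M)
    (hx : q.1 ∈ (chartAt Plane x).source) :
    deriv (fun τ => extChartAt (𝓡 2) x (σ τ)) t = chartDeriv x q.1 q.2 := by
  subst h
  exact (chartDeriv_velocity hσ x hx).symm

/-- Velocities of two curves through one point live in types that depend on how the base point is
written. Comparing them in the tangent bundle, through chart components, avoids any transport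
between these types. -/
lemma lift_eq_iff {σ : ℝ → M} {t : ℝ} (hσ : MDifferentiableAt 𝓘(ℝ, ℝ) (𝓡 2) σ t)
    {q : TangentBundle (𝓡 2) M} (x : M) (hx : q.1 ∈ (chartAt Plane x).source) :
    lift σ t = q ↔ σ t = q.1 ∧
      deriv (fun τ => extChartAt (𝓡 2) x (σ τ)) t = chartDeriv x q.1 q.2 := by
  refine ⟨fun h => ⟨congrArg (·.1) h, deriv_chart_eq_of_lift hσ h x hx⟩, fun ⟨h1, h2⟩ => ?_⟩
  have hx' : σ t ∈ (chartAt Plane x).source := by rwa [h1]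
  refine tangentBundle_ext h1 x hx' ?_
  rw [← h2]
  exact chartDeriv_velocity hσ x hx'

variable [RiemannianBundle (fun x : M => TangentSpace (𝓡 2) x)]

/-- Bridge from the componentwise definition to the vector calculus of `covDeriv`; `C²` regularity
is what lets components be taken before or after differentiating. -/
lemma covAccel_eq {σ : ℝ → M} {t : ℝ} (x : M)
    (hσ : ContDiffAt ℝ 2 (fun τ => extChartAt (𝓡 2) x (σ τ)) t) (k : Fin 2) :
    covAccel x σ t k = (deriv (deriv fun τ => extChartAt (𝓡 2) x (σ τ)) t
      + christoffelForm (chartGram x) (extChartAt (𝓡 2) x (σ t))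
        (deriv (fun τ => extChartAt (𝓡 2) x (σ τ)) t)
        (deriv (fun τ => extChartAt (𝓡 2) x (σ τ)) t)) k := by
  set c : ℝ → Plane := fun τ => extChartAt (𝓡 2) x (σ τ) with hc
  have hdir {X : ℝ → Plane} {τ : ℝ} (hX : DifferentiableAt ℝ X τ) (i : Fin 2) :
      deriv (fun τ => X τ i) τ = deriv X τ i := by
    have := dirDeriv_apply hX 1 i
    simpa only [dirDeriv, fderiv_eq_smul_deriv, one_smul] using this
  have h1 : ∀ᶠ τ in 𝓝 t, DifferentiableAt ℝ c τ := by
    filter_upwards [hσ.eventually (by simp)] with τ hτ using hτ.differentiableAt (by simp)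
  have h2 : DifferentiableAt ℝ (deriv c) t :=
    (contDiffAt_deriv hσ).differentiableAt one_ne_zero
  have h3 (i : Fin 2) : deriv (fun τ => c τ i) =ᶠ[𝓝 t] fun τ => deriv c τ i := by
    filter_upwards [h1] with τ hτ using hdir hτ i
  have h4 : covAccel x σ t k = deriv (deriv fun τ => c τ k) t + ∑ i, ∑ j,
      christoffel (chartGram x) k i j (c t) * deriv (fun τ => c τ i) t
        * deriv (fun τ => c τ j) t := rfl
  rw [h4, (h3 k).deriv_eq, hdir h2]
  simp only [hdir h1.self_of_nhds]
  rfl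

lemma isGeodesicOn_iff {σ : ℝ → M} {s : Set ℝ} :
    IsGeodesicOn σ s ↔ ∀ t ∈ s, ContMDiffAt 𝓘(ℝ, ℝ) (𝓡 2) 2 σ t ∧
      ∀ x : M, σ t ∈ (chartAt Plane x).source →
        deriv (deriv fun τ => extChartAt (𝓡 2) x (σ τ)) t
          + christoffelForm (chartGram x) (extChartAt (𝓡 2) x (σ t))
            (deriv (fun τ => extChartAt (𝓡 2) x (σ τ)) t)
            (deriv (fun τ => extChartAt (𝓡 2) x (σ τ)) t) = 0 := by
  refine forall₂_congr fun t _ => and_congr_right fun hσ => forall₂_congr fun x hx => ?_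
  have hc := contDiffAt_chart_comp (ENat.LEInfty.out) hσ x hx
  constructor
  · intro h
    ext k
    rw [← covAccel_eq x hc k, h k]
    rfl
  · intro h k
    rw [covAccel_eq x hc k, h]
    rfl

/-- The acceleration is quadratic in the rate of the reparametrization. Nothing is assumed of σ or
a, so the rate a = 0, which `expMap_smul` uses at time 0, is covered. -/
lemma covAccel_affine (x : M) (σ : ℝ → M) (a b t : ℝ) (k : Fin 2) :
    covAccel x (fun τ => σ (a * τ + b)) t k = a ^ 2 * covAccel x σ (a * t + b) k := by
  have hd (F : ℝ → ℝ) : deriv (fun τ => F (a * τ + b)) = fun τ => a * deriv F (a * τ + b) := by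
    funext τ
    have := deriv_comp_mul_left a (fun y => F (y + b)) τ
    rw [deriv_comp_add_const] at this
    exact this
  simp only [covAccel]
  rw [hd fun τ => extChartAt (𝓡 2) x (σ τ) k, deriv_const_mul_field,
    hd (deriv fun τ => extChartAt (𝓡 2) x (σ τ) k)]
  simp only [Fin.sum_univ_two]
  rw [hd fun τ => extChartAt (𝓡 2) x (σ τ) 0, hd fun τ => extChartAt (𝓡 2) x (σ τ) 1]
  ring

lemma IsGeodesicOn.affine {σ : ℝ → M} {s s' : Set ℝ} (h : IsGeodesicOn σ s) (a b : ℝ)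
    (hs : ∀ t ∈ s', a * t + b ∈ s) : IsGeodesicOn (fun τ => σ (a * τ + b)) s' := by
  intro t ht
  obtain ⟨h1, h2⟩ := h _ (hs t ht)
  refine ⟨?_, fun x hx k => by rw [covAccel_affine, h2 x hx k, mul_zero]⟩
  have : ContMDiffAt 𝓘(ℝ, ℝ) 𝓘(ℝ, ℝ) 2 (fun τ : ℝ => a * τ + b) t :=
    ContDiffAt.contMDiffAt (by fun_prop)
  exact ContMDiffAt.comp t h1 this

lemma IsGeodesicOn.mono {σ : ℝ → M} {s s' : Set ℝ} (h : IsGeodesicOn σ s) (hs : s' ⊆ s) :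
    IsGeodesicOn σ s' := fun t ht => h t (hs ht)

lemma IsGeodesicOn.mdifferentiableAt {σ : ℝ → M} {s : Set ℝ} (h : IsGeodesicOn σ s) {t : ℝ}
    (ht : t ∈ s) : MDifferentiableAt 𝓘(ℝ, ℝ) (𝓡 2) σ t :=
  (h t ht).1.mdifferentiableAt two_ne_zero

variable [IsContMDiffRiemannianBundle (𝓡 2) ∞ Plane (fun x : M => TangentSpace (𝓡 2) x)]

/-- Local uniqueness of geodesics with given initial point and velocity. -/
lemma IsGeodesicOn.eventuallyEq_right {σ₁ σ₂ : ℝ → M} {a b : ℝ} (hab : a < b)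
    (h₁ : IsGeodesicOn σ₁ (Icc a b)) (h₂ : IsGeodesicOn σ₂ (Icc a b)) (h : σ₁ a = σ₂ a)
    (hd : deriv (fun τ => extChartAt (𝓡 2) (σ₁ a) (σ₁ τ)) a =
      deriv (fun τ => extChartAt (𝓡 2) (σ₁ a) (σ₂ τ)) a) :
    ∀ᶠ t in 𝓝[>] a, σ₁ t = σ₂ t := by
  set x := σ₁ a with hx
  have hg := gramOn_chartGram x
  -- The geodesic equation as an autonomous first order system for position and velocity. Its field
  -- is `C¹` at the initial state, hence Lipschitz nearby, and ODE uniqueness applies.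
  set V : Plane × Plane → Plane × Plane :=
    fun y => (y.2, -christoffelForm (chartGram x) y.1 y.2 y.2) with hV
  set y : (ℝ → M) → ℝ → Plane × Plane := fun σ t =>
    (extChartAt (𝓡 2) x (σ t), deriv (fun τ => extChartAt (𝓡 2) x (σ τ)) t) with hy
  have hxs : x ∈ (chartAt Plane x).source := mem_chart_source Plane x
  have hxt : (y σ₁ a).1 ∈ (extChartAt (𝓡 2) x).target := by
    simp only [hy, ← hx]
    exact mem_extChartAt_target x
  have hVs : ContDiffAt ℝ 1 V (y σ₁ a) := by
    refine ContDiffAt.of_le (n := ∞) ?_ (by simp)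
    exact contDiffAt_snd.prodMk
      (contDiffAt_christoffelForm hg hxt contDiffAt_fst contDiffAt_snd contDiffAt_snd).neg
  obtain ⟨K, S, hS, hLip⟩ := hVs.exists_lipschitzOnWith
  have key {σ : ℝ → M} (hσ : IsGeodesicOn σ (Icc a b)) (ha : σ a = x) (hya : y σ a = y σ₁ a) :
      ∀ᶠ t in 𝓝[≥] a, σ t ∈ (chartAt Plane x).source ∧ HasDerivAt (y σ) (V (y σ t)) t ∧
        y σ t ∈ S := by
    have hya' : ContDiffAt ℝ 2 (fun τ => extChartAt (𝓡 2) x (σ τ)) a :=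
      contDiffAt_chart_comp ENat.LEInfty.out (hσ a ⟨le_rfl, hab.le⟩).1 x (by rwa [ha])
    have hyc : ContinuousAt (y σ) a :=
      hya'.continuousAt.prodMk (contDiffAt_deriv hya').continuousAt
    have e1 : ∀ᶠ t in 𝓝 a, σ t ∈ (chartAt Plane x).source :=
      (hσ a ⟨le_rfl, hab.le⟩).1.continuousAt.eventually_mem
        ((chartAt Plane x).open_source.mem_nhds (by rwa [ha]))
    have e2 : ∀ᶠ t in 𝓝 a, y σ t ∈ S := hyc.eventually_mem (by rwa [hya])
    filter_upwards [nhdsWithin_le_nhds e1, nhdsWithin_le_nhds e2,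
      mem_nhdsWithin_of_mem_nhds (Iio_mem_nhds hab), self_mem_nhdsWithin] with t t1 t2 t3 t4
    have ht : t ∈ Icc a b := ⟨t4, t3.le⟩
    have hc : ContDiffAt ℝ 2 (fun τ => extChartAt (𝓡 2) x (σ τ)) t :=
      contDiffAt_chart_comp ENat.LEInfty.out (hσ t ht).1 x t1
    refine ⟨t1, ?_, t2⟩
    have d1 := (hc.differentiableAt two_ne_zero).hasDerivAt
    have d2 := ((contDiffAt_deriv hc).differentiableAt one_ne_zero).hasDerivAt
    rw [eq_neg_of_add_eq_zero_left ((isGeodesicOn_iff.1 hσ t ht).2 x t1)] at d2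
    exact d1.prodMk d2
  have k1 := key h₁ rfl rfl
  have hya2 : y σ₂ a = y σ₁ a := by
    simp only [hy]
    rw [← h, ← hd]
  have k2 := key h₂ h.symm hya2
  obtain ⟨ε, hε, hsub⟩ := (mem_nhdsGE_iff_exists_Icc_subset).1 (k1.and k2)
  have huniq : EqOn (y σ₁) (y σ₂) (Icc a ε) := by
    refine ODE_solution_unique_of_mem_Icc_right (v := fun _ => V) (s := fun _ => S) (K := K)
      (fun _ _ => hLip) ?_ ?_ ?_ ?_ ?_ ?_ hya2.symm
    · exact fun t ht => (hsub ht).1.2.1.continuousAt.continuousWithinAt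
    · exact fun t ht => (hsub (Ico_subset_Icc_self ht)).1.2.1.hasDerivWithinAt
    · exact fun t ht => (hsub (Ico_subset_Icc_self ht)).1.2.2
    · exact fun t ht => (hsub ht).2.2.1.continuousAt.continuousWithinAt
    · exact fun t ht => (hsub (Ico_subset_Icc_self ht)).2.2.1.hasDerivWithinAt
    · exact fun t ht => (hsub (Ico_subset_Icc_self ht)).2.2.2
  filter_upwards [Ioc_mem_nhdsGT hε] with t ht
  have ht' : t ∈ Icc a ε := ⟨ht.1.le, ht.2⟩
  refine (extChartAt (𝓡 2) x).injOn ?_ ?_ (congrArg Prod.fst (huniq ht'))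
  · rw [extChartAt_source]
    exact (hsub ht').1.1
  · rw [extChartAt_source]
    exact (hsub ht').2.1

/-- Uniqueness of geodesics with given initial point and velocity. -/
lemma IsGeodesicOn.eqOn_of_lift_eq {σ₁ σ₂ : ℝ → M} {T : ℝ}
    (h₁ : IsGeodesicOn σ₁ (Icc 0 T)) (h₂ : IsGeodesicOn σ₂ (Icc 0 T))
    (h : lift σ₁ 0 = lift σ₂ 0) : EqOn σ₁ σ₂ (Icc 0 T) := by
  have hcont {σ : ℝ → M} (hσ : IsGeodesicOn σ (Icc 0 T)) : ContinuousOn σ (Icc 0 T) :=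
    fun t ht => (hσ t ht).1.continuousAt.continuousWithinAt
  have hcl : IsClosed ({t | σ₁ t = σ₂ t} ∩ Icc 0 T) := by
    rw [inter_comm]
    exact ((hcont h₁).prodMk (hcont h₂)).preimage_isClosed_of_isClosed isClosed_Icc
      isClosed_diagonal
  have h0 : σ₁ 0 = σ₂ 0 := congrArg (·.1) h
  -- Continuous induction: agreement on [0, t] has to be extended to the right of t. The velocities
  -- at t agree by hypothesis if t = 0, and otherwise as derivatives within [0, t].
  refine hcl.Icc_subset_of_forall_mem_nhdsGT_of_Icc_subset h0 ?_
  intro t ht hsub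
  have htT : t ∈ Icc 0 T := ⟨ht.1, ht.2.le⟩
  have htt : σ₁ t = σ₂ t := hsub ⟨ht.1, le_rfl⟩
  refine IsGeodesicOn.eventuallyEq_right ht.2 (h₁.mono (Icc_subset_Icc_left ht.1))
    (h₂.mono (Icc_subset_Icc_left ht.1)) htt ?_
  have m1 := h₁.mdifferentiableAt htT
  have m2 := h₂.mdifferentiableAt htT
  have hs1 : σ₁ t ∈ (chartAt Plane (σ₁ t)).source := mem_chart_source Plane _
  rcases ht.1.eq_or_lt with rfl | hpos
  · rw [deriv_chart_eq_of_lift m1 h _ (by rw [← h]; exact hs1),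
      deriv_chart_eq_of_lift m2 rfl _ (by rw [← h]; exact hs1)]
  · have d1 := (contDiffAt_chart_comp ENat.LEInfty.out (h₁ t htT).1 (σ₁ t) hs1).differentiableAt
      two_ne_zero
    have d2 := (contDiffAt_chart_comp ENat.LEInfty.out (h₂ t htT).1 (σ₁ t)
      (by rw [← htt]; exact hs1)).differentiableAt two_ne_zero
    have hu : UniqueDiffWithinAt ℝ (Icc 0 t) t :=
      uniqueDiffOn_Icc hpos t ⟨hpos.le, le_rfl⟩
    rw [← d1.derivWithin hu, ← d2.derivWithin hu]
    refine derivWithin_congr (fun τ hτ => ?_) (by rw [htt])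
    rw [show σ₁ τ = σ₂ τ from hsub hτ]

lemma lift_comp_affine {σ : ℝ → M} {a b t : ℝ}
    (hσ : MDifferentiableAt 𝓘(ℝ, ℝ) (𝓡 2) σ (a * t + b)) {p : M} {v : TangentSpace (𝓡 2) p}
    (h : lift σ (a * t + b) = ⟨p, v⟩) : lift (fun τ => σ (a * τ + b)) t = ⟨p, a • v⟩ := by
  have hps : p ∈ (chartAt Plane p).source := mem_chart_source Plane p
  have hm : MDifferentiableAt 𝓘(ℝ, ℝ) 𝓘(ℝ, ℝ) (fun τ : ℝ => a * τ + b) t :=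
    DifferentiableAt.mdifferentiableAt (by fun_prop)
  have hc : MDifferentiableAt 𝓘(ℝ, ℝ) (𝓡 2) (fun τ => σ (a * τ + b)) t :=
    MDifferentiableAt.comp (g := σ) (f := fun τ : ℝ => a * τ + b) t hσ hm
  rw [lift_eq_iff hc p hps]
  refine ⟨congrArg (·.1) h, ?_⟩
  have h1 := deriv_chart_eq_of_lift hσ h p hps
  have h2 := deriv_comp_mul_left a (fun τ => extChartAt (𝓡 2) p (σ (τ + b))) t
  rw [h2, deriv_comp_add_const (f := fun τ => extChartAt (𝓡 2) p (σ τ)), h1]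
  simp

lemma lift_comp_mul {σ : ℝ → M} (hσ : MDifferentiableAt 𝓘(ℝ, ℝ) (𝓡 2) σ 0) {p : M}
    {v : TangentSpace (𝓡 2) p} (h : lift σ 0 = ⟨p, v⟩) (a : ℝ) :
    lift (fun τ => σ (a * τ + 0)) 0 = ⟨p, a • v⟩ := by
  have h0 : a * 0 + 0 = 0 := by ring
  exact lift_comp_affine (by rwa [h0]) (by rwa [h0])

/-- By uniqueness of geodesics the one selected by choice in `expMap` may be replaced by any other
with the same initial velocity. -/
lemma expMap_eq {σ : ℝ → M} (hσ : IsGeodesicOn σ (Icc 0 1)) {p : M} {v : TangentSpace (𝓡 2) p}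
    (h : lift σ 0 = ⟨p, v⟩) : expMap p v = σ 1 := by
  have hE : HasExp p v := ⟨σ, hσ, h⟩
  rw [expMap, dif_pos hE]
  exact hE.choose_spec.1.eqOn_of_lift_eq hσ (hE.choose_spec.2.trans h.symm)
    ⟨zero_le_one, le_rfl⟩

lemma expMap_smul {σ : ℝ → M} {T : ℝ} (hT : 0 ≤ T) (hσ : IsGeodesicOn σ (Icc 0 T)) {p : M}
    {v : TangentSpace (𝓡 2) p} (h : lift σ 0 = ⟨p, v⟩) {t : ℝ} (ht : t ∈ Icc 0 T) :
    expMap p (t • v) = σ t := by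
  rw [expMap_eq (hσ.affine t 0 ?_) (lift_comp_mul (hσ.mdifferentiableAt ⟨le_rfl, hT⟩) h t)]
  · simp
  · intro τ hτ
    rw [add_zero]
    exact ⟨mul_nonneg ht.1 hτ.1, (mul_le_of_le_one_right ht.1 hτ.2).trans ht.2⟩

end Geodesics

/-! ### Normal coordinates and the Gauss lemma -/

section Normal

lemma deriv_eq_of_eventuallyEq_right {G : Type*} [NormedAddCommGroup G] [NormedSpace ℝ G]
    {f h : ℝ → G} {a : ℝ} (hf : DifferentiableAt ℝ f a) (hh : DifferentiableAt ℝ h a)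
    (heq : f =ᶠ[𝓝[≥] a] h) : deriv f a = deriv h a := by
  have hu : UniqueDiffWithinAt ℝ (Ici a) a := uniqueDiffWithinAt_Ici a
  rw [← hf.derivWithin hu, ← hh.derivWithin hu]
  exact heq.derivWithin_eq (heq.self_of_nhdsWithin self_mem_Ici)

lemma deriv_eventuallyEq_right {G : Type*} [NormedAddCommGroup G] [NormedSpace ℝ G]
    {f h : ℝ → G} {a : ℝ} (hf : DifferentiableAt ℝ f a) (hh : DifferentiableAt ℝ h a)
    (heq : f =ᶠ[𝓝[≥] a] h) : deriv f =ᶠ[𝓝[≥] a] deriv h := by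
  have ha := deriv_eq_of_eventuallyEq_right hf hh heq
  have h1 : ∀ᶠ t in 𝓝[>] a, deriv f t = deriv h t := by
    have h2 : f =ᶠ[𝓝[>] a] h := heq.filter_mono (nhdsWithin_mono a Ioi_subset_Ici_self)
    filter_upwards [eventually_eventually_nhdsWithin.2 h2, self_mem_nhdsWithin] with t ht hta
    rw [isOpen_Ioi.nhdsWithin_eq hta] at ht
    exact Filter.EventuallyEq.deriv_eq ht
  rw [EventuallyEq, ← Ioi_insert, nhdsWithin_insert, eventually_sup]
  exact ⟨by simpa using ha, h1⟩

variable {M : Type*} [MetricSpace M] [ChartedSpace Plane M]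
  [RiemannianBundle (fun x : M => TangentSpace (𝓡 2) x)]
  {V : Type*} [NormedAddCommGroup V] [InnerProductSpace ℝ V]

/-- `e` is a smooth parametrization of an open subset of the surface by the ball of radius `δ`, that
maps rays to geodesics and is isometric at the origin. -/
structure IsNormalChart (e : OpenPartialHomeomorph V M) (δ : ℝ) : Prop where
  source : e.source = Metric.ball 0 δ
  contMDiffOn : ContMDiffOn 𝓘(ℝ, V) (𝓡 2) ∞ e e.source
  contMDiffOn_symm : ContMDiffOn (𝓡 2) 𝓘(ℝ, V) ∞ e.symm e.target
  geodesic : ∀ w ∈ Metric.ball (0 : V) δ, IsGeodesicOn (fun t : ℝ => e (t • w)) (Icc 0 1)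
  norm_velocity_zero : ∀ w ∈ Metric.ball (0 : V) δ,
    ‖velocity (fun t : ℝ => e (t • w)) 0‖ = ‖w‖

/-- The derivative of `e` at `w`. -/
def pushVec (e : V → M) (w : V) : V →L[ℝ] TangentSpace (𝓡 2) (e w) := mfderiv 𝓘(ℝ, V) (𝓡 2) e w

lemma velocity_comp {e : V → M} {u : ℝ → V} {u' : V} {t : ℝ}
    (he : MDifferentiableAt 𝓘(ℝ, V) (𝓡 2) e (u t)) (hu : HasDerivAt u u' t) :
    velocity (fun s => e (u s)) t = pushVec e (u t) u' := by
  have h := mfderiv_comp t he hu.differentiableAt.mdifferentiableAt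
  rw [mfderiv_eq_fderiv, hu.hasFDerivAt.fderiv] at h
  refine (congrArg (fun L => L (1 : ℝ)) h).trans ?_
  change pushVec e (u t) ((ContinuousLinearMap.toSpanSingleton ℝ u') (1 : ℝ)) = _
  simp

/-- The metric of the surface, pulled back by `e`. -/
def pullForm (e : V → M) (w a b : V) : ℝ := inner ℝ (pushVec e w a) (pushVec e w b)

lemma mem_ball_of_smul {δ T : ℝ} {w : V} (hw : w ∈ Metric.ball (0 : V) δ) (hT : T ∈ Icc (0 : ℝ) 1) :
    T • w ∈ Metric.ball (0 : V) δ := by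
  rw [mem_ball_zero_iff] at hw ⊢
  rw [norm_smul, Real.norm_of_nonneg hT.1]
  nlinarith [norm_nonneg w, hT.2]

/-- Since the ball is open, a ray can be followed beyond time 1; this supplies the right
neighbourhood of the endpoint needed to check the geodesic equation there. -/
lemma exists_smul_mem_ball {δ : ℝ} {w : V} (hw : w ∈ Metric.ball (0 : V) δ) :
    ∃ T : ℝ, 1 < T ∧ T • w ∈ Metric.ball (0 : V) δ := by
  have hc : Continuous fun T : ℝ => T • w := by fun_prop
  have h1 : ∀ᶠ T : ℝ in 𝓝 1, T • w ∈ Metric.ball (0 : V) δ :=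
    hc.continuousAt.eventually_mem (Metric.isOpen_ball.mem_nhds (by simpa using hw))
  have h2 : ∀ᶠ T : ℝ in 𝓝[>] 1, 1 < T ∧ T • w ∈ Metric.ball (0 : V) δ := by
    filter_upwards [nhdsWithin_le_nhds h1, self_mem_nhdsWithin] with T h1 h2 using ⟨h2, h1⟩
  exact h2.exists

section Form

variable (e : V → M) (w a b c : V) (r : ℝ)

lemma pullForm_symm : pullForm e w a b = pullForm e w b a := real_inner_comm _ _

lemma pullForm_smul_left : pullForm e w (r • a) b = r * pullForm e w a b := by
  rw [pullForm, map_smul, real_inner_smul_left, pullForm]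

lemma pullForm_smul_right : pullForm e w a (r • b) = r * pullForm e w a b := by
  rw [pullForm_symm, pullForm_smul_left, pullForm_symm]

end Form

variable {e : OpenPartialHomeomorph V M} {δ : ℝ}

lemma IsNormalChart.contMDiffAt (he : IsNormalChart e δ) {w : V} (hw : w ∈ Metric.ball (0 : V) δ) :
    ContMDiffAt 𝓘(ℝ, V) (𝓡 2) ∞ e w :=
  he.contMDiffOn.contMDiffAt (e.open_source.mem_nhds (by rwa [he.source]))

lemma IsNormalChart.mdifferentiableAt (he : IsNormalChart e δ) {w : V}
    (hw : w ∈ Metric.ball (0 : V) δ) : MDifferentiableAt 𝓘(ℝ, V) (𝓡 2) e w :=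
  (he.contMDiffAt hw).mdifferentiableAt (by simp)

variable [IsManifold (𝓡 2) ∞ M]

/-- Rays are geodesics as long as they stay in the ball. -/
lemma IsNormalChart.geodesic_ray (he : IsNormalChart e δ) (u : V) :
    IsGeodesicOn (fun t : ℝ => e (t • u)) {t | 0 ≤ t ∧ t • u ∈ Metric.ball (0 : V) δ} := by
  rintro t ⟨ht0, ht⟩
  have key {T : ℝ} (hT : 0 < T) (hTu : T • u ∈ Metric.ball (0 : V) δ) (htT : t ≤ T) :
      IsGeodesicOn (fun s : ℝ => e (s • u)) {t} := by
    have h := (he.geodesic _ hTu).affine (s' := {t}) T⁻¹ 0 (by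
      rintro s rfl
      rw [add_zero]
      exact ⟨by positivity, inv_mul_le_one_of_le₀ htT hT.le⟩)
    have h2 : (fun τ : ℝ => e ((T⁻¹ * τ + 0) • T • u)) = fun s : ℝ => e (s • u) := by
      funext τ
      rw [add_zero, smul_smul, mul_assoc, mul_comm τ, inv_mul_cancel_left₀ hT.ne']
    rwa [h2] at h
  -- The ray is a rescaling of the segment to T • u. At t = 0 the choice T = t is not invertible, so
  -- a small positive T is taken.
  rcases ht0.eq_or_lt with rfl | hpos
  · have hc : Continuous fun T : ℝ => T • u := by fun_prop
    have h1 : ∀ᶠ T : ℝ in 𝓝[>] 0, T • u ∈ Metric.ball (0 : V) δ :=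
      nhdsWithin_le_nhds (hc.continuousAt.eventually_mem (Metric.isOpen_ball.mem_nhds ht))
    obtain ⟨T, hT, hT0⟩ := (h1.and self_mem_nhdsWithin).exists
    exact key hT0 hT (le_of_lt hT0) _ rfl
  · exact key hpos ht le_rfl _ rfl

section Families

variable {E : Type*} [NormedAddCommGroup E] [NormedSpace ℝ E] {F : E → V} {z : E}

lemma IsNormalChart.contDiffAt_family (he : IsNormalChart e δ) (hF : ContDiffAt ℝ ∞ F z)
    (hz : F z ∈ Metric.ball (0 : V) δ) {x : M} (hx : e (F z) ∈ (chartAt Plane x).source) :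
    ContDiffAt ℝ ∞ (fun y => extChartAt (𝓡 2) x (e (F y))) z :=
  contDiffAt_chart_comp le_rfl (ContMDiffAt.comp z (he.contMDiffAt hz) hF.contMDiffAt) x hx

lemma IsNormalChart.dirDeriv_family (he : IsNormalChart e δ) (hF : ContDiffAt ℝ ∞ F z)
    (hz : F z ∈ Metric.ball (0 : V) δ) {x : M} (hx : e (F z) ∈ (chartAt Plane x).source) (v : E) :
    dirDeriv v (fun y => extChartAt (𝓡 2) x (e (F y))) z =
      chartDeriv x (e (F z)) (pushVec e (F z) (dirDeriv v F z)) := by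
  refine Eq.trans ?_ (chartDeriv_mfderiv (he.mdifferentiableAt hz) x hx (dirDeriv v F z)).symm
  have h1 : DifferentiableAt ℝ (fun y => extChartAt (𝓡 2) x (e y)) (F z) :=
    (contDiffAt_chart_comp le_rfl (he.contMDiffAt hz) x hx).differentiableAt (by simp)
  have h2 := fderiv_comp z h1 (hF.differentiableAt (by simp))
  exact congrArg (fun L => L v) h2

lemma IsNormalChart.metricForm_family (he : IsNormalChart e δ) (hF : ContDiffAt ℝ ∞ F z)
    (hz : F z ∈ Metric.ball (0 : V) δ) {x : M} (hx : e (F z) ∈ (chartAt Plane x).source) (v w : E) :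
    metricForm (chartGram x) (extChartAt (𝓡 2) x (e (F z)))
      (dirDeriv v (fun y => extChartAt (𝓡 2) x (e (F y))) z)
      (dirDeriv w (fun y => extChartAt (𝓡 2) x (e (F y))) z) =
      pullForm e (F z) (dirDeriv v F z) (dirDeriv w F z) := by
  rw [he.dirDeriv_family hF hz hx, he.dirDeriv_family hF hz hx, pullForm,
    ← inner_eq_metricForm x hx]

lemma IsNormalChart.eventually_mem (he : IsNormalChart e δ) (hF : ContinuousAt F z)
    (hz : F z ∈ Metric.ball (0 : V) δ) {x : M} (hx : e (F z) ∈ (chartAt Plane x).source) :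
    ∀ᶠ y in 𝓝 z, F y ∈ Metric.ball (0 : V) δ ∧ e (F y) ∈ (chartAt Plane x).source := by
  refine (hF.eventually_mem (Metric.isOpen_ball.mem_nhds hz)).and ?_
  exact (ContinuousAt.comp (he.contMDiffAt hz).continuousAt hF).eventually_mem
    ((chartAt Plane x).open_source.mem_nhds hx)

end Families

/-- The family of rays `F (t, τ) = t ν(τ)`, read in a chart, satisfies the geodesic equation. -/
lemma IsNormalChart.covDeriv_family (he : IsNormalChart e δ) {ν : ℝ → V} {t τ : ℝ} (ht : 0 ≤ t)
    (hν : ContDiffAt ℝ ∞ ν τ) (hz : t • ν τ ∈ Metric.ball (0 : V) δ) {x : M}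
    (hx : e (t • ν τ) ∈ (chartAt Plane x).source) :
    covDeriv (chartGram x) (fun z : ℝ × ℝ => extChartAt (𝓡 2) x (e (z.1 • ν z.2))) (1, 0)
      (dirDeriv (1, 0) fun z : ℝ × ℝ => extChartAt (𝓡 2) x (e (z.1 • ν z.2))) (t, τ) = 0 := by
  set f : ℝ × ℝ → Plane := fun z => extChartAt (𝓡 2) x (e (z.1 • ν z.2)) with hf
  have hF : ContDiffAt ℝ ∞ (fun z : ℝ × ℝ => z.1 • ν z.2) (t, τ) :=
    contDiffAt_fst.smul (ContDiffAt.comp (t, τ) hν contDiffAt_snd)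
  have hfs : ContDiffAt ℝ ∞ f (t, τ) := he.contDiffAt_family hF hz hx
  have hline (s : ℝ) : HasDerivAt (fun s : ℝ => (s, τ)) ((1 : ℝ), (0 : ℝ)) s :=
    (hasDerivAt_id s).prodMk (hasDerivAt_const s τ)
  have hlc : ContinuousAt (fun s : ℝ => (s, τ)) t := (hline t).continuousAt
  have hderiv {X : ℝ × ℝ → Plane} {s : ℝ} (hX : DifferentiableAt ℝ X (s, τ)) :
      deriv (fun s => X (s, τ)) s = dirDeriv (1, 0) X (s, τ) :=
    (hX.hasFDerivAt.comp_hasDerivAt s (hline s)).deriv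
  have h1 : ∀ᶠ z in 𝓝 (t, τ), DifferentiableAt ℝ f z := by
    filter_upwards [(hfs.of_le (m := 1) (by simp)).eventually (by simp)] with z hz
      using hz.differentiableAt one_ne_zero
  have h2 : deriv (fun s => f (s, τ)) =ᶠ[𝓝 t] fun s => dirDeriv (1, 0) f (s, τ) := by
    filter_upwards [hlc.eventually h1] with s hs using hderiv hs
  have hgeo := (isGeodesicOn_iff.1 (he.geodesic_ray (ν τ)) t ⟨ht, hz⟩).2 x hx
  have h3 : deriv (deriv fun s => f (s, τ)) t = dirDeriv (1, 0) (dirDeriv (1, 0) f) (t, τ) := by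
    rw [h2.deriv_eq]
    exact hderiv ((contDiffAt_dirDeriv hfs _).differentiableAt (by simp))
  change deriv (deriv fun s => f (s, τ)) t + christoffelForm (chartGram x) (f (t, τ))
    (deriv (fun s => f (s, τ)) t) (deriv (fun s => f (s, τ)) t) = 0 at hgeo
  rw [h3, h2.self_of_nhds] at hgeo
  exact hgeo

lemma dirDeriv_fst_ray {ν : ℝ → V} {t τ : ℝ} (hν : DifferentiableAt ℝ ν τ) :
    dirDeriv (1, 0) (fun z : ℝ × ℝ => z.1 • ν z.2) (t, τ) = ν τ := by
  have h := (hasFDerivAt_fst (𝕜 := ℝ) (E := ℝ) (F := ℝ) (p := (t, τ))).smul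
    (hν.hasFDerivAt.comp (t, τ) (hasFDerivAt_snd (𝕜 := ℝ) (E := ℝ) (F := ℝ)))
  have h2 := congrArg (fun L => L ((1 : ℝ), (0 : ℝ))) h.fderiv
  exact h2.trans (by simp)

lemma dirDeriv_snd_ray {ν : ℝ → V} {t τ : ℝ} (hν : DifferentiableAt ℝ ν τ) :
    dirDeriv (0, 1) (fun z : ℝ × ℝ => z.1 • ν z.2) (t, τ) = t • deriv ν τ := by
  have h := (hasFDerivAt_fst (𝕜 := ℝ) (E := ℝ) (F := ℝ) (p := (t, τ))).smul
    (hν.hasFDerivAt.comp (t, τ) (hasFDerivAt_snd (𝕜 := ℝ) (E := ℝ) (F := ℝ)))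
  have h2 := congrArg (fun L => L ((0 : ℝ), (1 : ℝ))) h.fderiv
  exact h2.trans (by simp)

variable [IsContMDiffRiemannianBundle (𝓡 2) ∞ Plane (fun x : M => TangentSpace (𝓡 2) x)]

/-- Coefficients of the pulled back metric along a family of rays are differentiable. -/
lemma IsNormalChart.contDiffAt_pullForm (he : IsNormalChart e δ)
    {E : Type*} [NormedAddCommGroup E] [NormedSpace ℝ E] {F : E → V} {z : E}
    (hF : ∀ᶠ y in 𝓝 z, ContDiffAt ℝ ∞ F y) (hz : F z ∈ Metric.ball (0 : V) δ) (v w : E) :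
    ContDiffAt ℝ ∞ (fun y => pullForm e (F y) (dirDeriv v F y) (dirDeriv w F y)) z := by
  set x := e (F z)
  have hx : e (F z) ∈ (chartAt Plane x).source := mem_chart_source Plane _
  have hf := he.contDiffAt_family hF.self_of_nhds hz hx
  have hm : extChartAt (𝓡 2) x (e (F z)) ∈ (extChartAt (𝓡 2) x).target :=
    (extChartAt (𝓡 2) x).map_source (by rwa [extChartAt_source])
  refine (contDiffAt_metricForm
    (f := fun y => extChartAt (𝓡 2) x (e (F y))) (gramOn_chartGram x) hm hf (contDiffAt_dirDeriv hf v)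
    (contDiffAt_dirDeriv hf w)).congr_of_eventuallyEq ?_
  filter_upwards [hF, he.eventually_mem hF.self_of_nhds.continuousAt hz hx] with y h1 h2
  exact (he.metricForm_family h1 h2.1 h2.2 v w).symm

/-- Along a family of rays, `2 ∂_t ⟨F_t, F_τ⟩ = ∂_τ ⟨F_t, F_t⟩`. -/
lemma IsNormalChart.pullForm_mixed (he : IsNormalChart e δ) {ν : ℝ → V} {t τ : ℝ} (ht : 0 ≤ t)
    (hν : ContDiff ℝ ∞ ν) (hz : t • ν τ ∈ Metric.ball (0 : V) δ) (a : ℝ × ℝ) :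
    2 * dirDeriv (1, 0) (fun z : ℝ × ℝ => pullForm e (z.1 • ν z.2) (ν z.2)
        (dirDeriv a (fun z : ℝ × ℝ => z.1 • ν z.2) z)) (t, τ) =
      dirDeriv a (fun z : ℝ × ℝ => pullForm e (z.1 • ν z.2) (ν z.2) (ν z.2)) (t, τ) := by
  set x := e (t • ν τ)
  have hx : e (t • ν τ) ∈ (chartAt Plane x).source := mem_chart_source Plane _
  set F : ℝ × ℝ → V := fun z => z.1 • ν z.2 with hFdef
  have hF (z) : ContDiffAt ℝ ∞ F z :=
    contDiffAt_fst.smul (ContDiffAt.comp z hν.contDiffAt contDiffAt_snd)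
  have hf := he.contDiffAt_family (hF (t, τ)) hz hx
  have hm : extChartAt (𝓡 2) x (e (F (t, τ))) ∈ (extChartAt (𝓡 2) x).target :=
    (extChartAt (𝓡 2) x).map_source (by rwa [extChartAt_source])
  have hν1 (z : ℝ × ℝ) : dirDeriv (1, 0) F z = ν z.2 :=
    dirDeriv_fst_ray (hν.differentiable (by simp)).differentiableAt
  have hev (a b : ℝ × ℝ) : (fun z => pullForm e (F z) (dirDeriv a F z) (dirDeriv b F z))
      =ᶠ[𝓝 (t, τ)] fun z => metricForm (chartGram x) (extChartAt (𝓡 2) x (e (F z)))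
      (dirDeriv a (fun y => extChartAt (𝓡 2) x (e (F y))) z)
      (dirDeriv b (fun y => extChartAt (𝓡 2) x (e (F y))) z) := by
    filter_upwards [he.eventually_mem (hF (t, τ)).continuousAt hz hx] with y h2
    exact (he.metricForm_family (hF y) h2.1 h2.2 a b).symm
  have h1 := hev (1, 0) a
  have h2 := hev (1, 0) (1, 0)
  simp only [hν1] at h1 h2
  rw [dirDeriv_congr h1, dirDeriv_congr h2]
  exact dirDeriv_metricForm_mixed (gramOn_chartGram x) hm hf
    (he.covDeriv_family ht hν.contDiffAt hz hx)

/-- The normal chart is isometric at the origin by assumption for vectors of the ball only; both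
sides are quadratic, so scaling reaches all vectors. -/
lemma IsNormalChart.pullForm_zero (he : IsNormalChart e δ) (hδ : 0 < δ) (u : V) :
    pullForm e 0 u u = ‖u‖ ^ 2 := by
  have key (w : V) (hw : w ∈ Metric.ball (0 : V) δ) : pullForm e 0 w w = ‖w‖ ^ 2 := by
    rw [← he.norm_velocity_zero w hw, ← real_inner_self_eq_norm_sq]
    have h0 : (0 : V) = (0 : ℝ) • w := (zero_smul ℝ w).symm
    have he0 : MDifferentiableAt 𝓘(ℝ, V) (𝓡 2) e ((0 : ℝ) • w) := by
      rw [← h0]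
      exact he.mdifferentiableAt (by simpa using (norm_nonneg w).trans_lt (by simpa using hw))
    rw [velocity_comp (u := fun t : ℝ => t • w) he0
      (by simpa using (hasDerivAt_id (0 : ℝ)).smul_const w)]
    conv_lhs => rw [h0]
    rfl
  have hc : Continuous fun r : ℝ => r • u := by fun_prop
  have h1 : ∀ᶠ r : ℝ in 𝓝[>] 0, r • u ∈ Metric.ball (0 : V) δ :=
    nhdsWithin_le_nhds (hc.continuousAt.eventually_mem (Metric.isOpen_ball.mem_nhds (by simpa)))
  obtain ⟨r, hr, hr0⟩ := (h1.and self_mem_nhdsWithin).exists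
  have h := key _ hr
  have hr0 : (0 : ℝ) < r := hr0
  rw [pullForm_smul_left, pullForm_smul_right, norm_smul, Real.norm_of_nonneg hr0.le] at h
  have : r ^ 2 ≠ 0 := by positivity
  apply mul_left_cancel₀ this
  linarith

lemma eq_add_of_hasDerivAt_const {T : ℝ} {N : ℝ → ℝ} {c : ℝ} (hT : 0 ≤ T)
    (hN : ∀ t ∈ Icc 0 T, HasDerivAt N c t) : N T = N 0 + T * c := by
  have h := constant_of_has_deriv_right_zero (f := fun t => N t - t * c) (a := 0) (b := T)
    (fun t ht => ((hN t ht).continuousAt.sub (by fun_prop)).continuousWithinAt)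
    (fun t ht => by
      have := (hN t (Ico_subset_Icc_self ht)).fun_sub ((hasDerivAt_id t).mul_const c)
      simpa using this.hasDerivWithinAt) T ⟨hT, le_rfl⟩
  linarith

lemma hasDerivAt_slice {P : ℝ × ℝ → ℝ} {t τ : ℝ} (hP : DifferentiableAt ℝ P (t, τ)) :
    HasDerivAt (fun s => P (s, τ)) (dirDeriv (1, 0) P (t, τ)) t :=
  hP.hasFDerivAt.comp_hasDerivAt (f := fun s : ℝ => (s, τ)) t
    ((hasDerivAt_id t).prodMk (hasDerivAt_const t τ))

lemma hasDerivAt_slice_snd {P : ℝ × ℝ → ℝ} {t τ : ℝ} (hP : DifferentiableAt ℝ P (t, τ)) :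
    HasDerivAt (fun s => P (t, s)) (dirDeriv (0, 1) P (t, τ)) τ :=
  hP.hasFDerivAt.comp_hasDerivAt (f := fun s : ℝ => (t, s)) τ
    ((hasDerivAt_const τ t).prodMk (hasDerivAt_id τ))

lemma mem_ball_of_mem_Icc {u : V} {t T : ℝ} (hT : T • u ∈ Metric.ball (0 : V) δ)
    (ht : t ∈ Icc 0 T) : t • u ∈ Metric.ball (0 : V) δ := by
  rw [mem_ball_zero_iff, norm_smul] at hT ⊢
  refine lt_of_le_of_lt ?_ hT
  gcongr
  rw [Real.norm_of_nonneg ht.1, Real.norm_of_nonneg (ht.1.trans ht.2)]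
  exact ht.2

lemma IsNormalChart.contDiffAt_pullForm_ray (he : IsNormalChart e δ) {ν : ℝ → V} {z : ℝ × ℝ}
    (hν : ContDiff ℝ ∞ ν) (hz : z.1 • ν z.2 ∈ Metric.ball (0 : V) δ) (a b : ℝ × ℝ) :
    ContDiffAt ℝ ∞ (fun z : ℝ × ℝ => pullForm e (z.1 • ν z.2)
      (dirDeriv a (fun z : ℝ × ℝ => z.1 • ν z.2) z)
      (dirDeriv b (fun z : ℝ × ℝ => z.1 • ν z.2) z)) z :=
  he.contDiffAt_pullForm (F := fun z : ℝ × ℝ => z.1 • ν z.2) (Eventually.of_forall fun y =>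
    contDiffAt_fst.smul (ContDiffAt.comp y hν.contDiffAt contDiffAt_snd)) hz a b

/-- Rays are traversed with constant speed. -/
lemma IsNormalChart.pullForm_self (he : IsNormalChart e δ) {u : V} {t : ℝ} (ht : 0 ≤ t)
    (hz : t • u ∈ Metric.ball (0 : V) δ) : pullForm e (t • u) u u = ‖u‖ ^ 2 := by
  have hδ : 0 < δ := (norm_nonneg _).trans_lt (by simpa using hz)
  have hν : ContDiff ℝ ∞ fun _ : ℝ => u := contDiff_const
  have hν1 (z : ℝ × ℝ) : dirDeriv (1, 0) (fun z : ℝ × ℝ => z.1 • u) z = u :=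
    dirDeriv_fst_ray (ν := fun _ => u) (by fun_prop)
  have hN : ∀ s ∈ Icc 0 t, HasDerivAt (fun s : ℝ => pullForm e (s • u) u u) 0 s := by
    intro s hs
    have hsu := mem_ball_of_mem_Icc hz hs
    -- For a constant family and the radial direction the first variation identity reads 2N' = N',
    -- where N is the squared speed; hence N' = 0.
    have h1 := he.pullForm_mixed (τ := 0) hs.1 hν hsu (1, 0)
    have h2 := (he.contDiffAt_pullForm_ray (z := (s, 0)) hν hsu (1, 0) (1, 0)).differentiableAt
      (by simp)
    simp only [hν1] at h1 h2
    have h3 := hasDerivAt_slice h2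
    rwa [show dirDeriv (1, 0) (fun z : ℝ × ℝ => pullForm e (z.1 • u) u u) (s, 0) = 0 by
      linarith] at h3
  have h := eq_add_of_hasDerivAt_const ht hN
  simpa [he.pullForm_zero hδ] using h

/-- The Gauss lemma. -/
lemma IsNormalChart.gauss (he : IsNormalChart e δ) {w : V} (hw : w ∈ Metric.ball (0 : V) δ)
    (a : V) : pullForm e w w a = inner ℝ w a := by
  -- Varying the ray in the direction a, the mixed product at (s, 0) is the pulled back product of w
  -- and s • a. Twice its s-derivative is the τ-derivative at 0 of ‖w + τ a‖², that is 2⟨w, a⟩. So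
  -- the product is linear in s, and s = 1 gives the claim.
  set ν : ℝ → V := fun τ => w + τ • a with hνdef
  have hν : ContDiff ℝ ∞ ν := by fun_prop
  have hνd (τ : ℝ) : HasDerivAt ν a τ := by
    have h := ((hasDerivAt_id τ).smul_const a).const_add w
    rwa [one_smul] at h
  have hν0 : ν 0 = w := by simp [hνdef]
  have hν1 (z : ℝ × ℝ) : dirDeriv (1, 0) (fun z : ℝ × ℝ => z.1 • ν z.2) z = ν z.2 :=
    dirDeriv_fst_ray (hνd _).differentiableAt
  have hν2 (z : ℝ × ℝ) : dirDeriv (0, 1) (fun z : ℝ × ℝ => z.1 • ν z.2) z = z.1 • a := by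
    rw [← (hνd z.2).deriv]
    exact dirDeriv_snd_ray (hνd _).differentiableAt
  have hN : ∀ s ∈ Icc (0 : ℝ) 1,
      HasDerivAt (fun s : ℝ => pullForm e (s • w) w (s • a)) (inner ℝ w a) s := by
    intro s hs
    have hsw : s • ν 0 ∈ Metric.ball (0 : V) δ := by
      rw [hν0]
      exact mem_ball_of_smul hw hs
    have h1 := he.pullForm_mixed (τ := 0) hs.1 hν hsw (0, 1)
    have h2 := (he.contDiffAt_pullForm_ray (z := (s, 0)) hν hsw (1, 0) (0, 1)).differentiableAt
      (by simp)
    have h3 := (he.contDiffAt_pullForm_ray (z := (s, 0)) hν hsw (1, 0) (1, 0)).differentiableAt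
      (by simp)
    simp only [hν1, hν2] at h1 h2 h3
    have hev : (fun τ => pullForm e (s • ν τ) (ν τ) (ν τ)) =ᶠ[𝓝 0] fun τ => ‖ν τ‖ ^ 2 := by
      have hc : Continuous fun τ => s • ν τ := hν.continuous.const_smul s
      filter_upwards [hc.continuousAt.eventually_mem (Metric.isOpen_ball.mem_nhds hsw)] with τ hτ
      exact he.pullForm_self hs.1 hτ
    have h4 := (hasDerivAt_slice_snd h3).unique
      ((hνd 0).norm_sq.congr_of_eventuallyEq hev)
    rw [h4, hν0] at h1
    have h5 := hasDerivAt_slice h2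
    rw [show dirDeriv (1, 0) (fun z : ℝ × ℝ => pullForm e (z.1 • ν z.2) (ν z.2) (z.1 • a)) (s, 0)
      = inner ℝ w a by linarith] at h5
    simpa only [hν0] using h5
  have h := eq_add_of_hasDerivAt_const zero_le_one hN
  have h0 : pullForm e 0 w (0 : V) = 0 := by simp [pullForm]
  simpa only [one_smul, zero_smul, h0, one_mul, zero_add] using h

end Normal

/-! ### The exponential map as a normal chart; distances -/

section Dist

variable {M : Type*} [MetricSpace M] [ChartedSpace Plane M] [IsManifold (𝓡 2) ∞ M]
  [RiemannianBundle (fun x : M => TangentSpace (𝓡 2) x)]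
  [IsContMDiffRiemannianBundle (𝓡 2) ∞ Plane (fun x : M => TangentSpace (𝓡 2) x)]

/-- Two `C²` curves that agree to the right of a have the same first and second derivatives at a.
The exponential map is compared with geodesics at nonnegative times only, whereas the geodesic
equation involves two-sided derivatives. -/
lemma IsGeodesicOn.congr_right {σ₁ σ₂ : ℝ → M} {a : ℝ} (h₁ : IsGeodesicOn σ₁ {a})
    (h₂ : ContMDiffAt 𝓘(ℝ, ℝ) (𝓡 2) 2 σ₂ a) (h : σ₁ =ᶠ[𝓝[≥] a] σ₂) : IsGeodesicOn σ₂ {a} := by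
  rw [isGeodesicOn_iff] at h₁ ⊢
  rintro t rfl
  refine ⟨h₂, fun x hx => ?_⟩
  have hat : σ₁ t = σ₂ t := h.self_of_nhdsWithin self_mem_Ici
  have hx1 : σ₁ t ∈ (chartAt Plane x).source := by rwa [hat]
  have c1 := contDiffAt_chart_comp ENat.LEInfty.out (h₁ t rfl).1 x hx1
  have c2 := contDiffAt_chart_comp ENat.LEInfty.out h₂ x hx
  have hc : (fun τ => extChartAt (𝓡 2) x (σ₁ τ)) =ᶠ[𝓝[≥] t] fun τ => extChartAt (𝓡 2) x (σ₂ τ) := by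
    filter_upwards [h] with τ hτ
    rw [hτ]
  have d1 := deriv_eventuallyEq_right (c1.differentiableAt two_ne_zero)
    (c2.differentiableAt two_ne_zero) hc
  have d2 := deriv_eq_of_eventuallyEq_right ((contDiffAt_deriv c1).differentiableAt one_ne_zero)
    ((contDiffAt_deriv c2).differentiableAt one_ne_zero) d1
  rw [← d2, ← d1.self_of_nhdsWithin self_mem_Ici, ← hat]
  exact (h₁ t rfl).2 x hx1

/-- The exponential map, restricted to a ball on which it is a diffeomorphism, is a normal chart. -/
lemma IsNormalRadius.exists_chart {p : M} {δ : ℝ} (h : IsNormalRadius p δ) :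
    ∃ e : OpenPartialHomeomorph (TangentSpace (𝓡 2) p) M, IsNormalChart e δ ∧
      EqOn e (expMap p) (Metric.ball 0 δ) ∧
      ∀ w ∈ Metric.ball (0 : TangentSpace (𝓡 2) p) δ,
        lift (fun t : ℝ => e (t • w)) 0 = ⟨p, w⟩ := by
  obtain ⟨hexp, e, hsrc, heq, hsm, hsm'⟩ := h
  have hat {w : TangentSpace (𝓡 2) p} (hw : w ∈ Metric.ball (0 : TangentSpace (𝓡 2) p) δ) :
      ContMDiffAt 𝓘(ℝ, TangentSpace (𝓡 2) p) (𝓡 2) ∞ e w :=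
    hsm.contMDiffAt (e.open_source.mem_nhds (by rwa [hsrc]))
  have hray (w : TangentSpace (𝓡 2) p) {t : ℝ}
      (ht : t • w ∈ Metric.ball (0 : TangentSpace (𝓡 2) p) δ) :
      ContMDiffAt 𝓘(ℝ, ℝ) (𝓡 2) 2 (fun s : ℝ => e (s • w)) t := by
    have h1 : ContMDiffAt 𝓘(ℝ, ℝ) 𝓘(ℝ, TangentSpace (𝓡 2) p) 2 (fun s : ℝ => s • w) t :=
      ContDiffAt.contMDiffAt (contDiffAt_id.smul contDiffAt_const)
    exact ContMDiffAt.comp (g := e) (f := fun s : ℝ => s • w) t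
      ((hat ht).of_le ENat.LEInfty.out) h1
  have key (w : TangentSpace (𝓡 2) p) (hw : w ∈ Metric.ball (0 : TangentSpace (𝓡 2) p) δ) :
      ∃ T > (1 : ℝ), ∃ σ : ℝ → M, IsGeodesicOn σ (Icc 0 T) ∧ lift σ 0 = ⟨p, w⟩ ∧
        ∀ t ∈ Icc 0 T, e (t • w) = σ t := by
    obtain ⟨T, hT, hTw⟩ := exists_smul_mem_ball hw
    obtain ⟨σ, hσ, hl⟩ := hexp _ hTw
    have hT0 : 0 < T := one_pos.trans hT
    have hσ' : IsGeodesicOn (fun τ => σ (T⁻¹ * τ + 0)) (Icc 0 T) := hσ.affine T⁻¹ 0 (by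
      intro t ht
      rw [add_zero]
      exact ⟨mul_nonneg (inv_nonneg.2 hT0.le) ht.1, inv_mul_le_one_of_le₀ ht.2 hT0.le⟩)
    have hl' : lift (fun τ => σ (T⁻¹ * τ + 0)) 0 = ⟨p, w⟩ := by
      rw [lift_comp_mul (hσ.mdifferentiableAt ⟨le_rfl, zero_le_one⟩) hl, smul_smul,
        inv_mul_cancel₀ hT0.ne', one_smul]
    refine ⟨T, hT, _, hσ', hl', fun t ht => ?_⟩
    rw [heq (by rw [hsrc]; exact mem_ball_of_mem_Icc hTw ht)]
    exact expMap_smul hT0.le hσ' hl' ht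
  have hlift (w : TangentSpace (𝓡 2) p) (hw : w ∈ Metric.ball (0 : TangentSpace (𝓡 2) p) δ) :
      lift (fun t : ℝ => e (t • w)) 0 = ⟨p, w⟩ := by
    obtain ⟨T, hT, σ, hσ, hl, hσe⟩ := key w hw
    have hT0 : 0 < T := one_pos.trans hT
    have hp : p ∈ (chartAt Plane p).source := mem_chart_source Plane p
    have h0 : e ((0 : ℝ) • w) = p := (hσe 0 ⟨le_rfl, hT0.le⟩).trans (congrArg (·.1) hl)
    have h0w : (0 : ℝ) • w ∈ Metric.ball (0 : TangentSpace (𝓡 2) p) δ :=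
      mem_ball_of_smul hw ⟨le_rfl, zero_le_one⟩
    have m1 := (hray w h0w).mdifferentiableAt two_ne_zero
    have m2 := hσ.mdifferentiableAt (t := 0) ⟨le_rfl, hT0.le⟩
    rw [lift_eq_iff m1 p hp]
    refine ⟨h0, ?_⟩
    rw [← deriv_chart_eq_of_lift m2 hl p hp]
    have hσ0 : σ 0 = p := congrArg (·.1) hl
    refine deriv_eq_of_eventuallyEq_right
      ((contDiffAt_chart_comp ENat.LEInfty.out (hray w h0w) p (by rwa [h0])).differentiableAt
        two_ne_zero)
      ((contDiffAt_chart_comp ENat.LEInfty.out (hσ 0 ⟨le_rfl, hT0.le⟩).1 p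
        (by rwa [hσ0])).differentiableAt two_ne_zero) ?_
    filter_upwards [Icc_mem_nhdsGE hT0] with t ht
    rw [hσe t ht]
  refine ⟨e, ⟨hsrc, hsm, hsm', fun w hw => ?_, fun w hw => ?_⟩, fun w hw => heq (by rwa [hsrc]),
    hlift⟩
  · obtain ⟨T, hT, σ, hσ, -, hσe⟩ := key w hw
    intro t ht
    have htT : t < T := ht.2.trans_lt hT
    refine IsGeodesicOn.congr_right (σ₁ := σ) ?_ (hray w (mem_ball_of_smul hw ht)) ?_ t rfl
    · exact hσ.mono (singleton_subset_iff.2 ⟨ht.1, htT.le⟩)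
    · filter_upwards [Icc_mem_nhdsGE htT] with s hs
      exact (hσe s ⟨ht.1.trans hs.1, hs.2⟩).symm
  · exact congrArg (fun q : TangentBundle (𝓡 2) M => ‖q.2‖) (hlift w hw)

variable {V : Type*} [NormedAddCommGroup V] [InnerProductSpace ℝ V]
  {e : OpenPartialHomeomorph V M} {δ : ℝ}

lemma IsNormalChart.norm_velocity_ray (he : IsNormalChart e δ) {u : V} {t : ℝ} (ht : 0 ≤ t)
    (hz : t • u ∈ Metric.ball (0 : V) δ) : ‖velocity (fun s : ℝ => e (s • u)) t‖ = ‖u‖ := by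
  have hv : velocity (fun s : ℝ => e (s • u)) t = pushVec e (t • u) u :=
    velocity_comp (u := fun s : ℝ => s • u) (he.mdifferentiableAt hz)
      (by simpa using (hasDerivAt_id t).smul_const u)
  have h := he.pullForm_self ht hz
  rw [pullForm, real_inner_self_eq_norm_sq] at h
  rw [hv]
  exact (sq_eq_sq₀ (norm_nonneg _) (norm_nonneg _)).1 h

/-- By the Gauss lemma, `e` does not decrease the radial speed. -/
lemma IsNormalChart.inner_le (he : IsNormalChart e δ) {w : V} (hw : w ∈ Metric.ball (0 : V) δ)
    (a : V) : inner ℝ w a ≤ ‖w‖ * ‖pushVec e w a‖ := by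
  rw [← he.gauss hw a]
  have h := he.pullForm_self (u := w) zero_le_one (by simpa using hw)
  rw [one_smul, pullForm, real_inner_self_eq_norm_sq] at h
  rw [← (sq_eq_sq₀ (norm_nonneg _) (norm_nonneg _)).1 h]
  exact real_inner_le_norm _ _

end Dist

/-! ### Rays of a normal chart realize the distance -/

section Minimizing

open MeasureTheory

variable {M : Type*} [MetricSpace M] [ChartedSpace Plane M] [IsManifold (𝓡 2) ∞ M]
  [RiemannianBundle (fun x : M => TangentSpace (𝓡 2) x)]
  [IsContMDiffRiemannianBundle (𝓡 2) ∞ Plane (fun x : M => TangentSpace (𝓡 2) x)]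
  {V : Type*} [NormedAddCommGroup V] [InnerProductSpace ℝ V]
  {e : OpenPartialHomeomorph V M} {δ : ℝ}

lemma IsNormalChart.contDiffAt_symm_comp (he : IsNormalChart e δ) {n : ℕ∞ω} (hn : n ≤ ∞)
    {γ : ℝ → M} {t : ℝ} (hγ : ContMDiffAt 𝓘(ℝ, ℝ) (𝓡 2) n γ t) (ht : γ t ∈ e.target) :
    ContDiffAt ℝ n (fun s => e.symm (γ s)) t := by
  have h1 := (he.contMDiffOn_symm.contMDiffAt (e.open_target.mem_nhds ht)).of_le hn
  exact (ContMDiffAt.comp t h1 hγ).contDiffAt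

lemma IsNormalChart.velocity_eq (he : IsNormalChart e δ) {γ : ℝ → M} {t : ℝ}
    (hγ : ContMDiffAt 𝓘(ℝ, ℝ) (𝓡 2) 1 γ t) (ht : γ t ∈ e.target) :
    ‖velocity γ t‖ = ‖pushVec e (e.symm (γ t)) (deriv (fun s => e.symm (γ s)) t)‖ := by
  have hu := (he.contDiffAt_symm_comp (by simp) hγ ht).differentiableAt one_ne_zero
  have hw : e.symm (γ t) ∈ Metric.ball (0 : V) δ := by
    rw [← he.source]
    exact e.map_target ht
  have hev : γ =ᶠ[𝓝 t] fun s => e (e.symm (γ s)) := by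
    filter_upwards [hγ.continuousAt.eventually_mem (e.open_target.mem_nhds ht)] with s hs
    exact (e.right_inv hs).symm
  have h1 : lift γ t = lift (fun s => e (e.symm (γ s))) t := by
    have hm : MDifferentiableAt 𝓘(ℝ, ℝ) (𝓡 2) γ t := hγ.mdifferentiableAt one_ne_zero
    have hx := mem_chart_source Plane (γ t)
    have h0 : γ t = e (e.symm (γ t)) := hev.self_of_nhds
    rw [lift_eq_iff hm (γ t) (by simp only [lift]; rwa [← h0])]
    refine ⟨h0, ?_⟩
    have hm2 := hm.congr_of_eventuallyEq hev.symm
    refine Eq.trans ?_ (chartDeriv_velocity hm2 (γ t) (by rwa [← h0])).symm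
    refine Filter.EventuallyEq.deriv_eq ?_
    filter_upwards [hev] with s hs
    rw [← hs]
  have h2 := congrArg (fun q : TangentBundle (𝓡 2) M => ‖q.2‖) h1
  exact h2.trans (congrArg norm
    (velocity_comp (u := fun s => e.symm (γ s)) (he.mdifferentiableAt hw) hu.hasDerivAt))

/-- A path that stays in the normal neighbourhood is at least as long as the radial distance it
covers, up to the regularization `ε` of the radius at the origin. -/
lemma IsNormalChart.radial_le_pathELength (he : IsNormalChart e δ) {γ : ℝ → M}
    (hγ : ContMDiff 𝓘(ℝ, ℝ) (𝓡 2) 1 γ) {T : ℝ} (hT : 0 ≤ T) (hmem : ∀ t ∈ Icc 0 T, γ t ∈ e.target)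
    {ε : ℝ} (hε : 0 < ε) :
    ENNReal.ofReal (√(ε ^ 2 + ‖e.symm (γ T)‖ ^ 2) - √(ε ^ 2 + ‖e.symm (γ 0)‖ ^ 2)) ≤
      pathELength (𝓡 2) γ 0 T := by
  set u : ℝ → V := fun s => e.symm (γ s) with hu
  -- The norm is not differentiable at the origin, through which the path may pass. This
  -- regularization is `C¹` along the path, and its derivative ⟨u, u'⟩ / m is at most the speed, by
  -- `inner_le` and ‖u‖ ≤ m.
  set m : ℝ → ℝ := fun s => √(ε ^ 2 + ‖u s‖ ^ 2) with hm
  have huc : ∀ t ∈ Icc 0 T, ContDiffAt ℝ 1 u t := fun t ht =>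
    he.contDiffAt_symm_comp (by simp) hγ.contMDiffAt (hmem t ht)
  have hpos (t) : 0 < ε ^ 2 + ‖u t‖ ^ 2 := by positivity
  have hmc : ∀ t ∈ Icc 0 T, ContDiffAt ℝ 1 m t := fun t ht =>
    (contDiffAt_const.add ((huc t ht).norm_sq ℝ)).sqrt (hpos t).ne'
  have hmd : ∀ t ∈ Icc 0 T, HasDerivAt m (inner ℝ (u t) (deriv u t) / m t) t := by
    intro t ht
    have h := (((huc t ht).differentiableAt one_ne_zero).hasDerivAt.norm_sq.const_add
      (ε ^ 2)).sqrt (hpos t).ne'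
    convert h using 1
    rw [mul_div_mul_left _ _ two_ne_zero]
  have hcont : ContinuousOn (deriv m) (Icc 0 T) := fun t ht =>
    (((hmc t ht).fderiv_right (m := 0) (by simp)).clm_apply
      (contDiffAt_const (c := (1 : ℝ)))).continuousAt.continuousWithinAt
  have hint : ∫ t in (0 : ℝ)..T, deriv m t = m T - m 0 := by
    refine intervalIntegral.integral_eq_sub_of_hasDerivAt (fun t ht => ?_) ?_
    · rw [uIcc_of_le hT] at ht
      exact (hmd t ht).differentiableAt.hasDerivAt
    · rw [← uIcc_of_le hT] at hcont
      exact hcont.intervalIntegrable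
  change ENNReal.ofReal (m T - m 0) ≤ _
  rw [← hint, intervalIntegral.integral_of_le hT, pathELength_eq_lintegral_mfderiv_Icc,
    ← restrict_Ioc_eq_restrict_Icc]
  refine (Real.ofReal_le_enorm _).trans ((enorm_integral_le_lintegral_enorm _).trans ?_)
  refine setLIntegral_mono' measurableSet_Ioc fun t ht => ?_
  have ht' : t ∈ Icc 0 T := Ioc_subset_Icc_self ht
  change ‖deriv m t‖ₑ ≤ ‖velocity γ t‖ₑ
  rw [← ofReal_norm, ← ofReal_norm]
  refine ENNReal.ofReal_le_ofReal ?_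
  rw [(hmd t ht').deriv, he.velocity_eq hγ.contMDiffAt (hmem t ht'), Real.norm_eq_abs, abs_div,
    abs_of_pos (Real.sqrt_pos.2 (hpos t)), div_le_iff₀ (Real.sqrt_pos.2 (hpos t))]
  have hw : u t ∈ Metric.ball (0 : V) δ := by
    rw [← he.source]
    exact e.map_target (hmem t ht')
  have h1 := he.inner_le hw (deriv u t)
  have h2 := he.inner_le hw (-deriv u t)
  rw [map_neg, norm_neg, inner_neg_right] at h2
  have h3 : ‖u t‖ ≤ m t := Real.le_sqrt_of_sq_le (by nlinarith)
  refine (abs_le.2 ⟨by linarith, h1⟩).trans ?_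
  rw [mul_comm]
  gcongr

variable [IsRiemannianManifold (𝓡 2) M]

/-- In a normal neighbourhood the distance to the centre is the radius. -/
lemma IsNormalChart.dist_eq [FiniteDimensional ℝ V] (he : IsNormalChart e δ) {w : V}
    (hw : w ∈ Metric.ball (0 : V) δ) : dist (e 0) (e w) = ‖w‖ := by
  have hδ : 0 < δ := (norm_nonneg _).trans_lt (by simpa using hw)
  have h0 : (0 : V) ∈ Metric.ball (0 : V) δ := by simpa
  suffices h : riemannianEDist (𝓡 2) (e 0) (e w) = ENNReal.ofReal ‖w‖ by
    rw [← IsRiemannianManifold.out (I := 𝓡 2), edist_dist] at h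
    exact (ENNReal.ofReal_eq_ofReal_iff dist_nonneg (norm_nonneg _)).1 h
  refine le_antisymm ?_ ?_
  · have hcm : ContMDiffOn 𝓘(ℝ, ℝ) (𝓡 2) 1 (fun t : ℝ => e (t • w)) (Icc 0 1) := fun t ht =>
      ((he.geodesic w hw t ht).1.of_le one_le_two).contMDiffWithinAt
    refine (riemannianEDist_le_pathELength hcm (by simp) (by simp) zero_le_one).trans ?_
    rw [pathELength_eq_lintegral_mfderiv_Icc]
    have hc : ∀ t ∈ Icc (0 : ℝ) 1,
        ‖mfderiv 𝓘(ℝ, ℝ) (𝓡 2) (fun t : ℝ => e (t • w)) t (1 : ℝ)‖ₑ = ENNReal.ofReal ‖w‖ := by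
      intro t ht
      rw [← he.norm_velocity_ray ht.1 (mem_ball_of_smul hw ht), ofReal_norm]
      rfl
    exact (setLIntegral_congr_fun measurableSet_Icc hc).le.trans (by simp)
  · by_contra! hlt
    obtain ⟨γ, hγ0, hγ1, hγ, hL, -⟩ :=
      exists_lt_locally_constant_of_riemannianEDist_lt hlt (zero_lt_one' ℝ)
    set ρ := ‖w‖ with hρ
    have hρδ : ρ < δ := by simpa using hw
    have hρ0 : 0 < ρ := by
      by_contra! hle
      rw [ENNReal.ofReal_of_nonpos hle] at hL
      exact not_lt_bot hL
    have hsub : Metric.closedBall (0 : V) ρ ⊆ e.source := by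
      rw [he.source]
      exact Metric.closedBall_subset_ball hρδ
    -- A path shorter than ρ may leave the chart, so it is cut at the first time T at which it
    -- leaves the image of the ball of radius ρ.
    set S : Set ℝ := Icc 0 1 ∩ γ ⁻¹' (e '' Metric.ball (0 : V) ρ)ᶜ with hS
    have hopen : IsOpen (e '' Metric.ball (0 : V) ρ) :=
      e.isOpen_image_of_subset_source Metric.isOpen_ball
        (Metric.ball_subset_closedBall.trans hsub)
    have hScl : IsClosed S := isClosed_Icc.inter (hopen.isClosed_compl.preimage hγ.continuous)
    have hScpt : IsCompact S := isCompact_Icc.of_isClosed_subset hScl inter_subset_left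
    have hSne : S.Nonempty := by
      refine ⟨1, ⟨zero_le_one, le_rfl⟩, ?_⟩
      rintro ⟨w', hw', heq⟩
      rw [hγ1] at heq
      have := e.injOn (hsub (Metric.ball_subset_closedBall hw')) (by rwa [he.source]) heq
      rw [this] at hw'
      simp [hρ] at hw'
    obtain ⟨T, ⟨⟨hT0, hT1⟩, hTS⟩, hmin⟩ := hScpt.exists_isLeast hSne
    have hin : ∀ t ∈ Ico 0 T, γ t ∈ e '' Metric.ball (0 : V) ρ := by
      intro t ht
      by_contra hcon
      exact absurd (hmin ⟨⟨ht.1, ht.2.le.trans hT1⟩, hcon⟩) (not_le.2 ht.2)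
    have hTpos : 0 < T := by
      rcases hT0.eq_or_lt with rfl | h
      · exact absurd ⟨0, by simpa using hρ0, hγ0.symm⟩ hTS
      · exact h
    -- Closed balls are compact in finite dimension, so the image is closed in M; this keeps the
    -- exit point inside the chart.
    have hcl : IsClosed (e '' Metric.closedBall (0 : V) ρ) :=
      ((isCompact_closedBall (0 : V) ρ).image_of_continuousOn
        (e.continuousOn.mono hsub)).isClosed
    have hTin : γ T ∈ e '' Metric.closedBall (0 : V) ρ := by
      have h1 : T ∈ closure (Ico 0 T) := by
        rw [closure_Ico hTpos.ne]
        exact ⟨hT0, le_rfl⟩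
      refine hcl.closure_subset_iff.2 ?_ (image_closure_subset_closure_image hγ.continuous
        (mem_image_of_mem γ h1))
      rintro _ ⟨t, ht, rfl⟩
      exact image_mono Metric.ball_subset_closedBall (hin t ht)
    have hmem : ∀ t ∈ Icc 0 T, γ t ∈ e.target := by
      intro t ht
      have : γ t ∈ e '' Metric.closedBall (0 : V) ρ := by
        rcases ht.2.eq_or_lt with rfl | h
        · exact hTin
        · exact image_mono Metric.ball_subset_closedBall (hin t ⟨ht.1, h⟩)
      obtain ⟨w', hw', h⟩ := this
      rw [← h]
      exact e.map_source (hsub hw')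
    have hnorm : ρ ≤ ‖e.symm (γ T)‖ := by
      by_contra! hcon
      exact hTS ⟨e.symm (γ T), by simpa using hcon, e.right_inv (hmem T ⟨hT0, le_rfl⟩)⟩
    have hstart : e.symm (γ 0) = 0 := by
      rw [hγ0, e.left_inv (by rwa [he.source])]
    have hfin : pathELength (𝓡 2) γ 0 1 ≠ ⊤ := (hL.trans ENNReal.ofReal_lt_top).ne
    have hL' : (pathELength (𝓡 2) γ 0 1).toReal < ρ := by
      rwa [← ENNReal.lt_ofReal_iff_toReal_lt hfin]
    -- With ε equal to the gap between ρ and the length, the radial estimate gives √(ε² + R²) - ε ≤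
    -- ρ - ε, where R ≥ ρ is the radius at the exit time. This is impossible, as √(ε² + R²) > R.
    set ε := ρ - (pathELength (𝓡 2) γ 0 1).toReal with hε
    have hεpos : 0 < ε := by linarith
    have h1 := (he.radial_le_pathELength hγ hT0 hmem hεpos).trans
      (pathELength_mono le_rfl hT1)
    rw [ENNReal.ofReal_le_iff_le_toReal hfin, hstart] at h1
    have h2 : ‖e.symm (γ T)‖ < √(ε ^ 2 + ‖e.symm (γ T)‖ ^ 2) :=
      Real.lt_sqrt_of_sq_lt (by nlinarith)
    have h3 : √(ε ^ 2 + ‖(0 : V)‖ ^ 2) = ε := by simp [Real.sqrt_sq hεpos.le]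
    rw [h3] at h1
    linarith

end Minimizing

/-! ### The Jacobi equation -/

/-- Uniqueness for the Jacobi equation, without any regularity of the curvature `K`. -/
lemma jacobi_unique {ℓ : ℝ} (hℓ : 0 < ℓ) {K J J' G : ℝ → ℝ}
    (hJ : ∀ t ∈ Icc 0 ℓ, HasDerivWithinAt J (J' t) (Icc 0 ℓ) t)
    (hJ' : ∀ t ∈ Icc 0 ℓ, HasDerivWithinAt J' (-(K t * J t)) (Icc 0 ℓ) t)
    (hJ0 : J 0 = 0) (hJ1 : J' 0 = 1) (hG : ∀ t ∈ Icc 0 ℓ, ContDiffAt ℝ 2 G t) (hG0 : G 0 = 0)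
    (hG1 : deriv G 0 = 1) (hGpos : ∀ t ∈ Ioc 0 ℓ, 0 < G t)
    (hG2 : ∀ t ∈ Ioo 0 ℓ, deriv (deriv G) t = -(K t * G t)) :
    J ℓ = G ℓ ∧ J' ℓ = deriv G ℓ := by
  have dG : ∀ t ∈ Icc 0 ℓ, HasDerivAt G (deriv G t) t := fun t ht =>
    ((hG t ht).differentiableAt two_ne_zero).hasDerivAt
  have dG' : ∀ t ∈ Icc 0 ℓ, HasDerivAt (deriv G) (deriv (deriv G) t) t := fun t ht =>
    ((contDiffAt_deriv (hG t ht)).differentiableAt one_ne_zero).hasDerivAt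
  have hright {F : ℝ → ℝ} {F' t : ℝ} (ht : t ∈ Ico 0 ℓ) (h : HasDerivWithinAt F F' (Icc 0 ℓ) t) :
      HasDerivWithinAt F F' (Ici t) t := by
    refine (h.mono_of_mem_nhdsWithin ?_)
    filter_upwards [Icc_mem_nhdsGE ht.2] with s hs using ⟨ht.1.trans hs.1, hs.2⟩
  -- The Wronskian is constant. The equation for G is available at interior times only; at t = 0 the
  -- derivative vanishes because J and G do.
  have hW : ∀ t ∈ Icc 0 ℓ, J t * deriv G t - J' t * G t = 0 := by
    have hd : ∀ t ∈ Icc 0 ℓ, HasDerivWithinAt (fun t => J t * deriv G t - J' t * G t)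
        (J' t * deriv G t + J t * deriv (deriv G) t - (-(K t * J t) * G t + J' t * deriv G t))
        (Icc 0 ℓ) t := fun t ht =>
      ((hJ t ht).mul (dG' t ht).hasDerivWithinAt).sub ((hJ' t ht).mul (dG t ht).hasDerivWithinAt)
    intro t ht
    have h := constant_of_has_deriv_right_zero (fun t ht => (hd t ht).continuousWithinAt)
      (fun t ht => ?_) t ht
    · rw [h, hJ0, hG0]
      ring
    · have h := hright ht (hd t (Ico_subset_Icc_self ht))
      have hzero : J' t * deriv G t + J t * deriv (deriv G) t -
          (-(K t * J t) * G t + J' t * deriv G t) = 0 := by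
        rcases ht.1.eq_or_lt with rfl | hpos
        · rw [hJ0, hG0]
          ring
        · rw [hG2 t ⟨hpos, ht.2⟩]
          ring
      rwa [hzero] at h
  -- A zero Wronskian makes J / G constant away from 0, and its limit at 0 is 1 because both
  -- functions start at 0 with slope one.
  have hR : ∀ a ∈ Ioc 0 ℓ, J a / G a = J ℓ / G ℓ := by
    intro a ha
    have hsub : Icc a ℓ ⊆ Icc 0 ℓ := Icc_subset_Icc_left ha.1.le
    have hne : ∀ t ∈ Icc a ℓ, G t ≠ 0 := fun t ht => (hGpos t ⟨ha.1.trans_le ht.1, ht.2⟩).ne'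
    have hd : ∀ t ∈ Icc a ℓ, HasDerivWithinAt (fun t => J t / G t)
        ((J' t * G t - J t * deriv G t) / G t ^ 2) (Icc 0 ℓ) t := fun t ht =>
      (hJ t (hsub ht)).div (dG t (hsub ht)).hasDerivWithinAt (hne t ht)
    refine (constant_of_has_deriv_right_zero (f := fun t => J t / G t)
      (fun t ht => (hd t ht).continuousWithinAt.mono hsub) (fun t ht => ?_) ℓ ⟨ha.2, le_rfl⟩).symm
    have ht' := Ico_subset_Icc_self ht
    have h := hright ⟨(hsub ht').1, ht.2⟩ (hd t ht')
    have h0 := hW t (hsub ht')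
    rwa [show J' t * G t - J t * deriv G t = 0 by linarith, zero_div] at h
  have hslope {F : ℝ → ℝ} (h : HasDerivWithinAt F 1 (Ioi 0) 0) (h0 : F 0 = 0) :
      Tendsto (fun t => F t / t) (𝓝[>] 0) (𝓝 1) := by
    have h1 := (hasDerivWithinAt_iff_tendsto_slope' (by simp)).1 h
    refine h1.congr fun t => ?_
    simp [slope, h0, div_eq_inv_mul]
  have h0mem : (0 : ℝ) ∈ Icc 0 ℓ := ⟨le_rfl, hℓ.le⟩
  have l1 : Tendsto (fun t => J t / t) (𝓝[>] 0) (𝓝 1) := by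
    refine hslope ?_ hJ0
    have h := hright ⟨le_rfl, hℓ⟩ (hJ 0 h0mem)
    rw [hJ1] at h
    exact h.mono Ioi_subset_Ici_self
  have l2 : Tendsto (fun t => G t / t) (𝓝[>] 0) (𝓝 1) := by
    refine hslope ?_ hG0
    have h := dG 0 h0mem
    rw [hG1] at h
    exact h.hasDerivWithinAt
  have l3 : Tendsto (fun t => J t / G t) (𝓝[>] 0) (𝓝 (1 / 1)) := by
    refine (l1.div l2 one_ne_zero).congr' ?_
    filter_upwards [self_mem_nhdsWithin] with t ht
    have : t ≠ 0 := ne_of_gt ht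
    simp only [Pi.div_apply]
    rw [div_div_div_cancel_right₀ this]
  have l4 : Tendsto (fun t => J t / G t) (𝓝[>] 0) (𝓝 (J ℓ / G ℓ)) := by
    refine tendsto_const_nhds.congr' ?_
    filter_upwards [Ioc_mem_nhdsGT hℓ] with t ht using (hR t ht).symm
  have hGℓ := hGpos ℓ ⟨hℓ, le_rfl⟩
  have h1 : J ℓ = G ℓ := by
    have := tendsto_nhds_unique l4 l3
    rwa [div_one, div_eq_one_iff_eq hGℓ.ne'] at this
  refine ⟨h1, ?_⟩
  have h2 := hW ℓ ⟨hℓ.le, le_rfl⟩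
  rw [h1] at h2
  have : G ℓ * (deriv G ℓ - J' ℓ) = 0 := by linarith
  rcases mul_eq_zero.1 this with h | h
  · exact absurd h hGℓ.ne'
  · linarith

/-! ### Polar angles in the tangent plane -/

section Polar

variable {V : Type*} [NormedAddCommGroup V] [InnerProductSpace ℝ V]
  (b : OrthonormalBasis (Fin 2) ℝ V)

/-- The unit vector at angle `θ`. -/
def unitVec (θ : ℝ) : V := Real.cos θ • b 0 + Real.sin θ • b 1

/-- The unit vector at angle `θ + π / 2`. -/
def unitVec' (θ : ℝ) : V := -Real.sin θ • b 0 + Real.cos θ • b 1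

lemma inner_basis_comb (x y x' y' : ℝ) :
    inner ℝ (x • b 0 + y • b 1) (x' • b 0 + y' • b 1) = x * x' + y * y' := by
  have h00 : inner ℝ (b 0) (b 0) = (1 : ℝ) := by simp
  have h11 : inner ℝ (b 1) (b 1) = (1 : ℝ) := by simp
  have h01 : inner ℝ (b 0) (b 1) = (0 : ℝ) := b.orthonormal.2 (by simp)
  have h10 : inner ℝ (b 1) (b 0) = (0 : ℝ) := b.orthonormal.2 (by simp)
  simp only [inner_add_left, inner_add_right, real_inner_smul_left, real_inner_smul_right, h00, h11,
    h01, h10]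
  ring

lemma inner_unitVec_self (θ : ℝ) : inner ℝ (unitVec b θ) (unitVec b θ) = (1 : ℝ) := by
  rw [unitVec, inner_basis_comb]
  nlinarith [Real.sin_sq_add_cos_sq θ]

lemma inner_unitVec'_self (θ : ℝ) : inner ℝ (unitVec' b θ) (unitVec' b θ) = (1 : ℝ) := by
  rw [unitVec', inner_basis_comb]
  nlinarith [Real.sin_sq_add_cos_sq θ]

lemma inner_unitVec_unitVec' (θ : ℝ) : inner ℝ (unitVec b θ) (unitVec' b θ) = (0 : ℝ) := by
  rw [unitVec, unitVec', inner_basis_comb]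
  ring

lemma inner_unitVec'_unitVec (θ₁ θ : ℝ) :
    inner ℝ (unitVec' b θ₁) (unitVec b θ) = Real.sin (θ - θ₁) := by
  rw [unitVec, unitVec', inner_basis_comb, Real.sin_sub]
  ring

lemma norm_unitVec (θ : ℝ) : ‖unitVec b θ‖ = 1 := by
  rw [norm_eq_sqrt_real_inner, inner_unitVec_self, Real.sqrt_one]

lemma hasDerivAt_unitVec (θ : ℝ) : HasDerivAt (unitVec b) (unitVec' b θ) θ :=
  ((Real.hasDerivAt_cos θ).smul_const (b 0)).add ((Real.hasDerivAt_sin θ).smul_const (b 1))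

lemma contDiff_unitVec : ContDiff ℝ ∞ (unitVec b) :=
  (Real.contDiff_cos.smul contDiff_const).add (Real.contDiff_sin.smul contDiff_const)

lemma exists_unitVec (w : V) : ∃ θ, w = ‖w‖ • unitVec b θ := by
  have hw : w = b.repr w 0 • b 0 + b.repr w 1 • b 1 := by
    conv_lhs => rw [← b.sum_repr w]
    rw [Fin.sum_univ_two]
  set z : ℂ := ⟨b.repr w 0, b.repr w 1⟩ with hz
  have hn : ‖z‖ = ‖w‖ := by
    have h1 : ‖w‖ ^ 2 = b.repr w 0 * b.repr w 0 + b.repr w 1 * b.repr w 1 := by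
      rw [← real_inner_self_eq_norm_sq, hw, inner_basis_comb, ← hw]
    have h2 : ‖z‖ ^ 2 = b.repr w 0 * b.repr w 0 + b.repr w 1 * b.repr w 1 := by
      rw [← Complex.normSq_eq_norm_sq, Complex.normSq_mk]
    exact (sq_eq_sq₀ (norm_nonneg _) (norm_nonneg _)).1 (h2.trans h1.symm)
  refine ⟨z.arg, ?_⟩
  conv_lhs => rw [hw]
  rw [unitVec, smul_add, smul_smul, smul_smul, ← hn, Complex.norm_mul_cos_arg,
    Complex.norm_mul_sin_arg]

/-- A polar angle is given by `arcsin` near a point where it is continuous. -/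
lemma polarAngle_eventuallyEq {u : ℝ → V} {θ : ℝ → ℝ} {s₁ : ℝ} (hθ : ContinuousAt θ s₁)
    (hu0 : ∀ᶠ s in 𝓝 s₁, u s ≠ 0) (hu : ∀ᶠ s in 𝓝 s₁, u s = ‖u s‖ • unitVec b (θ s)) :
    θ =ᶠ[𝓝 s₁] fun s => θ s₁ + Real.arcsin (inner ℝ (unitVec' b (θ s₁)) (u s) / ‖u s‖) := by
  have hnear : ∀ᶠ s in 𝓝 s₁, θ s ∈ Ioo (θ s₁ - Real.pi / 2) (θ s₁ + Real.pi / 2) :=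
    hθ.eventually_mem (Ioo_mem_nhds (by linarith [Real.pi_pos]) (by linarith [Real.pi_pos]))
  filter_upwards [hu0, hu, hnear] with s h0 h1 h2
  have hn : ‖u s‖ ≠ 0 := norm_ne_zero_iff.2 h0
  have h3 : inner ℝ (unitVec' b (θ s₁)) (u s) / ‖u s‖ = Real.sin (θ s - θ s₁) := by
    conv_lhs => rw [h1]
    rw [real_inner_smul_right, inner_unitVec'_unitVec, norm_smul, norm_unitVec, norm_norm, mul_one,
      mul_div_cancel_left₀ _ hn]
  rw [h3, Real.arcsin_sin (by linarith [h2.1]) (by linarith [h2.2])]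
  ring

/-- At s₁ the argument of `arcsin` is 0, away from its singular values ±1, and the norm is `C²`
there since u does not vanish. -/
lemma contDiffAt_arcsin_angle {u : ℝ → V} {θ₁ s₁ : ℝ} (hu : ContDiffAt ℝ 2 u s₁)
    (hu1 : u s₁ = ‖u s₁‖ • unitVec b θ₁) (hu0 : u s₁ ≠ 0) :
    ContDiffAt ℝ 2 (fun s => θ₁ + Real.arcsin (inner ℝ (unitVec' b θ₁) (u s) / ‖u s‖)) s₁ := by
  have hn : ‖u s₁‖ ≠ 0 := norm_ne_zero_iff.2 hu0
  have hk : inner ℝ (unitVec' b θ₁) (u s₁) / ‖u s₁‖ = (0 : ℝ) := by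
    rw [hu1, real_inner_smul_right, inner_unitVec'_unitVec]
    simp
  have hq : ContDiffAt ℝ 2 (fun s => inner ℝ (unitVec' b θ₁) (u s) / ‖u s‖) s₁ :=
    (contDiffAt_const.inner ℝ hu).div (hu.norm ℝ hu0) hn
  refine contDiffAt_const.add (ContDiffAt.comp (g := Real.arcsin) s₁ ?_ hq)
  rw [hk]
  exact Real.contDiffAt_arcsin (by norm_num) (by norm_num)

/-- The angle is the one at s₁ plus the `arcsin` of the sine of the deviation. A sine alone leaves
two directions possible; near s₁ the deviation has positive cosine, which selects the right one. -/
lemma exists_polarAngle {u : ℝ → V} {s₁ : ℝ} (hu : ContDiffAt ℝ 2 u s₁) (hu0 : u s₁ ≠ 0) :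
    ∃ θ : ℝ → ℝ, ContinuousAt θ s₁ ∧ ∀ᶠ s in 𝓝 s₁, u s = ‖u s‖ • unitVec b (θ s) := by
  obtain ⟨θ₁, hθ₁⟩ := exists_unitVec b (u s₁)
  have hn : ‖u s₁‖ ≠ 0 := norm_ne_zero_iff.2 hu0
  refine ⟨_, (contDiffAt_arcsin_angle b hu hθ₁ hu0).continuousAt, ?_⟩
  have hc : ContinuousAt (fun s => inner ℝ (unitVec b θ₁) (u s)) s₁ :=
    (contDiffAt_const.inner ℝ hu).continuousAt
  have hpos : 0 < inner ℝ (unitVec b θ₁) (u s₁) := by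
    rw [hθ₁, real_inner_smul_right, inner_unitVec_self, mul_one]
    positivity
  filter_upwards [hu.continuousAt.eventually_ne hu0, hc.eventually (lt_mem_nhds hpos)] with s h0 h1
  obtain ⟨ψ, hψ⟩ := exists_unitVec b (u s)
  have hns : 0 < ‖u s‖ := norm_pos_iff.2 h0
  have hcos : 0 < Real.cos (ψ - θ₁) := by
    rw [hψ, real_inner_smul_right, unitVec, unitVec, inner_basis_comb] at h1
    rw [Real.cos_sub]
    have := pos_of_mul_pos_right h1 hns.le
    linarith
  have hk : inner ℝ (unitVec' b θ₁) (u s) / ‖u s‖ = Real.sin (ψ - θ₁) := by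
    conv_lhs => rw [hψ]
    rw [real_inner_smul_right, inner_unitVec'_unitVec, norm_smul, norm_unitVec, norm_norm, mul_one,
      mul_div_cancel_left₀ _ hns.ne']
  have hs : Real.sin (Real.arcsin (Real.sin (ψ - θ₁))) = Real.sin (ψ - θ₁) :=
    Real.sin_arcsin (Real.neg_one_le_sin _) (Real.sin_le_one _)
  have hc' : Real.cos (Real.arcsin (Real.sin (ψ - θ₁))) = Real.cos (ψ - θ₁) := by
    rw [Real.cos_arcsin, ← Real.cos_sq', Real.sqrt_sq hcos.le]
  have heq : unitVec b (θ₁ + Real.arcsin (Real.sin (ψ - θ₁))) = unitVec b ψ := by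
    rw [unitVec, unitVec, Real.cos_add, Real.sin_add, hs, hc', ← Real.cos_add, ← Real.sin_add]
    simp
  rw [hk, heq]
  exact hψ

end Polar

/-! ### The metric and the Jacobi field in geodesic polar coordinates -/

section Radial

variable {M : Type*} [MetricSpace M] [ChartedSpace Plane M] [IsManifold (𝓡 2) ∞ M]
  [RiemannianBundle (fun x : M => TangentSpace (𝓡 2) x)]
  {V : Type*} [NormedAddCommGroup V] [InnerProductSpace ℝ V]
  {e : OpenPartialHomeomorph V M} {δ : ℝ}

lemma IsNormalChart.pushVec_injective (he : IsNormalChart e δ) {w : V}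
    (hw : w ∈ Metric.ball (0 : V) δ) : Function.Injective (pushVec e w) := by
  have h : e.MDifferentiable 𝓘(ℝ, V) (𝓡 2) :=
    ⟨he.contMDiffOn.mdifferentiableOn (by simp), he.contMDiffOn_symm.mdifferentiableOn (by simp)⟩
  exact h.mfderiv_injective (by rwa [he.source])

lemma dirDeriv_snd_plane (u a : V) (z : ℝ × ℝ) :
    dirDeriv (0, 1) (fun z : ℝ × ℝ => z.1 • u + z.2 • a) z = a := by
  have h := ((ContinuousLinearMap.fst ℝ ℝ ℝ).smulRight u +
    (ContinuousLinearMap.snd ℝ ℝ ℝ).smulRight a).fderiv (x := z)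
  refine (congrArg (fun L => L ((0 : ℝ), (1 : ℝ))) h).trans ?_
  simp

lemma deriv_deriv_slice {P : ℝ × ℝ → ℝ} {t τ : ℝ} (hP : ContDiffAt ℝ ∞ P (t, τ)) :
    deriv (fun s => P (s, τ)) t = dirDeriv (1, 0) P (t, τ) ∧
    deriv (deriv fun s => P (s, τ)) t = dirDeriv (1, 0) (dirDeriv (1, 0) P) (t, τ) := by
  have hline : ContinuousAt (fun s : ℝ => (s, τ)) t := by fun_prop
  have h1 : ∀ᶠ z in 𝓝 (t, τ), DifferentiableAt ℝ P z := by
    filter_upwards [(hP.of_le (m := 1) (by simp)).eventually (by simp)] with z hz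
      using hz.differentiableAt one_ne_zero
  have h2 : deriv (fun s => P (s, τ)) =ᶠ[𝓝 t] fun s => dirDeriv (1, 0) P (s, τ) := by
    filter_upwards [hline.eventually h1] with s hs using (hasDerivAt_slice hs).deriv
  refine ⟨h2.self_of_nhds, ?_⟩
  rw [h2.deriv_eq]
  exact (hasDerivAt_slice ((contDiffAt_dirDeriv hP _).differentiableAt (by simp))).deriv

variable [IsContMDiffRiemannianBundle (𝓡 2) ∞ Plane (fun x : M => TangentSpace (𝓡 2) x)]

/-- The affine family s u + τ a has a as its constant τ-derivative, so smoothness also holds at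
radius 0, where the angular field of the polar family degenerates. -/
lemma IsNormalChart.contDiffAt_pullForm_line (he : IsNormalChart e δ) {u : V} (a : V) {t : ℝ}
    (hz : t • u ∈ Metric.ball (0 : V) δ) :
    ContDiffAt ℝ ∞ (fun s : ℝ => pullForm e (s • u) a a) t := by
  have h := he.contDiffAt_pullForm (F := fun z : ℝ × ℝ => z.1 • u + z.2 • a) (z := (t, 0))
    (Eventually.of_forall fun y => by fun_prop) (by simpa using hz) (0, 1) (0, 1)
  simp only [dirDeriv_snd_plane] at h
  have h2 : ContDiffAt ℝ ∞ (fun s : ℝ => (s, (0 : ℝ))) t := by fun_prop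
  have h3 := ContDiffAt.comp (f := fun s : ℝ => (s, (0 : ℝ))) t h h2
  simpa [Function.comp_def] using h3

variable (b : OrthonormalBasis (Fin 2) ℝ V)

lemma smul_unitVec_mem_ball {t θ : ℝ} (ht : 0 ≤ t) :
    t • unitVec b θ ∈ Metric.ball (0 : V) δ ↔ t < δ := by
  rw [mem_ball_zero_iff, norm_smul, norm_unitVec, mul_one, Real.norm_of_nonneg ht]

lemma contDiff_polarRay : ContDiff ℝ ∞ fun z : ℝ × ℝ => z.1 • unitVec b z.2 :=
  contDiff_fst.smul ((contDiff_unitVec b).comp contDiff_snd)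

lemma dirDeriv_fst_polarRay (z : ℝ × ℝ) :
    dirDeriv (1, 0) (fun z : ℝ × ℝ => z.1 • unitVec b z.2) z = unitVec b z.2 :=
  dirDeriv_fst_ray (hasDerivAt_unitVec b z.2).differentiableAt

lemma dirDeriv_snd_polarRay (z : ℝ × ℝ) :
    dirDeriv (0, 1) (fun z : ℝ × ℝ => z.1 • unitVec b z.2) z = z.1 • unitVec' b z.2 := by
  rw [← (hasDerivAt_unitVec b z.2).deriv]
  exact dirDeriv_snd_ray (hasDerivAt_unitVec b z.2).differentiableAt

/-- In geodesic polar coordinates the metric is `dr² + q dθ²`. -/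
lemma IsNormalChart.polar_metric (he : IsNormalChart e δ) {z : ℝ × ℝ} (hz0 : 0 ≤ z.1)
    (hz : z.1 < δ) {x : M} (hx : e (z.1 • unitVec b z.2) ∈ (chartAt Plane x).source) :
    let f := fun z : ℝ × ℝ => extChartAt (𝓡 2) x (e (z.1 • unitVec b z.2))
    metricForm (chartGram x) (f z) (dirDeriv (1, 0) f z) (dirDeriv (1, 0) f z) = 1 ∧
    metricForm (chartGram x) (f z) (dirDeriv (1, 0) f z) (dirDeriv (0, 1) f z) = 0 ∧
    metricForm (chartGram x) (f z) (dirDeriv (0, 1) f z) (dirDeriv (0, 1) f z) =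
      z.1 ^ 2 * pullForm e (z.1 • unitVec b z.2) (unitVec' b z.2) (unitVec' b z.2) := by
  intro f
  have hb : z.1 • unitVec b z.2 ∈ Metric.ball (0 : V) δ := (smul_unitVec_mem_ball b hz0).2 hz
  have hF := (contDiff_polarRay b).contDiffAt (x := z)
  have key (v w : ℝ × ℝ) := he.metricForm_family hF hb hx v w
  refine ⟨?_, ?_, ?_⟩
  · refine (key _ _).trans ?_
    rw [dirDeriv_fst_polarRay, he.pullForm_self hz0 hb, norm_unitVec, one_pow]
  · refine (key _ _).trans ?_
    rw [dirDeriv_fst_polarRay, dirDeriv_snd_polarRay, pullForm_smul_right, ← pullForm_smul_left,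
      he.gauss hb, real_inner_smul_left, inner_unitVec_unitVec', mul_zero]
  · refine (key _ _).trans ?_
    rw [dirDeriv_snd_polarRay, pullForm_smul_left, pullForm_smul_right]
    ring

/-- Near points with positive radius, the chart expression of geodesic polar coordinates is smooth
and its metric is `dr² + q dθ²`. -/
lemma IsNormalChart.eventually_polar (he : IsNormalChart e δ) {r θ : ℝ} (hr0 : 0 < r) (hr : r < δ)
    {x : M} (hx : e (r • unitVec b θ) ∈ (chartAt Plane x).source) :
    let f := fun z : ℝ × ℝ => extChartAt (𝓡 2) x (e (z.1 • unitVec b z.2))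
    ∀ᶠ z in 𝓝 (r, θ), ContDiffAt ℝ ∞ f z ∧
      covDeriv (chartGram x) f (1, 0) (dirDeriv (1, 0) f) z = 0 ∧
      metricForm (chartGram x) (f z) (dirDeriv (1, 0) f z) (dirDeriv (1, 0) f z) = 1 ∧
      metricForm (chartGram x) (f z) (dirDeriv (1, 0) f z) (dirDeriv (0, 1) f z) = 0 ∧
      metricForm (chartGram x) (f z) (dirDeriv (0, 1) f z) (dirDeriv (0, 1) f z) =
        z.1 ^ 2 * pullForm e (z.1 • unitVec b z.2) (unitVec' b z.2) (unitVec' b z.2) := by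
  intro f
  have h0 : ∀ᶠ z : ℝ × ℝ in 𝓝 (r, θ), 0 < z.1 := continuousAt_fst.eventually (lt_mem_nhds hr0)
  filter_upwards [h0, he.eventually_mem (contDiff_polarRay b).continuous.continuousAt
    ((smul_unitVec_mem_ball b hr0.le).2 hr) hx] with z h0 h1
  exact ⟨he.contDiffAt_family (contDiff_polarRay b).contDiffAt h1.1 h1.2,
    he.covDeriv_family h0.le (contDiff_unitVec b).contDiffAt h1.1 h1.2,
    he.polar_metric b h0.le ((smul_unitVec_mem_ball b h0.le).1 h1.1) h1.2⟩

lemma pullForm_unitVec'_pos (he : IsNormalChart e δ) {w : V} (hw : w ∈ Metric.ball (0 : V) δ)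
    (θ : ℝ) : 0 < pullForm e w (unitVec' b θ) (unitVec' b θ) := by
  refine real_inner_self_pos.2 fun h => ?_
  have h0 := he.pushVec_injective hw (h.trans (map_zero _).symm)
  have h1 := inner_unitVec'_self b θ
  rw [h0, inner_zero_left] at h1
  exact zero_ne_one h1

/-- Once the factor t is split off from the length of ∂_θ, the radicand is positive even at t = 0.
Hence that length is `C²` up to the centre, as `jacobi_unique` requires. -/
lemma IsNormalChart.contDiffAt_jacobi_polar (he : IsNormalChart e δ) {t θ : ℝ} (ht0 : 0 ≤ t)
    (ht : t < δ) :
    ContDiffAt ℝ 2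
      (fun t => √(pullForm e (t • unitVec b θ) (unitVec' b θ) (unitVec' b θ))) t := by
  have hbt : t • unitVec b θ ∈ Metric.ball (0 : V) δ := (smul_unitVec_mem_ball b ht0).2 ht
  exact ((he.contDiffAt_pullForm_line (unitVec' b θ) hbt).of_le ENat.LEInfty.out).sqrt
    (pullForm_unitVec'_pos b he hbt θ).ne'

lemma deriv_deriv_sq {G : ℝ → ℝ} {t : ℝ} (hG : ContDiffAt ℝ 2 G t) :
    deriv (fun s => G s ^ 2) t = 2 * G t * deriv G t ∧
    deriv (deriv fun s => G s ^ 2) t = 2 * (deriv G t ^ 2 + G t * deriv (deriv G) t) := by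
  have h1 : deriv (fun s => G s ^ 2) =ᶠ[𝓝 t] fun s => 2 * G s * deriv G s := by
    filter_upwards [hG.eventually (by simp)] with s hs
    rw [((hs.differentiableAt two_ne_zero).hasDerivAt.fun_pow 2).deriv]
    norm_num
  refine ⟨h1.self_of_nhds, ?_⟩
  have h2 := (((hG.differentiableAt two_ne_zero).hasDerivAt.const_mul 2).fun_mul
    ((contDiffAt_deriv hG).differentiableAt one_ne_zero).hasDerivAt).deriv
  rw [h1.deriv_eq, h2]
  ring

/-- The length of `∂_θ` satisfies the Jacobi equation along rays. -/
lemma IsNormalChart.jacobi_polar (he : IsNormalChart e δ) {t θ : ℝ} (ht0 : 0 < t) (ht : t < δ) :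
    let G := fun t => t * √(pullForm e (t • unitVec b θ) (unitVec' b θ) (unitVec' b θ))
    deriv (deriv G) t = -(gaussianCurvature (e (t • unitVec b θ)) * G t) := by
  intro G
  have hbt : t • unitVec b θ ∈ Metric.ball (0 : V) δ := (smul_unitVec_mem_ball b ht0.le).2 ht
  have hG : ContDiffAt ℝ 2 G t := contDiffAt_id.mul (he.contDiffAt_jacobi_polar b ht0.le ht)
  have hGpos : 0 < G t := mul_pos ht0 (Real.sqrt_pos.2 (pullForm_unitVec'_pos b he hbt θ))
  -- `gaussianCurvature` is computed in the chart around the point itself, so the Jacobi relation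
  -- has to be read in this chart.
  set x := e (t • unitVec b θ) with hxdef
  have hx : e (t • unitVec b θ) ∈ (chartAt Plane x).source := mem_chart_source Plane _
  have hev := he.eventually_polar b ht0 ht hx
  have hg := gramOn_chartGram x
  have hm : extChartAt (𝓡 2) x (e (t • unitVec b θ)) ∈ (extChartAt (𝓡 2) x).target :=
    mem_extChartAt_target x
  have key := jacobi_sq (f := fun z : ℝ × ℝ => extChartAt (𝓡 2) x (e (z.1 • unitVec b z.2)))
    (z := (t, θ)) (v := (1, 0)) (w := (0, 1)) hg hm (hev.mono fun z h => h.1)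
    (hev.mono fun z h => h.2.1) hev.self_of_nhds.2.2.1 (hev.mono fun z h => h.2.2.2.1)
  set f := fun z : ℝ × ℝ => extChartAt (𝓡 2) x (e (z.1 • unitVec b z.2)) with hf
  set q : ℝ × ℝ → ℝ := fun y => metricForm (chartGram x) (f y) (dirDeriv (0, 1) f y)
    (dirDeriv (0, 1) f y) with hq
  change q (t, θ) * dirDeriv (1, 0) (dirDeriv (1, 0) q) (t, θ) = dirDeriv (1, 0) q (t, θ) ^ 2 / 2
    - 2 * gaussianCurvature x * q (t, θ) ^ 2 at key
  have hfs : ContDiffAt ℝ ∞ f (t, θ) := hev.self_of_nhds.1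
  have hqs : ContDiffAt ℝ ∞ q (t, θ) := contDiffAt_metricForm (f := f) hg hm hfs
    (contDiffAt_dirDeriv hfs _) (contDiffAt_dirDeriv hfs _)
  have hqG : (fun s => q (s, θ)) =ᶠ[𝓝 t] fun s => G s ^ 2 := by
    have hline : ContinuousAt (fun s : ℝ => (s, θ)) t := by fun_prop
    filter_upwards [hline.eventually hev] with s hs
    refine hs.2.2.2.2.trans ?_
    rw [mul_pow, Real.sq_sqrt]
    exact real_inner_self_nonneg
  obtain ⟨d1, d2⟩ := deriv_deriv_slice hqs
  obtain ⟨d3, d4⟩ := deriv_deriv_sq hG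
  rw [← d1, ← d2, show q (t, θ) = G t ^ 2 from hqG.self_of_nhds, hqG.deriv.deriv_eq, hqG.deriv_eq,
    d3, d4] at key
  -- Substituting q = G² into q q'' = q'²/2 - 2 K q² cancels the terms with G'²; the remaining
  -- factor 2G³ is positive.
  have h3 : 2 * G t ^ 3 * (deriv (deriv G) t + gaussianCurvature x * G t) = 0 := by linarith
  have h4 : 2 * G t ^ 3 ≠ 0 := by positivity
  linarith [(mul_eq_zero.1 h3).resolve_left h4]

/-- The Jacobi field along a ray is the length of `∂_θ`. -/
lemma IsNormalChart.jacobiField_mul (he : IsNormalChart e δ) {σ : ℝ → M} {ℓ θ : ℝ} {J J' : ℝ → ℝ}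
    (hℓ0 : 0 < ℓ) (hℓ : ℓ < δ) (hσ : ∀ t ∈ Icc 0 ℓ, σ t = e (t • unitVec b θ))
    (hJ : IsJacobiField σ ℓ J J') {x : M}
    (hx : e (ℓ • unitVec b θ) ∈ (chartAt Plane x).source) :
    let f := fun z : ℝ × ℝ => extChartAt (𝓡 2) x (e (z.1 • unitVec b z.2))
    J ℓ * J' ℓ = dirDeriv (1, 0) (fun y => metricForm (chartGram x) (f y) (dirDeriv (0, 1) f y)
      (dirDeriv (0, 1) f y)) (ℓ, θ) / 2 := by
  intro f
  set B := fun t : ℝ => √(pullForm e (t • unitVec b θ) (unitVec' b θ) (unitVec' b θ)) with hB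
  have hBs : ∀ t ∈ Icc 0 ℓ, ContDiffAt ℝ 2 B t := fun t ht =>
    he.contDiffAt_jacobi_polar b ht.1 (ht.2.trans_lt hℓ)
  have hGs : ∀ t ∈ Icc 0 ℓ, ContDiffAt ℝ 2 (fun t => t * B t) t := fun t ht =>
    contDiffAt_id.mul (hBs t ht)
  have hδ : 0 < δ := hℓ0.trans hℓ
  have hB0 : B 0 = 1 := by
    simp only [hB, zero_smul]
    rw [he.pullForm_zero hδ, ← real_inner_self_eq_norm_sq, inner_unitVec'_self, Real.sqrt_one]
  have h1 : deriv (fun t => t * B t) 0 = 1 := by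
    have h := ((hasDerivAt_id (0 : ℝ)).fun_mul
      ((hBs 0 ⟨le_rfl, hℓ0.le⟩).differentiableAt two_ne_zero).hasDerivAt).deriv
    simpa [hB0] using h
  have hpos : ∀ t ∈ Ioc 0 ℓ, 0 < t * B t := fun t ht =>
    mul_pos ht.1 (Real.sqrt_pos.2 (pullForm_unitVec'_pos b he
      ((smul_unitVec_mem_ball b ht.1.le).2 (ht.2.trans_lt hℓ)) θ))
  obtain ⟨j1, j2⟩ := jacobi_unique (K := fun t => gaussianCurvature (σ t)) hℓ0 hJ.deriv_J hJ.jacobi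
    hJ.zero hJ.one hGs (zero_mul _) h1 hpos fun t ht => by
      rw [hσ t ⟨ht.1.le, ht.2.le⟩]
      exact he.jacobi_polar b ht.1 (ht.2.trans hℓ)
  have hev := he.eventually_polar b hℓ0 hℓ hx
  have hfs : ContDiffAt ℝ ∞ f (ℓ, θ) := hev.self_of_nhds.1
  have hm : f (ℓ, θ) ∈ (extChartAt (𝓡 2) x).target :=
    (extChartAt (𝓡 2) x).map_source (by rwa [extChartAt_source])
  have hqs := contDiffAt_metricForm (f := f) (gramOn_chartGram x) hm hfs
    (contDiffAt_dirDeriv hfs (0, 1)) (contDiffAt_dirDeriv hfs (0, 1))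
  have hqG : (fun s => metricForm (chartGram x) (f (s, θ)) (dirDeriv (0, 1) f (s, θ))
      (dirDeriv (0, 1) f (s, θ))) =ᶠ[𝓝 ℓ] fun s => (s * B s) ^ 2 := by
    have hline : ContinuousAt (fun s : ℝ => (s, θ)) ℓ := by fun_prop
    filter_upwards [hline.eventually hev] with s hs
    refine hs.2.2.2.2.trans ?_
    rw [mul_pow, Real.sq_sqrt]
    exact real_inner_self_nonneg
  rw [← (deriv_deriv_slice hqs).1, hqG.deriv_eq,
    (deriv_deriv_sq (hGs ℓ ⟨hℓ0.le, le_rfl⟩)).1, j1, j2]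
  ring

end Radial

/-! ### Curves in a normal neighbourhood -/

section Curves

lemma deriv_eq_of_eqOn_Icc {G : Type*} [NormedAddCommGroup G] [NormedSpace ℝ G] {f h : ℝ → G}
    {a b t : ℝ} (hab : a < b) (ht : t ∈ Icc a b) (hf : DifferentiableAt ℝ f t)
    (hh : DifferentiableAt ℝ h t) (heq : EqOn f h (Icc a b)) : deriv f t = deriv h t := by
  have hu : UniqueDiffWithinAt ℝ (Icc a b) t := uniqueDiffOn_Icc hab t ht
  rw [← hf.derivWithin hu, ← hh.derivWithin hu]
  exact derivWithin_congr heq (heq ht)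

variable {M : Type*} [MetricSpace M] [ChartedSpace Plane M]
  [RiemannianBundle (fun x : M => TangentSpace (𝓡 2) x)]
  {V : Type*} [NormedAddCommGroup V] [InnerProductSpace ℝ V]
  {e : OpenPartialHomeomorph V M} {δ : ℝ}

lemma exists_lift_eq {σ : ℝ → M} {t : ℝ} {p : M} (h : σ t = p) :
    ∃ v : TangentSpace (𝓡 2) p, lift σ t = ⟨p, v⟩ := by
  subst h
  exact ⟨_, rfl⟩

variable [IsManifold (𝓡 2) ∞ M]

lemma IsNormalChart.deriv_chart (he : IsNormalChart e δ) {h : ℝ → V} {h' : V} {t : ℝ}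
    (hh : HasDerivAt h h' t) (hz : h t ∈ Metric.ball (0 : V) δ) {x : M}
    (hx : e (h t) ∈ (chartAt Plane x).source) :
    DifferentiableAt ℝ (fun s => extChartAt (𝓡 2) x (e (h s))) t ∧
    deriv (fun s => extChartAt (𝓡 2) x (e (h s))) t =
      chartDeriv x (e (h t)) (pushVec e (h t) h') := by
  have hm : MDifferentiableAt 𝓘(ℝ, ℝ) (𝓡 2) (fun s => e (h s)) t :=
    MDifferentiableAt.comp (g := e) (f := h) t (he.mdifferentiableAt hz)
      hh.differentiableAt.mdifferentiableAt
  refine ⟨?_, ?_⟩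
  · have h1 : DifferentiableAt ℝ (fun y => extChartAt (𝓡 2) x (e y)) (h t) :=
      (contDiffAt_chart_comp le_rfl (he.contMDiffAt hz) x hx).differentiableAt (by simp)
    exact DifferentiableAt.comp (f := h) t h1 hh.differentiableAt
  · rw [← chartDeriv_velocity hm x hx]
    exact congrArg _ (velocity_comp (he.mdifferentiableAt hz) hh)

variable [IsContMDiffRiemannianBundle (𝓡 2) ∞ Plane (fun x : M => TangentSpace (𝓡 2) x)]

/-- `geodesicCurvature` is the length of the covariant acceleration, so by positive definiteness its
vanishing kills the whole vector. -/
lemma acceleration_eq_zero {γ : ℝ → M} {s : ℝ} (hγ : ContMDiffAt 𝓘(ℝ, ℝ) (𝓡 2) 2 γ s)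
    (h : geodesicCurvature γ s = 0) :
    deriv (deriv fun τ => extChartAt (𝓡 2) (γ s) (γ τ)) s
      + christoffelForm (chartGram (γ s)) (extChartAt (𝓡 2) (γ s) (γ s))
        (deriv (fun τ => extChartAt (𝓡 2) (γ s) (γ τ)) s)
        (deriv (fun τ => extChartAt (𝓡 2) (γ s) (γ τ)) s) = 0 := by
  set A := deriv (deriv fun τ => extChartAt (𝓡 2) (γ s) (γ τ)) s
      + christoffelForm (chartGram (γ s)) (extChartAt (𝓡 2) (γ s) (γ s))
        (deriv (fun τ => extChartAt (𝓡 2) (γ s) (γ τ)) s)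
        (deriv (fun τ => extChartAt (𝓡 2) (γ s) (γ τ)) s) with hA
  have hc := contDiffAt_chart_comp ENat.LEInfty.out hγ (γ s) (mem_chart_source Plane _)
  by_contra hne
  have hpos := metricForm_chartGram_pos (γ s) (mem_extChartAt_target (I := 𝓡 2) (γ s)) hne
  have hk : geodesicCurvature γ s =
      √(metricForm (chartGram (γ s)) (extChartAt (𝓡 2) (γ s) (γ s)) A A) := by
    rw [geodesicCurvature]
    simp only [covAccel_eq (γ s) hc, ← hA]
    rfl
  rw [hk] at h
  exact (Real.sqrt_pos.2 hpos).ne' h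

variable {γ : ℝ → M} {s₁ : ℝ} {θ : ℝ → ℝ} (b : OrthonormalBasis (Fin 2) ℝ V)

/-- The second derivative of the radius along a curve with vanishing geodesic curvature. -/
lemma IsNormalChart.deriv_deriv_norm (he : IsNormalChart e δ) {u : ℝ → V}
    (hu : ContDiffAt ℝ 2 u s₁) (hu0 : u s₁ ≠ 0) (hub : u s₁ ∈ Metric.ball (0 : V) δ)
    (hγ : ContMDiffAt 𝓘(ℝ, ℝ) (𝓡 2) 2 γ s₁) (hγu : ∀ᶠ s in 𝓝 s₁, γ s = e (u s))
    (hκ : geodesicCurvature γ s₁ = 0) (hθ : ContDiffAt ℝ 2 θ s₁)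
    (hθu : ∀ᶠ s in 𝓝 s₁, u s = ‖u s‖ • unitVec b (θ s)) {σ : ℝ → M} {J J' : ℝ → ℝ}
    (hσ : ∀ t ∈ Icc 0 ‖u s₁‖, σ t = e (t • unitVec b (θ s₁)))
    (hJ : IsJacobiField σ ‖u s₁‖ J J') :
    deriv (deriv fun s => ‖u s‖) s₁ = deriv θ s₁ ^ 2 * (J ‖u s₁‖ * J' ‖u s₁‖) := by
  have hr : ContDiffAt ℝ 2 (fun s => ‖u s‖) s₁ := hu.norm ℝ hu0
  have hr0 : 0 < ‖u s₁‖ := norm_pos_iff.2 hu0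
  have hrδ : ‖u s₁‖ < δ := by simpa using hub
  have hev' {F : ℝ → ℝ} (hF : ContDiffAt ℝ 2 F s₁) :
      ∀ᶠ τ in 𝓝 s₁, HasDerivAt F (deriv F τ) τ := by
    filter_upwards [hF.eventually (by simp)] with τ hτ
    exact (hτ.differentiableAt two_ne_zero).hasDerivAt
  have hγ1 : γ s₁ = e (‖u s₁‖ • unitVec b (θ s₁)) := by
    rw [← hθu.self_of_nhds]
    exact hγu.self_of_nhds
  have hx : e (‖u s₁‖ • unitVec b (θ s₁)) ∈ (chartAt Plane (γ s₁)).source := by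
    rw [← hγ1]
    exact mem_chart_source Plane _
  have hm : extChartAt (𝓡 2) (γ s₁) (e (‖u s₁‖ • unitVec b (θ s₁))) ∈
      (extChartAt (𝓡 2) (γ s₁)).target :=
    (extChartAt (𝓡 2) (γ s₁)).map_source (by rwa [extChartAt_source])
  have hc := contDiffAt_chart_comp ENat.LEInfty.out hγ (γ s₁) (mem_chart_source Plane _)
  have hev := he.eventually_polar b hr0 hrδ hx
  rw [he.jacobiField_mul b hr0 hrδ hσ hJ hx]
  refine deriv_radial (r := fun s => ‖u s‖) (c := fun τ => extChartAt (𝓡 2) (γ s₁) (γ τ))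
    (f := fun z : ℝ × ℝ => extChartAt (𝓡 2) (γ s₁) (e (z.1 • unitVec b z.2)))
    (gramOn_chartGram (γ s₁)) hm (hev.mono fun z h => h.1) hev.self_of_nhds.2.1
    (hev.mono fun z h => h.2.2.1) (hev.mono fun z h => h.2.2.2.1) (hev' hr) (hev' hθ)
    ((contDiffAt_deriv hr).differentiableAt one_ne_zero).hasDerivAt ?_
    ((contDiffAt_deriv hc).differentiableAt one_ne_zero) (acceleration_eq_zero hγ hκ)
  filter_upwards [hγu, hθu] with τ h1 h2
  rw [h1]
  conv_lhs => rw [h2]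

/-- A unit speed curve along which the polar angle is stationary is tangent to the ray. -/
lemma IsNormalChart.areTangent_of_deriv_angle (he : IsNormalChart e δ)
    (hγ : ContMDiffAt 𝓘(ℝ, ℝ) (𝓡 2) 1 γ s₁) (hγe : γ s₁ ∈ e.target)
    (hunit : ‖velocity γ s₁‖ = 1) (hu0 : e.symm (γ s₁) ≠ 0)
    (hθ : DifferentiableAt ℝ θ s₁) (hθ0 : deriv θ s₁ = 0)
    (hθu : ∀ᶠ s in 𝓝 s₁, e.symm (γ s) = ‖e.symm (γ s)‖ • unitVec b (θ s)) {σ : ℝ → M} {ℓ : ℝ}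
    (hℓ : ℓ = ‖e.symm (γ s₁)‖) (hσd : MDifferentiableAt 𝓘(ℝ, ℝ) (𝓡 2) σ ℓ)
    (hσ : ∀ t ∈ Icc 0 ℓ, σ t = e (t • unitVec b (θ s₁))) : AreTangent σ ℓ γ s₁ := by
  set u : ℝ → V := fun s => e.symm (γ s) with hu
  have hℓ0 : 0 < ℓ := hℓ ▸ norm_pos_iff.2 hu0
  have hus : ContDiffAt ℝ 1 u s₁ := he.contDiffAt_symm_comp (by simp) hγ hγe
  have hub : u s₁ ∈ Metric.ball (0 : V) δ := by
    rw [← he.source]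
    exact e.map_target hγe
  have hu1 : u s₁ = ℓ • unitVec b (θ s₁) := by
    rw [hℓ]
    exact hθu.self_of_nhds
  have hrd := ((hus.norm ℝ hu0).differentiableAt one_ne_zero).hasDerivAt
  set ρ := deriv (fun s => ‖u s‖) s₁ with hρ
  -- In the product rule for the polar form of u the angular term carries the factor θ' = 0.
  have hud : HasDerivAt u (ρ • unitVec b (θ s₁)) s₁ := by
    have h1 := hrd.fun_smul ((hasDerivAt_unitVec b (θ s₁)).scomp s₁ hθ.hasDerivAt)
    rw [hθ0] at h1
    refine HasDerivAt.congr_of_eventuallyEq ?_ hθu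
    simpa using h1
  have hpush : ‖pushVec e (u s₁) (unitVec b (θ s₁))‖ = 1 := by
    have h := he.pullForm_self hℓ0.le (u := unitVec b (θ s₁)) (by rwa [← hu1])
    rw [← hu1, pullForm, real_inner_self_eq_norm_sq, norm_unitVec] at h
    exact (sq_eq_sq₀ (norm_nonneg _) zero_le_one).1 h
  -- The radial direction is pushed to a unit vector and γ has unit speed; the sign of ρ decides
  -- between the two cases of tangency.
  have hρ1 : |ρ| = 1 := by
    have h := he.velocity_eq hγ hγe
    change _ = ‖pushVec e (u s₁) (deriv u s₁)‖ at h
    rw [hunit, hud.deriv, map_smul, norm_smul, hpush, mul_one, Real.norm_eq_abs] at h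
    exact h.symm
  have hγ1 : γ s₁ = e (u s₁) := (e.right_inv hγe).symm
  have hxs : γ s₁ ∈ (chartAt Plane (γ s₁)).source := mem_chart_source Plane _
  have hx : e (u s₁) ∈ (chartAt Plane (γ s₁)).source := by rwa [← hγ1]
  have hσℓ : σ ℓ = γ s₁ := by rw [hσ ℓ ⟨hℓ0.le, le_rfl⟩, ← hu1, ← hγ1]
  have hγd : MDifferentiableAt 𝓘(ℝ, ℝ) (𝓡 2) γ s₁ := hγ.mdifferentiableAt one_ne_zero
  set D := chartDeriv (γ s₁) (e (u s₁)) (pushVec e (u s₁) (unitVec b (θ s₁))) with hD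
  have d1 : deriv (fun s => extChartAt (𝓡 2) (γ s₁) (γ s)) s₁ = ρ • D := by
    have h1 := (he.deriv_chart hud hub hx).2
    rw [map_smul, map_smul] at h1
    rw [hD, ← h1]
    refine Filter.EventuallyEq.deriv_eq ?_
    filter_upwards [hγ.continuousAt.eventually_mem (e.open_target.mem_nhds hγe)] with s hs
    rw [hu, e.right_inv hs]
  have d2 : deriv (fun t => extChartAt (𝓡 2) (γ s₁) (σ t)) ℓ = D := by
    have hray : HasDerivAt (fun t : ℝ => t • unitVec b (θ s₁)) (unitVec b (θ s₁)) ℓ := by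
      simpa using (hasDerivAt_id ℓ).smul_const (unitVec b (θ s₁))
    obtain ⟨h1, h2⟩ := he.deriv_chart hray (x := γ s₁) (by rwa [← hu1]) (by rwa [← hu1])
    have h3 : D = deriv (fun t : ℝ => extChartAt (𝓡 2) (γ s₁) (e (t • unitVec b (θ s₁)))) ℓ := by
      rw [h2, hD, hu1]
    rw [h3]
    -- σ is known to be a ray on [0, ℓ] only, so at the endpoint the derivatives are compared within
    -- this interval.
    refine deriv_eq_of_eqOn_Icc hℓ0 ⟨hℓ0.le, le_rfl⟩ ?_ h1 fun t ht => by simp only [hσ t ht]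
    have hmc : MDifferentiableAt (𝓡 2) 𝓘(ℝ, Plane) (extChartAt (𝓡 2) (γ s₁)) (σ ℓ) :=
      mdifferentiableAt_extChartAt (by rwa [hσℓ])
    exact (MDifferentiableAt.comp ℓ hmc hσd).differentiableAt
  have d3 := chartDeriv_velocity hγd (γ s₁) hxs
  rw [d1] at d3
  rcases (abs_eq zero_le_one).1 hρ1 with h | h
  · left
    rw [lift_eq_iff hσd (γ s₁) hxs]
    refine ⟨hσℓ, ?_⟩
    rw [d2, d3, h, one_smul]
  · right
    rw [lift_eq_iff hσd (γ s₁) hxs]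
    refine ⟨hσℓ, ?_⟩
    rw [d2, map_neg, d3, h, neg_smul, one_smul, neg_neg]

end Curves

/-! ### Totally normal neighbourhoods and convex curves -/

section TotallyNormal

variable {M : Type*} [MetricSpace M] [ChartedSpace Plane M] [IsManifold (𝓡 2) ∞ M]
  [RiemannianBundle (fun x : M => TangentSpace (𝓡 2) x)]
  [IsContMDiffRiemannianBundle (𝓡 2) ∞ Plane (fun x : M => TangentSpace (𝓡 2) x)]

lemma finiteDimensional_tangentSpace (p : M) : FiniteDimensional ℝ (TangentSpace (𝓡 2) p) :=
  inferInstanceAs (FiniteDimensional ℝ Plane)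

lemma IsTotallyNormal.exists_chart {U : Set M} (hU : IsTotallyNormal U) {p : M} (hp : p ∈ U) :
    ∃ δ > 0, ∃ e : OpenPartialHomeomorph (TangentSpace (𝓡 2) p) M, IsNormalChart e δ ∧
      EqOn e (expMap p) (Metric.ball 0 δ) ∧ U ⊆ e.target ∧ e 0 = p ∧
      ∀ w ∈ Metric.ball (0 : TangentSpace (𝓡 2) p) δ,
        lift (fun t : ℝ => e (t • w)) 0 = ⟨p, w⟩ := by
  obtain ⟨-, δ, hδ, h⟩ := hU
  obtain ⟨hn, hsub⟩ := h p hp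
  obtain ⟨e, he, heq, hl⟩ := hn.exists_chart
  refine ⟨δ, hδ, e, he, heq, fun q hq => ?_, ?_, hl⟩
  · obtain ⟨w, hw, rfl⟩ := hsub hq
    rw [← heq hw]
    exact e.map_source (by rwa [he.source])
  · have h0 := congrArg (·.1) (hl 0 (by simpa using hδ))
    simpa [lift] using h0

lemma IsNormalChart.isUnitGeodesic_ray {V : Type*} [NormedAddCommGroup V] [InnerProductSpace ℝ V]
    {e : OpenPartialHomeomorph V M} {δ : ℝ} (he : IsNormalChart e δ) {w : V}
    (hw : w ∈ Metric.ball (0 : V) δ) (hw0 : w ≠ 0) :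
    IsUnitGeodesic (fun t : ℝ => e (t • ‖w‖⁻¹ • w)) ‖w‖ (e 0) (e w) := by
  have hn : 0 < ‖w‖ := norm_pos_iff.2 hw0
  have hu : ‖‖w‖⁻¹ • w‖ = 1 := by
    rw [norm_smul, norm_inv, norm_norm, inv_mul_cancel₀ hn.ne']
  have hT : ‖w‖ • ‖w‖⁻¹ • w = w := by rw [smul_smul, mul_inv_cancel₀ hn.ne', one_smul]
  have hmem : ∀ t ∈ Icc 0 ‖w‖, t • ‖w‖⁻¹ • w ∈ Metric.ball (0 : V) δ := fun t ht =>
    mem_ball_of_mem_Icc (by rwa [hT]) ht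
  refine ⟨(he.geodesic_ray _).mono fun t ht => ⟨ht.1, hmem t ht⟩, fun t ht => ?_, ?_, ?_⟩
  · rw [he.norm_velocity_ray ht.1 (hmem t ht), hu]
  · simp
  · simp only [hT]

variable [IsRiemannianManifold (𝓡 2) M]

/-- The boundary curve of a strictly convex region is transversal to the geodesic chords. -/
lemma IsConvexCurve.not_areTangent {U : Set M} (hU : IsTotallyNormal U) {γ : ℝ → M}
    (hγ : ContMDiff 𝓘(ℝ, ℝ) (𝓡 2) 2 γ) (hunit : ∀ s, ‖velocity γ s‖ = 1) (hγU : ∀ s, γ s ∈ U)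
    {s₀ s₁ : ℝ} (hne : γ s₀ ≠ γ s₁) {σ : ℝ → M}
    (hσ : IsUnitGeodesic σ (genFun γ s₀ s₁) (γ s₀) (γ s₁)) {L : ℝ} (hL : IsConvexCurve U γ L) :
    ¬ AreTangent σ (genFun γ s₀ s₁) γ s₁ := by
  intro htan
  obtain ⟨D, hDc, -, hfr, hconv⟩ := hL.convex
  have hfrD (s : ℝ) : γ s ∈ frontier D := by
    rw [hfr]
    exact mem_range_self s
  have hD (s : ℝ) : γ s ∈ D := hDc.isClosed.frontier_subset (hfrD s)
  have := finiteDimensional_tangentSpace (γ s₁)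
  -- The chart is centred at the point of tangency, so that the chord is a ray from the origin and
  -- the curve passes through the origin.
  obtain ⟨δ, hδ, e, he, heq, hUe, he0, hl⟩ := hU.exists_chart (hγU s₁)
  set ℓ := genFun γ s₀ s₁ with hℓ
  have hℓ0 : 0 < ℓ := dist_pos.2 hne
  have hball {q : M} (hq : q ∈ U) :
      e.symm q ∈ Metric.ball (0 : TangentSpace (𝓡 2) (γ s₁)) δ := by
    rw [← he.source]
    exact e.map_target (hUe hq)
  have hℓδ : ℓ < δ := by
    have h := he.dist_eq (hball (hγU s₀))
    rw [e.right_inv (hUe (hγU s₀)), he0, dist_comm] at h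
    change ℓ = _ at h
    rw [h]
    simpa using hball (hγU s₀)
  have hσℓ := hσ.geodesic.mdifferentiableAt (t := ℓ) ⟨hℓ0.le, le_rfl⟩
  obtain ⟨ε, hε, hlift⟩ : ∃ ε : ℝ, |ε| = 1 ∧ lift σ ℓ = ⟨γ s₁, ε • velocity γ s₁⟩ := by
    rcases htan with h | h
    · exact ⟨1, by simp, by rw [h, one_smul]⟩
    · exact ⟨-1, by simp, by rw [h, neg_one_smul]⟩
  set v : TangentSpace (𝓡 2) (γ s₁) := (-1 : ℝ) • ε • velocity γ s₁ with hv
  have hv1 : ‖v‖ = 1 := by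
    rw [hv, norm_smul, norm_smul, hunit, Real.norm_eq_abs, Real.norm_eq_abs, hε]
    simp
  have hrev0 : (-1 : ℝ) * 0 + ℓ = ℓ := by ring
  have hrev : lift (fun τ => σ (-1 * τ + ℓ)) 0 = ⟨γ s₁, v⟩ :=
    lift_comp_affine (by rwa [hrev0]) (by rwa [hrev0])
  have hgeo : IsGeodesicOn (fun τ => σ (-1 * τ + ℓ)) (Icc 0 ℓ) :=
    hσ.geodesic.affine (-1) ℓ fun t ht => ⟨by linarith [ht.2], by linarith [ht.1]⟩
  -- The midpoint of the chord, reached from γ s₁ along the reversed geodesic; strict convexity puts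
  -- it in the interior.
  set w₀ : TangentSpace (𝓡 2) (γ s₁) := (ℓ / 2) • v with hw₀
  have hw₀n : ‖w₀‖ = ℓ / 2 := by
    rw [hw₀, norm_smul, hv1, mul_one, Real.norm_of_nonneg (by linarith)]
  have hw₀b : w₀ ∈ Metric.ball (0 : TangentSpace (𝓡 2) (γ s₁)) δ := by
    rw [mem_ball_zero_iff, hw₀n]
    linarith
  have hmid : e w₀ ∈ interior D := by
    rw [heq hw₀b, hw₀, expMap_smul hℓ0.le hgeo hrev ⟨by linarith, by linarith⟩]
    exact hconv _ (hD s₀) _ (hD s₁) hne σ hσ _ ⟨by linarith, by change _ < ℓ; linarith⟩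
  -- Seen from γ s₁ the interior is star-shaped: the ray to an interior point is the minimizing
  -- segment between two points of D.
  have hcone {w : TangentSpace (𝓡 2) (γ s₁)} {c : ℝ}
      (hw : w ∈ Metric.ball (0 : TangentSpace (𝓡 2) (γ s₁)) δ) (hw0 : w ≠ 0)
      (hwD : e w ∈ interior D) (hc : c ∈ Ioo (0 : ℝ) 1) : e (c • w) ∈ interior D := by
    have hn : 0 < ‖w‖ := norm_pos_iff.2 hw0
    have hdist := he.dist_eq hw
    have hne' : e 0 ≠ e w := by
      rw [← dist_pos, hdist]
      exact hn
    have h := hconv (e 0) (by rw [he0]; exact hD s₁) (e w) (interior_subset hwD) hne' _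
      (by rw [hdist]; exact he.isUnitGeodesic_ray hw hw0) (c * ‖w‖)
      (by rw [hdist]; exact ⟨mul_pos hc.1 hn, by nlinarith [hc.2]⟩)
    rwa [smul_smul, mul_assoc, mul_inv_cancel₀ hn.ne', mul_one] at h
  set u : ℝ → TangentSpace (𝓡 2) (γ s₁) := fun s => e.symm (γ s) with hu
  have h0b : (0 : TangentSpace (𝓡 2) (γ s₁)) ∈ Metric.ball 0 δ := by simpa using hδ
  have hu1 : u s₁ = 0 := by
    change e.symm (γ s₁) = 0
    conv_lhs => rw [← he0]
    exact e.left_inv (by rwa [he.source])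
  have hud : HasDerivAt u (deriv u s₁) s₁ :=
    ((he.contDiffAt_symm_comp ENat.LEInfty.out hγ.contMDiffAt (hUe (hγU s₁))).differentiableAt
      two_ne_zero).hasDerivAt
  have hxs : γ s₁ ∈ (chartAt Plane (γ s₁)).source := mem_chart_source Plane _
  have hwu : w₀ = (-(ε * (ℓ / 2))) • deriv u s₁ := by
    have h1 := (he.deriv_chart hud (x := γ s₁) (by rwa [hu1]) (by rwa [hu1, he0])).2
    have h2 : (fun s => extChartAt (𝓡 2) (γ s₁) (e (u s))) =
        fun s => extChartAt (𝓡 2) (γ s₁) (γ s) := by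
      funext s
      rw [hu, e.right_inv (hUe (hγU s))]
    rw [h2, ← chartDeriv_velocity (hγ.mdifferentiableAt two_ne_zero) (γ s₁) hxs, hu1] at h1
    have hray : HasDerivAt (fun t : ℝ => t • w₀) w₀ 0 := by
      simpa using (hasDerivAt_id (0 : ℝ)).smul_const w₀
    have hz : (0 : ℝ) • w₀ = 0 := zero_smul ℝ w₀
    have h3 := (he.deriv_chart hray (x := γ s₁) (by rwa [hz]) (by rwa [hz, he0])).2
    have h4 : MDifferentiableAt 𝓘(ℝ, ℝ) (𝓡 2) (fun t : ℝ => e (t • w₀)) 0 :=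
      (he.geodesic w₀ hw₀b).mdifferentiableAt ⟨le_rfl, zero_le_one⟩
    rw [deriv_chart_eq_of_lift h4 (hl w₀ hw₀b) (γ s₁) hxs, hz] at h3
    have hinj : Function.Injective fun a => chartDeriv (γ s₁) (e 0) (pushVec e 0 a) :=
      (chartDeriv_injective (γ s₁) (by rwa [he0])).comp (he.pushVec_injective h0b)
    refine hinj ?_
    simp only [map_smul]
    rw [← h1, ← h3]
    simp only [hw₀, hv, map_smul, smul_smul]
    congr 1
    ring
  -- At this rate, possibly backwards, the curve leaves γ s₁ with velocity exactly w₀.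
  set c : ℝ := -(ε * (ℓ / 2)) with hc
  have hg : HasDerivAt (fun t : ℝ => u (s₁ + t * c)) w₀ 0 := by
    have h1 : HasDerivAt (fun t : ℝ => s₁ + t * c) c 0 := by
      simpa using ((hasDerivAt_id (0 : ℝ)).mul_const c).const_add s₁
    have h2 : HasDerivAt u (deriv u s₁) (s₁ + 0 * c) := by rwa [zero_mul, add_zero]
    rw [hwu]
    exact HasDerivAt.scomp (h := fun t : ℝ => s₁ + t * c) (0 : ℝ) h2 h1
  have hslope : Tendsto (fun t : ℝ => t⁻¹ • u (s₁ + t * c)) (𝓝[>] 0) (𝓝 w₀) := by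
    have h1 := (hasDerivWithinAt_iff_tendsto_slope' (s := Ioi (0 : ℝ)) (by simp)).1
      hg.hasDerivWithinAt
    refine h1.congr fun t => ?_
    simp [slope, hu1]
  have hO : ∀ᶠ w in 𝓝 w₀, w ∈ Metric.ball (0 : TangentSpace (𝓡 2) (γ s₁)) δ ∧ w ≠ 0 ∧
      e w ∈ interior D := by
    have hw₀0 : w₀ ≠ 0 := by
      rw [← norm_pos_iff, hw₀n]
      linarith
    exact (Metric.isOpen_ball.eventually_mem hw₀b).and ((eventually_ne_nhds hw₀0).and
      ((he.contMDiffAt hw₀b).continuousAt.eventually_mem (isOpen_interior.mem_nhds hmid)))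
  -- The curve divided by t tends to w₀, so for small t it lies over the interior. Scaling back by t
  -- < 1 stays in the interior by `hcone`, although the curve runs in the frontier.
  obtain ⟨t, ⟨htb, ht0, htD⟩, ht⟩ :=
    ((hslope.eventually hO).and (Ioo_mem_nhdsGT (zero_lt_one' ℝ))).exists
  have hin := hcone htb ht0 htD ht
  rw [smul_smul, mul_inv_cancel₀ ht.1.ne', one_smul, hu, e.right_inv (hUe (hγU _))] at hin
  exact (hfrD (s₁ + t * c)).2 hin

variable {γ : ℝ → M} {s₀ s₁ δ : ℝ} {e : OpenPartialHomeomorph (TangentSpace (𝓡 2) (γ s₀)) M}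

lemma IsNormalChart.genFun_eq (he : IsNormalChart e δ) (hγe : ∀ s, γ s ∈ e.target)
    (he0 : e 0 = γ s₀) : genFun γ s₀ = fun s => ‖e.symm (γ s)‖ := by
  have := finiteDimensional_tangentSpace (γ s₀)
  funext s
  have h := he.dist_eq (w := e.symm (γ s)) (by rw [← he.source]; exact e.map_target (hγe s))
  rwa [e.right_inv (hγe s), he0] at h

/-- Since the chart is injective on its ball, the condition on the exponential map becomes a polar
decomposition of a curve in the tangent plane. -/
lemma IsNormalChart.isPolarAngle_iff (he : IsNormalChart e δ)
    (heq : EqOn e (expMap (γ s₀)) (Metric.ball 0 δ)) (hγe : ∀ s, γ s ∈ e.target)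
    (he0 : e 0 = γ s₀) (b : OrthonormalBasis (Fin 2) ℝ (TangentSpace (𝓡 2) (γ s₀))) (θ : ℝ → ℝ) :
    IsPolarAngle γ s₀ s₁ b θ ↔ ContinuousAt θ s₁ ∧
      ∀ᶠ s in 𝓝 s₁, e.symm (γ s) = ‖e.symm (γ s)‖ • unitVec b (θ s) := by
  refine and_congr_right fun _ => eventually_congr (Eventually.of_forall fun s => ?_)
  have hb : e.symm (γ s) ∈ e.source := e.map_target (hγe s)
  have hb' : ‖e.symm (γ s)‖ • unitVec b (θ s) ∈ Metric.ball 0 δ := by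
    rw [smul_unitVec_mem_ball b (norm_nonneg _)]
    rw [he.source] at hb
    simpa using hb
  have hp : polar (γ s₀) b (genFun γ s₀ s) (θ s) = e (‖e.symm (γ s)‖ • unitVec b (θ s)) := by
    rw [heq hb', he.genFun_eq hγe he0]
    rfl
  rw [hp]
  constructor
  · intro h
    conv_lhs => rw [h]
    exact e.left_inv (by rwa [he.source])
  · intro h
    rw [← h, e.right_inv (hγe s)]

/-- The geodesic chord of the curve is a ray of the normal chart. -/
lemma IsNormalChart.chord_eq (he : IsNormalChart e δ)
    (heq : EqOn e (expMap (γ s₀)) (Metric.ball 0 δ)) (hγe : ∀ s, γ s ∈ e.target)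
    (he0 : e 0 = γ s₀) (hne : γ s₀ ≠ γ s₁) {σ : ℝ → M}
    (hσ : IsUnitGeodesic σ (genFun γ s₀ s₁) (γ s₀) (γ s₁))
    {b : OrthonormalBasis (Fin 2) ℝ (TangentSpace (𝓡 2) (γ s₀))} {θ₁ : ℝ}
    (hθ : e.symm (γ s₁) = ‖e.symm (γ s₁)‖ • unitVec b θ₁) :
    ∀ t ∈ Icc 0 (genFun γ s₀ s₁), σ t = e (t • unitVec b θ₁) := by
  set ℓ := genFun γ s₀ s₁ with hℓ
  have hℓ0 : 0 < ℓ := dist_pos.2 hne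
  have hℓu : ℓ = ‖e.symm (γ s₁)‖ := congrFun (he.genFun_eq hγe he0) s₁
  obtain ⟨v, hv⟩ := exists_lift_eq hσ.source
  have hv1 : ‖v‖ = 1 := by
    rw [← hσ.unit_speed 0 ⟨le_rfl, hℓ0.le⟩]
    exact (congrArg (fun q : TangentBundle (𝓡 2) M => ‖q.2‖) hv).symm
  have hub : e.symm (γ s₁) ∈ e.source := e.map_target (hγe s₁)
  have hℓδ : ℓ < δ := by
    rw [he.source] at hub
    rw [hℓu]
    simpa using hub
  have hmem : ∀ t ∈ Icc 0 ℓ, t • v ∈ Metric.ball (0 : TangentSpace (𝓡 2) (γ s₀)) δ := by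
    intro t ht
    rw [mem_ball_zero_iff, norm_smul, hv1, mul_one, Real.norm_of_nonneg ht.1]
    exact ht.2.trans_lt hℓδ
  have hσe : ∀ t ∈ Icc 0 ℓ, σ t = e (t • v) := fun t ht => by
    rw [heq (hmem t ht), expMap_smul hℓ0.le hσ.geodesic hv ht]
  -- Both vectors lie in the ball and are sent to γ s₁, so injectivity of the chart identifies the
  -- initial direction of σ.
  have hℓv : ℓ • v = ℓ • unitVec b θ₁ := by
    have h := hσe ℓ ⟨hℓ0.le, le_rfl⟩
    rw [hσ.target] at h
    conv_rhs => rw [hℓu, ← hθ, h]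
    exact (e.left_inv (by rw [he.source]; exact hmem ℓ ⟨hℓ0.le, le_rfl⟩)).symm
  rwa [smul_right_injective _ hℓ0.ne' hℓv] at hσe

end TotallyNormal

end SurfaceBilliard

end

/-! ### The second derivative of the generating function -/

theorem mainTheorem3 {M : Type*} [MetricSpace M] [ChartedSpace SurfaceBilliard.Plane M]
    [IsManifold (𝓡 2) ∞ M]
    [RiemannianBundle (fun x : M => TangentSpace (𝓡 2) x)]
    [IsContMDiffRiemannianBundle (𝓡 2) ∞ SurfaceBilliard.Plane
      (fun x : M => TangentSpace (𝓡 2) x)]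
    [IsRiemannianManifold (𝓡 2) M]
    (U : Set M) (hU : SurfaceBilliard.IsTotallyNormal U)
    (γ : ℝ → M) (hγ : ContMDiff 𝓘(ℝ, ℝ) (𝓡 2) 2 γ)
    (hunit : ∀ s, ‖SurfaceBilliard.velocity γ s‖ = 1) (hγU : ∀ s, γ s ∈ U)
    (s₀ s₁ : ℝ) (hne : γ s₀ ≠ γ s₁)
    (hκ : SurfaceBilliard.geodesicCurvature γ s₁ = 0)
    (σ : ℝ → M)
    (hσ : SurfaceBilliard.IsUnitGeodesic σ (SurfaceBilliard.genFun γ s₀ s₁) (γ s₀) (γ s₁))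
    (J J' : ℝ → ℝ)
    (hJ : SurfaceBilliard.IsJacobiField σ (SurfaceBilliard.genFun γ s₀ s₁) J J')
    (b : OrthonormalBasis (Fin 2) ℝ (TangentSpace (𝓡 2) (γ s₀))) :
    ContDiffAt ℝ 2 (SurfaceBilliard.genFun γ s₀) s₁ ∧
    (∃ θ : ℝ → ℝ, SurfaceBilliard.IsPolarAngle γ s₀ s₁ b θ) ∧
    (∀ θ : ℝ → ℝ, SurfaceBilliard.IsPolarAngle γ s₀ s₁ b θ →
      ContDiffAt ℝ 2 θ s₁ ∧
      iteratedDeriv 2 (SurfaceBilliard.genFun γ s₀) s₁ =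
        deriv θ s₁ ^ 2 *
          (J (SurfaceBilliard.genFun γ s₀ s₁) * J' (SurfaceBilliard.genFun γ s₀ s₁))) ∧
    (¬ SurfaceBilliard.AreTangent σ (SurfaceBilliard.genFun γ s₀ s₁) γ s₁ →
      SignType.sign (iteratedDeriv 2 (SurfaceBilliard.genFun γ s₀) s₁) =
        SignType.sign
          (J (SurfaceBilliard.genFun γ s₀ s₁) * J' (SurfaceBilliard.genFun γ s₀ s₁))) ∧
    (∀ L : ℝ, SurfaceBilliard.IsConvexCurve U γ L →
      SignType.sign (iteratedDeriv 2 (SurfaceBilliard.genFun γ s₀) s₁) =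
        SignType.sign
          (J (SurfaceBilliard.genFun γ s₀ s₁) * J' (SurfaceBilliard.genFun γ s₀ s₁))) := by
  obtain ⟨δ, hδ, e, he, heq, hUe, he0, -⟩ := hU.exists_chart (hγU s₀)
  have hγe (s : ℝ) : γ s ∈ e.target := hUe (hγU s)
  have hH := he.genFun_eq hγe he0
  have hpolar := he.isPolarAngle_iff (s₁ := s₁) heq hγe he0 b
  have hℓ : SurfaceBilliard.genFun γ s₀ s₁ = ‖e.symm (γ s₁)‖ := congrFun hH s₁
  have hu : ContDiffAt ℝ 2 (fun s => e.symm (γ s)) s₁ :=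
    he.contDiffAt_symm_comp ENat.LEInfty.out hγ.contMDiffAt (hγe s₁)
  have hu0 : e.symm (γ s₁) ≠ 0 := by
    rw [← norm_pos_iff, ← hℓ]
    exact dist_pos.2 hne
  have hub : e.symm (γ s₁) ∈ Metric.ball 0 δ := by
    rw [← he.source]
    exact e.map_target (hγe s₁)
  have key (θ : ℝ → ℝ) (hθ : SurfaceBilliard.IsPolarAngle γ s₀ s₁ b θ) :
      ContDiffAt ℝ 2 θ s₁ ∧
      iteratedDeriv 2 (SurfaceBilliard.genFun γ s₀) s₁ = deriv θ s₁ ^ 2 *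
        (J (SurfaceBilliard.genFun γ s₀ s₁) * J' (SurfaceBilliard.genFun γ s₀ s₁)) := by
    obtain ⟨hθc, hθu⟩ := (hpolar θ).1 hθ
    -- Continuity at s₁ alone forces θ to be the `arcsin` branch near s₁, so every admissible angle
    -- inherits its regularity.
    have hθ2 : ContDiffAt ℝ 2 θ s₁ :=
      (SurfaceBilliard.contDiffAt_arcsin_angle b hu hθu.self_of_nhds hu0).congr_of_eventuallyEq
        (SurfaceBilliard.polarAngle_eventuallyEq b hθc (hu.continuousAt.eventually_ne hu0) hθu)
    have hchord := he.chord_eq heq hγe he0 hne hσ hθu.self_of_nhds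
    refine ⟨hθ2, ?_⟩
    rw [hℓ] at hchord hJ ⊢
    rw [hH, iteratedDeriv_succ, iteratedDeriv_one]
    exact he.deriv_deriv_norm b hu hu0 hub hγ.contMDiffAt
      (Filter.Eventually.of_forall fun s => (e.right_inv (hγe s)).symm) hκ hθ2 hθu hchord hJ
  obtain ⟨θ, hθ⟩ : ∃ θ : ℝ → ℝ, SurfaceBilliard.IsPolarAngle γ s₀ s₁ b θ :=
    (SurfaceBilliard.exists_polarAngle b hu hu0).imp fun θ h => (hpolar θ).2 h
  have hsign (htan : ¬ SurfaceBilliard.AreTangent σ (SurfaceBilliard.genFun γ s₀ s₁) γ s₁) :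
      SignType.sign (iteratedDeriv 2 (SurfaceBilliard.genFun γ s₀) s₁) = SignType.sign
        (J (SurfaceBilliard.genFun γ s₀ s₁) * J' (SurfaceBilliard.genFun γ s₀ s₁)) := by
    obtain ⟨hθ2, hform⟩ := key θ hθ
    have hθu := ((hpolar θ).1 hθ).2
    have hθ' : deriv θ s₁ ≠ 0 := fun h0 => htan <|
      he.areTangent_of_deriv_angle b (hγ.contMDiffAt.of_le one_le_two) (hγe s₁) (hunit s₁) hu0
        (hθ2.differentiableAt two_ne_zero) h0 hθu hℓ
        (hσ.geodesic.mdifferentiableAt ⟨dist_nonneg, le_rfl⟩)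
        (he.chord_eq heq hγe he0 hne hσ hθu.self_of_nhds)
    rw [hform, sign_mul, sign_pos (by positivity), one_mul]
  refine ⟨?_, ⟨θ, hθ⟩, key, hsign, fun L hL => hsign (hL.not_areTangent hU hγ hunit hγU hne hσ)⟩
  rw [hH]
  exact hu.norm ℝ hu0
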